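/- A network is a finite undirected multigraph $G=(V,\mathcal E)$ without self-loops, together with two distinct vertices $O$ (origin) and $D$ (destination), such that each vertex and each edge lies on at least one route; a route is a path from $O$ to $D$ that visits no vertex twice. A network is linearly independent (LI) if each route has at least one edge that belongs to no other route. The class of series of linearly independent (SLI) networks is the smallest class of networks that contains every LI network and that contains, with any two networks, the network obtained by connecting them in series, i.e. by identifying the destination of the first with the origin of the second. Then there is an algorithm that, given any network $G$ as a list of edges (with its vertices numbered and each edge given by its two end vertices), decides whether $G$ is SLI in $O(|\mathcal E|+|V|)$ steps. Here an algorithm is a program for a random access machine with unit costs, whose only arithmetic operations are successor and predecessor. -/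

import Mathlib

/-! ## Two-terminal networks -/

namespace TwoTerminal

variable {α : Type*} {β : Type*}

/-- `IsPath G u p v`: the list of edges `p` is a path of the undirected multigraph `G` from `u`
to `v`, that is, consecutive edges share an end vertex and no vertex is visited twice. -/
inductive IsPath (G : Graph α β) : α → List β → α → Prop
  | nil {u : α} : u ∈ G.vertexSet → IsPath G u [] u
  /-- The vertices of a nonempty path `p` are the end vertices of its edges, so the last two
  hypotheses say exactly that `u` is not a vertex of the path `p` from `w` to `v`. -/
  | cons {u w v : α} {e : β} {p : List β} :
      G.IsLink e u w → IsPath G w p v → u ≠ w → (∀ e' ∈ p, ¬ G.Inc e' u) →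
      IsPath G u (e :: p) v

/-- `(G, O, D)` is a network: a finite undirected multigraph without loops, with two distinct
terminals `O` (origin) and `D` (destination), in which every edge and every vertex lies on at least
one route, that is, on at least one path from `O` to `D`. -/
structure IsNetwork (G : Graph α β) (O D : α) : Prop where
  finite_vertexSet : G.vertexSet.Finite
  finite_edgeSet : G.edgeSet.Finite
  loopless : G.Loopless
  origin_mem : O ∈ G.vertexSet
  dest_mem : D ∈ G.vertexSet
  origin_ne_dest : O ≠ D
  edge_on_route : ∀ e ∈ G.edgeSet, ∃ r, IsPath G O r D ∧ e ∈ r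
  vertex_on_route : ∀ v ∈ G.vertexSet, ∃ r, IsPath G O r D ∧ ∃ e ∈ r, G.Inc e v

/-- A network is linearly independent (LI) if each route has at least one edge that does not
belong to any other route. -/
structure IsLI (G : Graph α β) (O D : α) : Prop where
  isNetwork : IsNetwork G O D
  exists_private_edge : ∀ r, IsPath G O r D →
    ∃ e ∈ r, ∀ r', IsPath G O r' D → e ∈ r' → r' = r

/-- `G` is the union of its subgraphs `G₁` and `G₂`, which have the vertex `c` in common and
nothing else. If `(G₁, O, c)` and `(G₂, c, D)` are networks, this says that `(G, O, D)` is
obtained by connecting them in series, the destination of the first being joined with the origin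
of the second. -/
structure IsGluedAt (G G₁ G₂ : Graph α β) (c : α) : Prop where
  left_le : G₁ ≤ G
  right_le : G₂ ≤ G
  vertexSet_eq : G₁.vertexSet ∪ G₂.vertexSet = G.vertexSet
  edgeSet_eq : G₁.edgeSet ∪ G₂.edgeSet = G.edgeSet
  inter_vertexSet : G₁.vertexSet ∩ G₂.vertexSet = {c}
  disjoint_edgeSet : Disjoint G₁.edgeSet G₂.edgeSet

/-- Series of linearly independent networks (SLI): a single LI network, or two SLI networks
connected in series. -/
inductive IsSLI : Graph α β → α → α → Prop
  | of_isLI {G : Graph α β} {O D : α} : IsLI G O D → IsSLI G O D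
  | series {G G₁ G₂ : Graph α β} {O c D : α} :
      IsSLI G₁ O c → IsSLI G₂ c D → IsGluedAt G G₁ G₂ c → IsSLI G O D

end TwoTerminal

/-! ## A random access machine with unit costs -/

namespace Ram

/-- The memory: registers `reg 0, reg 1, …` and arrays `arr 0, arr 1, …` of natural numbers.
A program mentions only finitely many registers and arrays. -/
structure State where
  reg : ℕ → ℕ
  arr : ℕ → ℕ → ℕ

/-- The tests: comparison of two registers. -/
inductive Test
  | eq (x y : ℕ)
  | lt (x y : ℕ)

def Test.Holds : Test → State → Prop
  | .eq x y, s => s.reg x = s.reg y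
  | .lt x y, s => s.reg x < s.reg y

/-- Programs. The only arithmetic operations are successor and predecessor, so that after `t` steps
no memory cell holds a number larger than `t` plus the largest number in the input and
in the text of the program; unit cost is therefore not exploited through long numbers. -/
inductive Prog
  | skip
  | const (x k : ℕ)
  | move (x y : ℕ)
  | succ (x : ℕ)
  | pred (x : ℕ)
  | load (x a i : ℕ)
  | store (a i x : ℕ)
  | seq (p q : Prog)
  | cond (b : Test) (p q : Prog)
  | loop (b : Test) (p : Prog)

def State.setReg (s : State) (x k : ℕ) : State :=
  { s with reg := Function.update s.reg x k }

def State.setArr (s : State) (a i k : ℕ) : State :=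
  { s with arr := Function.update s.arr a (Function.update (s.arr a) i k) }

/-- `Runs p s t s'`: started in state `s`, the program `p` halts after exactly `t` steps in
state `s'`. Every elementary instruction and every evaluation of a test is one step. -/
inductive Runs : Prog → State → ℕ → State → Prop
  | skip {s} : Runs .skip s 1 s
  | const {s x k} : Runs (.const x k) s 1 (s.setReg x k)
  | move {s x y} : Runs (.move x y) s 1 (s.setReg x (s.reg y))
  | succ {s x} : Runs (.succ x) s 1 (s.setReg x (s.reg x + 1))
  | pred {s x} : Runs (.pred x) s 1 (s.setReg x (s.reg x - 1))
  | load {s x a i} : Runs (.load x a i) s 1 (s.setReg x (s.arr a (s.reg i)))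
  | store {s a i x} : Runs (.store a i x) s 1 (s.setArr a (s.reg i) (s.reg x))
  | seq {p q s s' s'' t t'} : Runs p s t s' → Runs q s' t' s'' → Runs (.seq p q) s (t + t') s''
  | cond_true {b p q s s' t} : b.Holds s → Runs p s t s' → Runs (.cond b p q) s (t + 1) s'
  | cond_false {b p q s s' t} : ¬ b.Holds s → Runs q s t s' → Runs (.cond b p q) s (t + 1) s'
  | loop_true {b p s s' s'' t t'} : b.Holds s → Runs p s t s' → Runs (.loop b p) s' t' s'' →
      Runs (.loop b p) s (t + t' + 1) s''
  | loop_false {b p s} : ¬ b.Holds s → Runs (.loop b p) s 1 s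

end Ram

/-! ## Networks as inputs -/

/-- A network as a list of edges: the vertices are the numbers below `numV`, the edges are the
numbers below `numE`, and edge `i` has the end vertices `fst i` and `snd i`. The values of `fst` and
`snd` at `i ≥ numE` are not part of the input. -/
structure EdgeList where
  numV : ℕ
  numE : ℕ
  origin : ℕ
  dest : ℕ
  fst : ℕ → ℕ
  snd : ℕ → ℕ

namespace EdgeList

/-- The edge list `I` represents `(G, O, D)`: the vertices and the edges of `G` are numbered (in any
order), and each edge is given by its two end vertices (in any order). -/
def Represents {α : Type*} {β : Type*} (I : EdgeList) (G : Graph α β) (O D : α) : Prop :=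
  ∃ (v : ℕ → α) (e : ℕ → β),
    Set.BijOn v (Set.Iio I.numV) G.vertexSet ∧
    Set.BijOn e (Set.Iio I.numE) G.edgeSet ∧
    I.origin < I.numV ∧ v I.origin = O ∧
    I.dest < I.numV ∧ v I.dest = D ∧
    ∀ i < I.numE, I.fst i < I.numV ∧ I.snd i < I.numV ∧
      G.IsLink (e i) (v (I.fst i)) (v (I.snd i))

/-- The initial memory: the four numbers are in registers `0` to `3`, the end vertices of the edges
are in arrays `0` and `1`, and all other cells hold `0`. -/
def initState (I : EdgeList) : Ram.State where
  reg x :=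
    match x with
    | 0 => I.numV
    | 1 => I.numE
    | 2 => I.origin
    | 3 => I.dest
    | _ => 0
  arr a i :=
    if i < I.numE then
      match a with
      | 0 => I.fst i
      | 1 => I.snd i
      | _ => 0
    else 0

end EdgeList

/-! The network is simplified by two moves for as long as possible. Two parallel edges are merged
into one edge, which is marked thick. An inner vertex with exactly two edges, which lead to distinct
neighbours and one of which is thin, is removed by contracting a thin edge.

A thick edge stands for parallel edges, and these can be exchanged in every route that uses one of
them. No other edge of such a route can be private, so a route may have at most one thick edge, and
this edge must be its private one. This is the condition in `IsThickLI`. With this notion both moves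
preserve, in both directions, being a series of linearly independent networks:
`IsThickSLI.removesEdge`, `IsThickSLI.of_removesEdge`, `IsThickSLI.contracts` and
`IsThickSLI.of_contracts`. The delicate case is the contraction at a vertex at which two parts are
joined (`Contracts.isThickSLI_of_glued`).

Suppose that no move is possible and that the network is such a series. In a linearly independent
part each inner vertex has at least three neighbours, since otherwise a route through it would have
two thick edges. Then every route of the part is a single edge (`IsThickLI.route_length`): two ears
attached to the ends of the private edge of a longest route yield either a longer route or a second
route through the private edge. Absence of parallel edges now leaves only a chain, so the number of
edges is one less than the number of vertices (`IsThickSLI.card`). Conversely, each inner vertex of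
a network has at least two edges and each terminal at least one; if the number of edges is one less
than that of vertices, equality holds everywhere, the network is a chain, and a chain is a series of
single edges (`IsNetwork.isThickSLI_of_card`). So a count decides at the end (`Reduced.decide`).

For linear time, a vertex is visited by scanning its list of edges, merging parallel ones, only
until the list is exhausted or three neighbours are known. In the second case the rest of the list
need not be read: merging does not destroy neighbours, and a contraction puts both ends of the
contracted edge back on the work list. Apart from at most three edges per visit, every scanned edge
leaves the list for good. The potential in `Ready` gives 40 steps to each list entry, 300 to each
entry of the work list and 800 to each vertex; every visit is paid for by its decrease
(`Ready.visit`). -/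

namespace TwoTerminal

variable {α β α' β' : Type*} {G H : Graph α β} {u v w x y z : α} {e f : β} {p q : List β}

/-! ## Paths -/

theorem IsPath.left_mem (h : IsPath G u p v) : u ∈ G.vertexSet := by
  cases h with
  | nil h => exact h
  | cons h => exact h.left_mem

theorem IsPath.right_mem (h : IsPath G u p v) : v ∈ G.vertexSet := by
  induction h with
  | nil h => exact h
  | cons _ _ _ _ ih => exact ih

theorem IsPath.edge_mem (h : IsPath G u p v) (he : e ∈ p) : e ∈ G.edgeSet := by
  induction h with
  | nil h => simp at he
  | cons h _ _ _ ih =>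
    rcases List.mem_cons.1 he with rfl | he
    · exact h.edge_mem
    · exact ih he

theorem IsPath.eq_of_nil (h : IsPath G u [] v) : u = v := by
  cases h; rfl

theorem IsPath.ne_nil (h : IsPath G u p v) (huv : u ≠ v) : p ≠ [] := by
  rintro rfl; exact huv h.eq_of_nil

theorem IsPath.cons_inv (h : IsPath G u (e :: p) v) :
    ∃ w, G.IsLink e u w ∧ IsPath G w p v ∧ u ≠ w ∧ ∀ e' ∈ p, ¬ G.Inc e' u := by
  cases h with
  | cons h1 h2 h3 h4 => exact ⟨_, h1, h2, h3, h4⟩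

theorem IsPath.single (h : G.IsLink e u v) (huv : u ≠ v) : IsPath G u [e] v :=
  .cons h (.nil h.right_mem) huv (by simp)

/-- The vertex `x` lies on the path `p` that starts in `u`. -/
def OnPath (G : Graph α β) (u : α) (p : List β) (x : α) : Prop :=
  x = u ∨ ∃ e ∈ p, G.Inc e x

theorem OnPath.start : OnPath G u p u := .inl rfl

theorem onPath_nil : OnPath G u [] x ↔ x = u := by simp [OnPath]

theorem onPath_cons (h : G.IsLink e u w) :
    OnPath G u (e :: p) x ↔ x = u ∨ OnPath G w p x := by
  unfold OnPath
  constructor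
  · rintro (rfl | ⟨e', he', hx⟩)
    · exact .inl rfl
    · rcases List.mem_cons.1 he' with rfl | he'
      · rcases hx.eq_or_eq_of_isLink h with rfl | rfl <;> simp
      · exact .inr (.inr ⟨e', he', hx⟩)
  · rintro (rfl | rfl | ⟨e', he', hx⟩)
    · exact .inl rfl
    · exact .inr ⟨e, by simp, h.inc_right⟩
    · exact .inr ⟨e', by simp [he'], hx⟩

theorem not_onPath_tail (h : G.IsLink e u w) (hne : u ≠ w) (hp : ∀ e' ∈ p, ¬ G.Inc e' u) :
    ¬ OnPath G w p u := by
  rintro (rfl | ⟨e', he', hx⟩)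
  · exact hne rfl
  · exact hp e' he' hx

theorem IsPath.cons' (h : G.IsLink e u w) (hp : IsPath G w p v) (hu : ¬ OnPath G w p u) :
    IsPath G u (e :: p) v :=
  .cons h hp (fun h => hu (.inl h)) (fun e' he' hi => hu (.inr ⟨e', he', hi⟩))

theorem IsPath.onPath_end (h : IsPath G u p v) : OnPath G u p v := by
  induction h with
  | nil h => exact .inl rfl
  | cons h _ _ _ ih => exact (onPath_cons h).2 (.inr ih)

theorem IsPath.ne_of_isLink (h : IsPath G u p v) (he : e ∈ p) (hl : G.IsLink e x y) : x ≠ y := by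
  induction h with
  | nil h => simp at he
  | cons h _ hne _ ih =>
    rcases List.mem_cons.1 he with rfl | he
    · rcases h.eq_and_eq_or_eq_and_eq hl with ⟨rfl, rfl⟩ | ⟨rfl, rfl⟩
      · exact hne
      · exact hne.symm
    · exact ih he

theorem onPath_append (hp : IsPath G u p w) :
    OnPath G u (p ++ q) x ↔ OnPath G u p x ∨ OnPath G w q x := by
  induction hp with
  | nil h => simp only [List.nil_append, onPath_nil]; exact ⟨.inr, fun h => h.elim (fun h => .inl h) id⟩
  | cons h _ _ _ ih => rw [List.cons_append, onPath_cons h, onPath_cons h, ih, or_assoc]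

theorem IsPath.append (hp : IsPath G u p w) (hq : IsPath G w q v)
    (hd : ∀ x, OnPath G u p x → OnPath G w q x → x = w) : IsPath G u (p ++ q) v := by
  induction hp with
  | nil h => exact hq
  | cons h hp hne hin ih =>
    refine .cons' h (ih hq fun x h1 h2 => hd x ((onPath_cons h).2 (.inr h1)) h2) ?_
    intro h1
    rcases (onPath_append hp).1 h1 with h1 | h1
    · exact not_onPath_tail h hne hin h1
    · obtain rfl := hd _ .start h1
      exact not_onPath_tail h hne hin hp.onPath_end

theorem IsPath.split (h : IsPath G u (p ++ q) v) :
    ∃ w, IsPath G u p w ∧ IsPath G w q v ∧ ∀ x, OnPath G u p x → OnPath G w q x → x = w := by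
  induction p generalizing u with
  | nil => exact ⟨u, .nil h.left_mem, h, fun x hx _ => onPath_nil.1 hx⟩
  | cons e p ih =>
    obtain ⟨w, hl, hp, hne, hin⟩ := h.cons_inv
    obtain ⟨w', h1, h2, h3⟩ := ih hp
    refine ⟨w', .cons hl h1 hne fun e' he' => hin e' (by simp [he']), h2, fun x hx hx' => ?_⟩
    rcases (onPath_cons hl).1 hx with rfl | hx
    · exact absurd ((onPath_append h1).2 (.inr hx')) (not_onPath_tail hl hne hin)
    · exact h3 x hx hx'

/-- A path can be cut at each of its vertices. -/
theorem IsPath.exists_split (h : IsPath G u p v) (hx : OnPath G u p x) :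
    ∃ p₁ p₂, p = p₁ ++ p₂ ∧ IsPath G u p₁ x ∧ IsPath G x p₂ v ∧
      ∀ z, OnPath G u p₁ z → OnPath G x p₂ z → z = x := by
  induction h with
  | @nil u h => obtain rfl := onPath_nil.1 hx; exact ⟨[], [], rfl, .nil h, .nil h, fun z hz _ => onPath_nil.1 hz⟩
  | @cons u w v e p h hp hne hin ih =>
    by_cases hxu : x = u
    · subst hxu
      exact ⟨[], e :: p, rfl, .nil h.left_mem, .cons h hp hne hin, fun z hz _ => onPath_nil.1 hz⟩
    · obtain ⟨p₁, p₂, rfl, h1, h2, h3⟩ := ih (((onPath_cons h).1 hx).resolve_left hxu)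
      refine ⟨e :: p₁, p₂, rfl, .cons h h1 hne fun e' he' => hin e' (by simp [he']), h2, ?_⟩
      intro z hz hz'
      rcases (onPath_cons h).1 hz with rfl | hz
      · exact absurd ((onPath_append h1).2 (.inr hz')) (not_onPath_tail h hne hin)
      · exact h3 z hz hz'

/-- The two claims need a joint induction: to append the first edge at the far end, one must know
that its start is not a vertex of the reversed tail. -/
theorem IsPath.reverse (h : IsPath G u p v) :
    IsPath G v p.reverse u ∧ ∀ x, OnPath G v p.reverse x ↔ OnPath G u p x := by
  induction h with
  | nil h => exact ⟨.nil h, fun x => by simp⟩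
  | @cons u w v e p h hp hne hin ih =>
    obtain ⟨ih1, ih2⟩ := ih
    have hs : IsPath G w [e] u := .single h.symm hne.symm
    have ho : ∀ x, OnPath G w [e] x ↔ x = w ∨ x = u := fun x => by
      rw [onPath_cons h.symm, onPath_nil]
    refine ⟨?_, fun x => ?_⟩
    · rw [List.reverse_cons]
      refine ih1.append hs fun x h1 h2 => ?_
      rcases (ho x).1 h2 with rfl | rfl
      · rfl
      · exact absurd ((ih2 _).1 h1) (not_onPath_tail h hne hin)
    · rw [List.reverse_cons, onPath_append ih1, ho, onPath_cons h, ih2]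
      constructor
      · rintro (h1 | rfl | rfl)
        · exact .inr h1
        · exact .inr .start
        · exact .inl rfl
      · rintro (rfl | h1)
        · exact .inr (.inr rfl)
        · exact .inl h1

theorem IsPath.mono (h : IsPath H u p v) (hle : H ≤ G) : IsPath G u p v := by
  induction h with
  | nil h => exact .nil (hle.vertexSet_mono h)
  | cons h hp hne hin ih =>
    refine .cons (h.mono hle) ih hne fun e' he' hi => hin e' he' ?_
    exact (hle.inc_congr (hp.edge_mem he')).2 hi

theorem IsPath.anti (h : IsPath G u p v) (hle : H ≤ G) (hu : u ∈ H.vertexSet)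
    (hp : ∀ e ∈ p, e ∈ H.edgeSet) : IsPath H u p v := by
  induction h with
  | nil h => exact .nil hu
  | cons h _ hne hin ih =>
    have hl := (hle.isLink_iff (hp _ (by simp))).2 h
    exact .cons hl (ih hl.right_mem fun e he => hp e (by simp [he])) hne
      fun e' he' hi => hin e' he' (hi.mono hle)

theorem onPath_congr_of_le (hle : H ≤ G) (hp : ∀ e ∈ p, e ∈ H.edgeSet) :
    OnPath H u p x ↔ OnPath G u p x := by
  unfold OnPath
  exact or_congr_right (exists_congr fun e => and_congr_right fun he => hle.inc_congr (hp e he))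

theorem IsPath.mem_of_onPath (h : IsPath G u p v) (hx : OnPath G u p x) : x ∈ G.vertexSet := by
  rcases hx with rfl | ⟨e, _, hi⟩
  · exact h.left_mem
  · exact hi.vertex_mem

theorem IsPath.exists_first (h : IsPath G u p v) (hne : p ≠ []) : ∃ e ∈ p, G.Inc e u := by
  cases h with
  | nil => exact absurd rfl hne
  | cons h => exact ⟨_, by simp, h.inc_left⟩

theorem IsPath.exists_last (h : IsPath G u p v) (hne : p ≠ []) : ∃ e ∈ p, G.Inc e v := by
  obtain ⟨e, he, hi⟩ := h.reverse.1.exists_first (by simpa using hne)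
  exact ⟨e, by simpa using he, hi⟩

theorem IsPath.eq_of_inc_start (h : IsPath G u (e :: p) v) (hf : f ∈ e :: p) (hi : G.Inc f u) :
    f = e := by
  obtain ⟨w, _, _, _, hin⟩ := h.cons_inv
  rcases List.mem_cons.1 hf with rfl | hf
  · rfl
  · exact absurd hi (hin f hf)

theorem IsPath.nodup (h : IsPath G u p v) : p.Nodup := by
  induction h with
  | nil => exact .nil
  | cons h _ _ hin ih => exact List.nodup_cons.2 ⟨fun hm => hin _ hm h.inc_left, ih⟩

/-- After its first edge a path does not return to its start, whereas an edge parallel to the first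
one would. -/
theorem IsPath.eq_of_parallel (h : IsPath G u p v) (he : e ∈ p) (hf : f ∈ p)
    (h1 : G.IsLink e x y) (h2 : G.IsLink f x y) : e = f := by
  induction h with
  | nil => simp at he
  | cons h _ _ hin ih =>
    have key : ∀ {e f}, G.IsLink e x y → G.IsLink f x y → ∀ z, G.Inc e z → G.Inc f z :=
      fun h1 h2 z hz => by
        rcases hz.eq_or_eq_of_isLink h1 with rfl | rfl
        · exact h2.inc_left
        · exact h2.inc_right
    rcases List.mem_cons.1 he with rfl | he' <;> rcases List.mem_cons.1 hf with rfl | hf'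
    · rfl
    · exact absurd (key h1 h2 _ h.inc_left) (hin _ hf')
    · exact absurd (key h2 h1 _ h.inc_left) (hin _ he')
    · exact ih he' hf'

/-- Two routes one of which uses only edges of the other are equal. -/
theorem IsPath.eq_of_subset (h : IsPath G u p v) (h' : IsPath G u q v)
    (hpq : ∀ e ∈ p, e ∈ q) : p = q := by
  induction h generalizing q with
  | @nil u hu =>
    cases q with
    | nil => rfl
    | cons e q =>
      obtain ⟨w', hl, hp', hne, hin'⟩ := h'.cons_inv
      exact absurd hp'.onPath_end (not_onPath_tail hl hne hin')
  | @cons u w v e p h hp hne hin ih =>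
    cases q with
    | nil => simpa using hpq e
    | cons e' q =>
      -- The other path has only one edge at `u`, its first, so both paths begin with the same edge.
      have hee : e = e' := h'.eq_of_inc_start (hpq e (by simp)) h.inc_left
      subst hee
      obtain ⟨w', hl, hp', _, hin'⟩ := h'.cons_inv
      obtain rfl := h.right_unique hl
      rw [ih hp' fun f hf => ?_]
      rcases List.mem_cons.1 (hpq f (by simp [hf])) with rfl | h4
      · exact absurd h.inc_left (hin _ hf)
      · exact h4

/-- If `x` is an inner vertex of a path then two edges of the path meet in `x`. -/
theorem IsPath.exists_two_edges (h : IsPath G u p v) (hx : OnPath G u p x) (hxu : x ≠ u)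
    (hxv : x ≠ v) : ∃ e ∈ p, ∃ f ∈ p, e ≠ f ∧ G.Inc e x ∧ G.Inc f x := by
  obtain ⟨p₁, p₂, rfl, h1, h2, h3⟩ := h.exists_split hx
  obtain ⟨e, he, hex⟩ := h1.exists_last (h1.ne_nil hxu.symm)
  obtain ⟨f, hf, hfx⟩ := h2.exists_first (h2.ne_nil hxv)
  refine ⟨e, by simp [he], f, by simp [hf], ?_, hex, hfx⟩
  -- A common edge of both pieces would have both ends at their only common vertex, so it would be a
  -- loop.
  rintro rfl
  obtain ⟨y, hy⟩ := hex
  exact h1.ne_of_isLink he hy (h3 y (.inr ⟨e, he, hy.inc_right⟩) (.inr ⟨e, hf, hy.inc_right⟩)).symm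

end TwoTerminal

namespace TwoTerminal

variable {α β α' β' : Type*} {G H : Graph α β} {u v w x y z O D : α} {e f : β} {p q r : List β}

/-! ## Subgraphs given by a set of vertices and a set of edges -/

/-- The subgraph with the vertices in `X` and the edges in `F` both of whose ends are in `X`. -/
def sub (G : Graph α β) (X : Set α) (F : Set β) : Graph α β where
  vertexSet := G.vertexSet ∩ X
  IsLink e x y := G.IsLink e x y ∧ e ∈ F ∧ x ∈ X ∧ y ∈ X
  isLink_symm _ _ := ⟨fun _ _ h => ⟨h.1.symm, h.2.1, h.2.2.2, h.2.2.1⟩⟩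
  eq_or_eq_of_isLink_of_isLink _ _ _ _ _ h h' := h.1.left_eq_or_eq h'.1
  left_mem_of_isLink _ _ _ h := ⟨h.1.left_mem, h.2.2.1⟩

/-- `X` and `F` are the vertices and the edges of a subgraph of `G`. -/
structure IsSubPair (G : Graph α β) (X : Set α) (F : Set β) : Prop where
  vert : X ⊆ G.vertexSet
  edge : F ⊆ G.edgeSet
  ends : ∀ e ∈ F, ∀ x, G.Inc e x → x ∈ X

section sub

variable {X Y : Set α} {F K : Set β}

theorem IsSubPair.sub_vertexSet (h : IsSubPair G X F) : (sub G X F).vertexSet = X :=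
  Set.inter_eq_right.2 h.vert

theorem IsSubPair.sub_isLink (h : IsSubPair G X F) :
    (sub G X F).IsLink e x y ↔ e ∈ F ∧ G.IsLink e x y :=
  ⟨fun hl => ⟨hl.2.1, hl.1⟩, fun hl => ⟨hl.2, hl.1, h.ends _ hl.1 _ hl.2.inc_left,
    h.ends _ hl.1 _ hl.2.inc_right⟩⟩

theorem IsSubPair.sub_edgeSet (h : IsSubPair G X F) : (sub G X F).edgeSet = F := by
  ext e
  rw [Graph.edge_mem_iff_exists_isLink]
  simp only [h.sub_isLink]
  constructor
  · rintro ⟨x, y, h1, _⟩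
    exact h1
  · intro he
    obtain ⟨x, y, hl⟩ := G.exists_isLink_of_mem_edgeSet (h.edge he)
    exact ⟨x, y, he, hl⟩

theorem sub_le : sub G X F ≤ G := ⟨Set.inter_subset_left, fun _ _ _ h => h.1⟩

theorem isGluedAt_sub (h1 : IsSubPair G X F) (h2 : IsSubPair G Y K)
    (hV : X ∪ Y = G.vertexSet) (hE : F ∪ K = G.edgeSet) {c : α} (hc : X ∩ Y = {c})
    (hd : Disjoint F K) : IsGluedAt G (sub G X F) (sub G Y K) c where
  left_le := sub_le
  right_le := sub_le
  vertexSet_eq := by rw [h1.sub_vertexSet, h2.sub_vertexSet, hV]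
  edgeSet_eq := by rw [h1.sub_edgeSet, h2.sub_edgeSet, hE]
  inter_vertexSet := by rw [h1.sub_vertexSet, h2.sub_vertexSet, hc]
  disjoint_edgeSet := by rwa [h1.sub_edgeSet, h2.sub_edgeSet]

end sub

theorem IsGluedAt.symm {G G₁ G₂ : Graph α β} {c : α} (h : IsGluedAt G G₁ G₂ c) :
    IsGluedAt G G₂ G₁ c where
  left_le := h.right_le
  right_le := h.left_le
  vertexSet_eq := by rw [Set.union_comm, h.vertexSet_eq]
  edgeSet_eq := by rw [Set.union_comm, h.edgeSet_eq]
  inter_vertexSet := by rw [Set.inter_comm, h.inter_vertexSet]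
  disjoint_edgeSet := h.disjoint_edgeSet.symm

theorem IsGluedAt.left_mem_iff {G G₁ G₂ : Graph α β} {c : α} (h : IsGluedAt G G₁ G₂ c)
    (hx : x ∈ G₁.vertexSet) : x ∈ G₂.vertexSet ↔ x = c := by
  have h1 : x ∈ G₁.vertexSet ∩ G₂.vertexSet ↔ x = c := by rw [h.inter_vertexSet]; rfl
  rw [← h1]
  exact ⟨fun h => ⟨hx, h⟩, fun h => h.2⟩

/-- Every edge of `G` at a vertex of `G₁` other than `c` belongs to `G₁`. -/
theorem IsGluedAt.isLink_left {G G₁ G₂ : Graph α β} {c : α} (h : IsGluedAt G G₁ G₂ c)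
    (hx : x ∈ G₁.vertexSet) (hxc : x ≠ c) (hl : G.IsLink e x y) : G₁.IsLink e x y := by
  have he : e ∈ G₁.edgeSet ∪ G₂.edgeSet := by rw [h.edgeSet_eq]; exact hl.edge_mem
  rcases he with he | he
  · exact (h.left_le.isLink_iff he).2 hl
  · have := ((h.right_le.isLink_iff he).2 hl).left_mem
    exact absurd ((h.left_mem_iff hx).1 this) hxc

/-! ## Networks with thick edges -/

theorem IsNetwork.reverse (h : IsNetwork G O D) : IsNetwork G D O where
  finite_vertexSet := h.finite_vertexSet
  finite_edgeSet := h.finite_edgeSet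
  loopless := h.loopless
  origin_mem := h.dest_mem
  dest_mem := h.origin_mem
  origin_ne_dest := h.origin_ne_dest.symm
  edge_on_route e he := by
    obtain ⟨r, hr, her⟩ := h.edge_on_route e he
    exact ⟨r.reverse, hr.reverse.1, by simpa⟩
  vertex_on_route v hv := by
    obtain ⟨r, hr, e, he, hi⟩ := h.vertex_on_route v hv
    exact ⟨r.reverse, hr.reverse.1, e, by simpa, hi⟩

/-- Linear independence of a network each of whose edges in `T` (the thick edges) stands for
a pair of parallel edges. -/
structure IsThickLI (T : Set β) (G : Graph α β) (O D : α) : Prop where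
  isNetwork : IsNetwork G O D
  exists_private_edge : ∀ r, IsPath G O r D →
    ∃ e ∈ r, (∀ r', IsPath G O r' D → e ∈ r' → r' = r) ∧ ∀ f ∈ r, f ∈ T → f = e

/-- Series of linearly independent networks with a set `T` of thick edges. -/
inductive IsThickSLI (T : Set β) : Graph α β → α → α → Prop
  | of_isThickLI {G : Graph α β} {O D : α} : IsThickLI T G O D → IsThickSLI T G O D
  | series {G G₁ G₂ : Graph α β} {O c D : α} :
      IsThickSLI T G₁ O c → IsThickSLI T G₂ c D → IsGluedAt G G₁ G₂ c → IsThickSLI T G O D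

theorem isThickSLI_empty : IsThickSLI ∅ G O D ↔ IsSLI G O D := by
  constructor
  · intro h
    induction h with
    | of_isThickLI h =>
      refine .of_isLI ⟨h.1, fun r hr => ?_⟩
      obtain ⟨e, he, h1, _⟩ := h.2 r hr
      exact ⟨e, he, h1⟩
    | series _ _ hg ih1 ih2 => exact .series ih1 ih2 hg
  · intro h
    induction h with
    | of_isLI h =>
      refine .of_isThickLI ⟨h.1, fun r hr => ?_⟩
      obtain ⟨e, he, h1⟩ := h.2 r hr
      exact ⟨e, he, h1, by simp⟩
    | series _ _ hg ih1 ih2 => exact .series ih1 ih2 hg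

theorem IsThickSLI.origin_mem {T : Set β} (h : IsThickSLI T G O D) : O ∈ G.vertexSet := by
  induction h with
  | of_isThickLI h => exact h.1.origin_mem
  | series _ _ hg ih1 _ => exact hg.left_le.vertexSet_mono ih1

theorem IsThickLI.reverse {T : Set β} (h : IsThickLI T G O D) : IsThickLI T G D O := by
  refine ⟨h.1.reverse, fun r hr => ?_⟩
  obtain ⟨e, he, h1, h2⟩ := h.2 _ hr.reverse.1
  refine ⟨e, by simpa using he, fun r' hr' he' => ?_, fun f hf => h2 f (by simpa)⟩
  exact List.reverse_injective (h1 _ hr'.reverse.1 (by simpa))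

theorem IsThickSLI.reverse {T : Set β} (h : IsThickSLI T G O D) : IsThickSLI T G D O := by
  induction h with
  | of_isThickLI h => exact .of_isThickLI h.reverse
  | series _ _ hg ih1 ih2 => exact .series ih2 ih1 hg.symm

theorem IsThickSLI.dest_mem {T : Set β} (h : IsThickSLI T G O D) : D ∈ G.vertexSet :=
  h.reverse.origin_mem

/-- If the two outer terminals coincided, this vertex would belong to both parts and thus be `c`,
against the induction hypothesis for the first part. -/
theorem IsThickSLI.ne {T : Set β} (h : IsThickSLI T G O D) : O ≠ D := by
  induction h with
  | of_isThickLI h => exact h.1.origin_ne_dest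
  | series h1 h2 hg ih1 _ =>
    rintro rfl
    exact ih1 ((hg.left_mem_iff h1.origin_mem).1 h2.dest_mem)

theorem IsNetwork.exists_inc_origin (h : IsNetwork G O D) : ∃ e, G.Inc e O := by
  obtain ⟨r, _, e, he, hi⟩ := h.vertex_on_route O h.origin_mem
  exact ⟨e, hi⟩

theorem IsThickSLI.exists_inc_origin {T : Set β} (h : IsThickSLI T G O D) : ∃ e, G.Inc e O := by
  induction h with
  | of_isThickLI h => exact h.1.exists_inc_origin
  | series _ _ hg ih1 _ =>
    obtain ⟨e, he⟩ := ih1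
    exact ⟨e, he.mono hg.left_le⟩

/-! ## Isomorphisms -/

/-- `f` and `g` are bijections between the vertices and between the edges of two graphs that
respect the ends of the edges. -/
structure GraphIso (f : α' → α) (g : β' → β) (H : Graph α' β') (G : Graph α β) : Prop where
  bijV : Set.BijOn f H.vertexSet G.vertexSet
  bijE : Set.BijOn g H.edgeSet G.edgeSet
  isLink_iff : ∀ e ∈ H.edgeSet, ∀ x ∈ H.vertexSet, ∀ y ∈ H.vertexSet,
    (H.IsLink e x y ↔ G.IsLink (g e) (f x) (f y))

section iso

variable {f : α' → α} {g : β' → β} {H : Graph α' β'}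

theorem GraphIso.inc_iff (h : GraphIso f g H G) {e : β'} {x : α'} (he : e ∈ H.edgeSet)
    (hx : x ∈ H.vertexSet) : H.Inc e x ↔ G.Inc (g e) (f x) := by
  constructor
  · rintro ⟨y, hl⟩
    exact ⟨f y, (h.isLink_iff _ he _ hx _ hl.right_mem).1 hl⟩
  · rintro ⟨y, hl⟩
    obtain ⟨y', hy', rfl⟩ := h.bijV.surjOn hl.right_mem
    exact ⟨y', (h.isLink_iff _ he _ hx _ hy').2 hl⟩

theorem GraphIso.map_path (h : GraphIso f g H G) {u v : α'} {p : List β'} (hp : IsPath H u p v) :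
    IsPath G (f u) (p.map g) (f v) := by
  induction hp with
  | nil hu => exact .nil (h.bijV.mapsTo hu)
  | cons hl hp hne hin ih =>
    refine .cons ((h.isLink_iff _ hl.edge_mem _ hl.left_mem _ hl.right_mem).1 hl) ih
      (fun hf => hne (h.bijV.injOn hl.left_mem hl.right_mem hf)) fun e' he' hi => ?_
    obtain ⟨e, he, rfl⟩ := List.mem_map.1 he'
    exact hin e he ((h.inc_iff (hp.edge_mem he) hl.left_mem).2 hi)

theorem GraphIso.lift_path (h : GraphIso f g H G) {u v : α'} {q : List β}
    (hq : IsPath G (f u) q (f v)) (hu : u ∈ H.vertexSet) (hv : v ∈ H.vertexSet) :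
    ∃ p, IsPath H u p v ∧ p.map g = q := by
  induction q generalizing u with
  | nil =>
    obtain rfl := h.bijV.injOn hu hv hq.eq_of_nil
    exact ⟨[], .nil hu, rfl⟩
  | cons e q ih =>
    obtain ⟨w, hl, hq', hne, hin⟩ := hq.cons_inv
    obtain ⟨w, hw, rfl⟩ := h.bijV.surjOn hl.right_mem
    obtain ⟨e, he, rfl⟩ := h.bijE.surjOn hl.edge_mem
    obtain ⟨p, hp, rfl⟩ := ih hq' hw
    refine ⟨e :: p, .cons ((h.isLink_iff _ he _ hu _ hw).2 hl) hp (fun h => hne (h ▸ rfl))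
      fun e' he' hi => ?_, rfl⟩
    exact hin _ (List.mem_map_of_mem he') ((h.inc_iff (hp.edge_mem he') hu).1 hi)

theorem GraphIso.isNetwork (h : GraphIso f g H G) {O D : α'} (hn : IsNetwork G (f O) (f D))
    (hO : O ∈ H.vertexSet) (hD : D ∈ H.vertexSet) : IsNetwork H O D where
  finite_vertexSet := h.bijV.finite_iff_finite.2 hn.finite_vertexSet
  finite_edgeSet := h.bijE.finite_iff_finite.2 hn.finite_edgeSet
  loopless := by
    rw [Graph.loopless_iff_forall_ne_of_adj]
    rintro x y ⟨e, hl⟩ rfl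
    have := hn.loopless
    exact ((h.isLink_iff _ hl.edge_mem _ hl.left_mem _ hl.right_mem).1 hl).ne rfl
  origin_mem := hO
  dest_mem := hD
  origin_ne_dest hOD := hn.origin_ne_dest (hOD ▸ rfl)
  edge_on_route e he := by
    obtain ⟨r, hr, her⟩ := hn.edge_on_route _ (h.bijE.mapsTo he)
    obtain ⟨p, hp, rfl⟩ := h.lift_path hr hO hD
    obtain ⟨e', he', hee⟩ := List.mem_map.1 her
    obtain rfl := h.bijE.injOn (hp.edge_mem he') he hee
    exact ⟨p, hp, he'⟩
  vertex_on_route v hv := by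
    obtain ⟨r, hr, e, her, hi⟩ := hn.vertex_on_route _ (h.bijV.mapsTo hv)
    obtain ⟨p, hp, rfl⟩ := h.lift_path hr hO hD
    obtain ⟨e', he', rfl⟩ := List.mem_map.1 her
    exact ⟨p, hp, e', he', (h.inc_iff (hp.edge_mem he') hv).2 hi⟩

theorem GraphIso.isThickLI (h : GraphIso f g H G) {T : Set β} {T' : Set β'}
    (hT : ∀ e ∈ H.edgeSet, e ∈ T' → g e ∈ T) {O D : α'}
    (hn : IsThickLI T G (f O) (f D)) (hO : O ∈ H.vertexSet) (hD : D ∈ H.vertexSet) :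
    IsThickLI T' H O D := by
  refine ⟨h.isNetwork hn.1 hO hD, fun r hr => ?_⟩
  obtain ⟨_, he', h1, h2⟩ := hn.2 _ (h.map_path hr)
  obtain ⟨e, he, rfl⟩ := List.mem_map.1 he'
  refine ⟨e, he, fun r' hr' he' => ?_, fun k hk hkT => ?_⟩
  · have := h1 _ (h.map_path hr') (List.mem_map_of_mem he')
    refine hr'.eq_of_subset hr fun k hk => ?_
    have hk' : g k ∈ r.map g := this ▸ List.mem_map_of_mem hk
    obtain ⟨k', hk', hkk⟩ := List.mem_map.1 hk'
    exact h.bijE.injOn (hr.edge_mem hk') (hr'.edge_mem hk) hkk ▸ hk'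
  · exact h.bijE.injOn (hr.edge_mem hk) (hr.edge_mem he)
      (h2 _ (List.mem_map_of_mem hk) (hT _ (hr.edge_mem hk) hkT))

/-- A subgraph of the target of an isomorphism pulls back. -/
theorem GraphIso.isSubPair (h : GraphIso f g H G) {K : Graph α β} (hK : K ≤ G) :
    IsSubPair H (H.vertexSet ∩ f ⁻¹' K.vertexSet) (H.edgeSet ∩ g ⁻¹' K.edgeSet) where
  vert := Set.inter_subset_left
  edge := Set.inter_subset_left
  ends _ he _ hi :=
    ⟨hi.vertex_mem, ((hK.inc_congr he.2).2 ((h.inc_iff he.1 hi.vertex_mem).1 hi)).vertex_mem⟩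

theorem GraphIso.restrict (h : GraphIso f g H G) {K : Graph α β} (hK : K ≤ G) :
    GraphIso f g (sub H (H.vertexSet ∩ f ⁻¹' K.vertexSet) (H.edgeSet ∩ g ⁻¹' K.edgeSet)) K := by
  have hs := h.isSubPair hK
  refine ⟨?_, ?_, ?_⟩
  · rw [hs.sub_vertexSet]
    refine ⟨fun x hx => hx.2, h.bijV.injOn.mono Set.inter_subset_left, fun x hx => ?_⟩
    obtain ⟨x', hx', rfl⟩ := h.bijV.surjOn (hK.vertexSet_mono hx)
    exact ⟨x', ⟨hx', hx⟩, rfl⟩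
  · rw [hs.sub_edgeSet]
    refine ⟨fun x hx => hx.2, h.bijE.injOn.mono Set.inter_subset_left, fun x hx => ?_⟩
    obtain ⟨x', hx', rfl⟩ := h.bijE.surjOn (hK.edgeSet_mono hx)
    exact ⟨x', ⟨hx', hx⟩, rfl⟩
  · rw [hs.sub_vertexSet, hs.sub_edgeSet]
    intro e he x hx y hy
    rw [hs.sub_isLink, h.isLink_iff e he.1 x hx.1 y hy.1, hK.isLink_iff he.2]
    exact ⟨fun h => h.2, fun h => ⟨he, h⟩⟩

/-- Being a series of linearly independent networks is invariant under isomorphism; making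
thick edges thin does no harm. -/
theorem IsThickSLI.of_graphIso {T : Set β} {T' : Set β'} {O' D' : α} (hn : IsThickSLI T G O' D')
    (h : GraphIso f g H G) (hT : ∀ e ∈ H.edgeSet, e ∈ T' → g e ∈ T) {O D : α'}
    (hO : O ∈ H.vertexSet) (hD : D ∈ H.vertexSet) (hfO : f O = O') (hfD : f D = D') :
    IsThickSLI T' H O D := by
  induction hn generalizing H O D with
  | of_isThickLI hn =>
    subst hfO hfD
    exact .of_isThickLI (h.isThickLI hT hn hO hD)
  | @series G G₁ G₂ O' c D' h1 h2 hg ih1 ih2 =>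
    obtain ⟨c', hc', rfl⟩ := h.bijV.surjOn (hg.left_le.vertexSet_mono h1.dest_mem)
    -- The parts of `H` are the preimages of the parts of `G`, and the isomorphism restricts to each
    -- of them.
    have hs1 := h.isSubPair hg.left_le
    have hs2 := h.isSubPair hg.right_le
    refine .series (c := c')
      (ih1 (h.restrict hg.left_le) ?_ ?_ ?_ hfO rfl)
      (ih2 (h.restrict hg.right_le) ?_ ?_ ?_ rfl hfD)
      (isGluedAt_sub hs1 hs2 ?_ ?_ ?_ ?_)
    · rw [hs1.sub_edgeSet]; exact fun e he => hT e he.1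
    · rw [hs1.sub_vertexSet]; exact ⟨hO, by simpa [hfO] using h1.origin_mem⟩
    · rw [hs1.sub_vertexSet]; exact ⟨hc', h1.dest_mem⟩
    · rw [hs2.sub_edgeSet]; exact fun e he => hT e he.1
    · rw [hs2.sub_vertexSet]; exact ⟨hc', h2.origin_mem⟩
    · rw [hs2.sub_vertexSet]; exact ⟨hD, by simpa [hfD] using h2.dest_mem⟩
    · rw [← Set.inter_union_distrib_left, ← Set.preimage_union, hg.vertexSet_eq]
      exact Set.inter_eq_left.2 h.bijV.mapsTo
    · rw [← Set.inter_union_distrib_left, ← Set.preimage_union, hg.edgeSet_eq]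
      exact Set.inter_eq_left.2 h.bijE.mapsTo
    · ext x
      constructor
      · rintro ⟨⟨hx, hx1⟩, _, hx2⟩
        exact h.bijV.injOn hx hc' ((hg.left_mem_iff hx1).1 hx2)
      · rintro rfl
        exact ⟨⟨hc', h1.dest_mem⟩, hc', h2.origin_mem⟩
    · rw [Set.disjoint_left]
      exact fun e he he' => Set.disjoint_left.1 hg.disjoint_edgeSet he.2 he'.2

end iso

theorem graphIso_id : GraphIso id id G G :=
  ⟨Set.bijOn_id _, Set.bijOn_id _, fun _ _ _ _ _ _ => Iff.rfl⟩

/-- Only the status of edges of `G` matters. This allows one set of thick edges to be used for all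
parts of a series, although a merge concerns only one of them. -/
theorem IsThickSLI.mono {T T' : Set β} (h : IsThickSLI T G O D)
    (hT : ∀ e ∈ G.edgeSet, e ∈ T' → e ∈ T) : IsThickSLI T' G O D :=
  h.of_graphIso graphIso_id hT h.origin_mem h.dest_mem rfl rfl

end TwoTerminal

namespace TwoTerminal

variable {α β : Type*} {G H G₁ G₂ H₁ H₂ K : Graph α β} {u v w x y z O D c : α} {e f : β}
  {p q r : List β} {T : Set β}

/-! ## Merging parallel edges -/

/-- `H` arises from `G` by the removal of the edge `f`. -/
structure RemovesEdge (G H : Graph α β) (f : β) : Prop where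
  le : H ≤ G
  vertexSet_eq : H.vertexSet = G.vertexSet
  edgeSet_eq : H.edgeSet = G.edgeSet \ {f}

theorem removesEdge_deleteEdges (G : Graph α β) (f : β) : RemovesEdge G (G.deleteEdges {f}) f :=
  ⟨Graph.deleteEdges_le, by simp, by simp⟩

theorem RemovesEdge.le_of_le (h : RemovesEdge G H f) (hK : K ≤ G) (hf : f ∉ K.edgeSet) : K ≤ H where
  vertexSet_mono := by rw [h.vertexSet_eq]; exact hK.vertexSet_mono
  isLink_mono e x y hl := by
    refine (h.le.isLink_iff ?_).2 (hl.mono hK)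
    rw [h.edgeSet_eq]
    exact ⟨(hl.mono hK).edge_mem, fun hef => hf (hef ▸ hl.edge_mem)⟩

theorem RemovesEdge.path (h : RemovesEdge G H f) (hp : IsPath G u p v) (hf : f ∉ p) :
    IsPath H u p v := by
  refine hp.anti h.le (h.vertexSet_eq ▸ hp.left_mem) fun e he => ?_
  rw [h.edgeSet_eq]
  exact ⟨hp.edge_mem he, fun hef => hf (hef ▸ he)⟩

/-- Parallel edges can be exchanged because a path is constrained only by the ends of its edges. The
new path is described by its set of edges alone; this suffices, since `IsPath.eq_of_subset` recovers
a path from that set. -/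
theorem IsPath.replace (hp : IsPath G u p v) (hf : f ∈ p) (he : G.IsLink e x y)
    (hf' : G.IsLink f x y) :
    ∃ p', IsPath G u p' v ∧ ∀ k, k ∈ p' ↔ k ∈ p ∧ k ≠ f ∨ k = e := by
  have hinc : ∀ z, G.Inc e z → G.Inc f z := fun z hz => by
    rcases hz.eq_or_eq_of_isLink he with rfl | rfl
    exacts [hf'.inc_left, hf'.inc_right]
  induction hp with
  | nil => simp at hf
  | @cons u w v k p hl hp hne hin ih =>
    rcases List.mem_cons.1 hf with rfl | hfp
    · have hl' : G.IsLink e u w := by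
        rw [he.isLink_iff]; exact hf'.eq_and_eq_or_eq_and_eq hl
      refine ⟨e :: p, .cons hl' hp hne hin, fun m => ?_⟩
      have : f ∉ p := fun hm => hin _ hm hl.inc_left
      by_cases hm : m = f
      · subst hm; simp [this]
      · simp only [List.mem_cons, hm]; tauto
    · obtain ⟨p', hp', hmem⟩ := ih hfp
      refine ⟨k :: p', .cons hl hp' hne fun m hm hi => ?_, fun m => ?_⟩
      · rcases (hmem m).1 hm with ⟨hm, _⟩ | rfl
        · exact hin m hm hi
        · exact hin f hfp (hinc _ hi)
      · have : k ≠ f := fun hkf => hin f hfp (hkf ▸ hl.inc_left)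
        rw [List.mem_cons, List.mem_cons, hmem]
        by_cases hm : m = k
        · subst hm; simp [this]
        · simp [hm]

theorem RemovesEdge.twin (h : RemovesEdge G H f) (hef : e ≠ f) (he : G.IsLink e x y)
    (hf : G.IsLink f x y) (hp : IsPath G u p v) (hfp : f ∈ p) :
    ∃ p', IsPath H u p' v ∧ ∀ k, k ∈ p' ↔ k ∈ p ∧ k ≠ f ∨ k = e := by
  obtain ⟨p', hp', hmem⟩ := hp.replace hfp he hf
  exact ⟨p', h.path hp' (by rw [hmem]; simp [hef.symm]), hmem⟩

theorem RemovesEdge.isNetwork (h : RemovesEdge G H f) (hef : e ≠ f) (he : G.IsLink e x y)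
    (hf : G.IsLink f x y) (hn : IsNetwork G O D) : IsNetwork H O D := by
  have hedge : ∀ k ∈ H.edgeSet, ∃ r, IsPath H O r D ∧ k ∈ r := fun k hk => by
    rw [h.edgeSet_eq] at hk
    obtain ⟨r, hr, hkr⟩ := hn.edge_on_route k hk.1
    by_cases hfr : f ∈ r
    · obtain ⟨r', hr', hmem⟩ := h.twin hef he hf hr hfr
      exact ⟨r', hr', (hmem k).2 (.inl ⟨hkr, hk.2⟩)⟩
    · exact ⟨r, h.path hr hfr, hkr⟩
  have hinc : ∀ k ≠ f, ∀ z, G.Inc k z → H.Inc k z := fun k hk z hz =>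
    (h.le.inc_congr (by rw [h.edgeSet_eq]; exact ⟨hz.edge_mem, hk⟩)).2 hz
  refine ⟨h.vertexSet_eq ▸ hn.1, hn.2.subset h.le.edgeSet_mono, ?_, h.vertexSet_eq ▸ hn.4,
    h.vertexSet_eq ▸ hn.5, hn.6, hedge, fun z hz => ?_⟩
  · have := hn.loopless
    exact .anti h.le
  · obtain ⟨r, hr, k, hk, hi⟩ := hn.vertex_on_route z (h.vertexSet_eq ▸ hz)
    have : ∃ k, H.Inc k z := by
      by_cases hkf : k = f
      · subst hkf
        refine ⟨e, hinc e hef z ?_⟩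
        rcases hi.eq_or_eq_of_isLink hf with rfl | rfl
        exacts [he.inc_left, he.inc_right]
      · exact ⟨k, hinc k hkf z hi⟩
    obtain ⟨k, hi⟩ := this
    obtain ⟨r, hr, hk⟩ := hedge k hi.edge_mem
    exact ⟨r, hr, k, hk, hi⟩

theorem RemovesEdge.isNetwork_of (h : RemovesEdge G H f) (hef : e ≠ f) (he : G.IsLink e x y)
    (hf : G.IsLink f x y) (hxy : x ≠ y) (hn : IsNetwork H O D) : IsNetwork G O D := by
  have hE : ∀ k, k ∈ H.edgeSet ↔ k ∈ G.edgeSet ∧ k ≠ f := fun k => by rw [h.edgeSet_eq]; rfl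
  refine ⟨h.vertexSet_eq ▸ hn.1, ?_, ?_, h.vertexSet_eq ▸ hn.4, h.vertexSet_eq ▸ hn.5, hn.6,
    fun k hk => ?_, fun z hz => ?_⟩
  · refine (hn.2.insert f).subset fun k hk => ?_
    by_cases hkf : k = f
    · exact .inl hkf
    · exact .inr ((hE k).2 ⟨hk, hkf⟩)
  · rw [Graph.loopless_iff_forall_ne_of_adj]
    rintro a b ⟨k, hl⟩ rfl
    by_cases hkf : k = f
    · subst hkf
      rcases hl.eq_and_eq_or_eq_and_eq hf with ⟨h1, h2⟩ | ⟨h1, h2⟩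
      · exact hxy (h1.symm.trans h2)
      · exact hxy (h2.symm.trans h1)
    · have := hn.loopless
      exact ((h.le.isLink_iff ((hE k).2 ⟨hl.edge_mem, hkf⟩)).2 hl).ne rfl
  · by_cases hkf : k = f
    · subst hkf
      -- The restored edge gets its route by exchange from a route through its twin.
      obtain ⟨r, hr, her⟩ := hn.edge_on_route e ((hE e).2 ⟨he.edge_mem, hef⟩)
      obtain ⟨r', hr', hmem⟩ := (hr.mono h.le).replace her hf he
      exact ⟨r', hr', (hmem _).2 (.inr rfl)⟩
    · obtain ⟨r, hr, hkr⟩ := hn.edge_on_route k ((hE k).2 ⟨hk, hkf⟩)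
      exact ⟨r, hr.mono h.le, hkr⟩
  · obtain ⟨r, hr, k, hk, hi⟩ := hn.vertex_on_route z (h.vertexSet_eq ▸ hz)
    exact ⟨r, hr.mono h.le, k, hk, hi.mono h.le⟩

/-- The only new demand is that `e`, when it lies on a route, be the private edge. If another edge
were private, exchanging `e` for `f` would give a second route through that edge. -/
theorem RemovesEdge.isThickLI (h : RemovesEdge G H f) (hef : e ≠ f) (he : G.IsLink e x y)
    (hf : G.IsLink f x y) (hn : IsThickLI T G O D) : IsThickLI (insert e T) H O D := by
  refine ⟨h.isNetwork hef he hf hn.1, fun r hr => ?_⟩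
  have hrG := hr.mono h.le
  have hfr : f ∉ r := fun hm => by
    have := hr.edge_mem hm
    rw [h.edgeSet_eq] at this
    exact this.2 rfl
  obtain ⟨k, hk, h1, h2⟩ := hn.2 r hrG
  refine ⟨k, hk, fun r' hr' hk' => h1 r' (hr'.mono h.le) hk', ?_⟩
  rintro m hm (rfl | hmT)
  · obtain ⟨r', hr', hmem⟩ := hrG.replace hm hf he
    by_contra hmk
    have := h1 r' hr' ((hmem k).2 (.inl ⟨hk, Ne.symm hmk⟩))
    exact hfr (this ▸ (hmem f).2 (.inr rfl))
  · exact h2 m hm hmT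

/-- A route through `f` has a twin in `H` through `e`. As `e` is thick there, it is the private edge
of the twin, and so `f` is private in `G`. A route that avoids `f` keeps its private edge `k`: a
route through `f` and `k` would have this very route as its twin, which forces `k = e`, but parallel
edges never lie on one route. -/
theorem RemovesEdge.isThickLI_of (h : RemovesEdge G H f) (hef : e ≠ f) (he : G.IsLink e x y)
    (hf : G.IsLink f x y) (hxy : x ≠ y) (hn : IsThickLI (insert e T) H O D) :
    IsThickLI T G O D := by
  refine ⟨h.isNetwork_of hef he hf hxy hn.1, fun r hr => ?_⟩
  have hboth : ∀ {r}, IsPath G O r D → f ∈ r → e ∉ r := fun hr h1 h2 =>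
    hef (hr.eq_of_parallel h2 h1 he hf)
  by_cases hfr : f ∈ r
  · obtain ⟨r₁, hr₁, hmem⟩ := h.twin hef he hf hr hfr
    obtain ⟨k, hk, h1, h2⟩ := hn.2 r₁ hr₁
    obtain rfl : e = k := h2 e ((hmem e).2 (.inr rfl)) (.inl rfl)
    refine ⟨f, hfr, fun r' hr' hfr' => ?_, fun m hm hmT => ?_⟩
    · obtain ⟨r₁', hr₁', hmem'⟩ := h.twin hef he hf hr' hfr'
      obtain rfl := h1 r₁' hr₁' ((hmem' e).2 (.inr rfl))
      refine hr'.eq_of_subset hr fun m hm => ?_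
      by_cases hmf : m = f
      · exact hmf ▸ hfr
      · rcases (hmem m).1 ((hmem' m).2 (.inl ⟨hm, hmf⟩)) with h3 | rfl
        · exact h3.1
        · exact absurd hm (hboth hr' hfr')
    · by_contra hmf
      obtain rfl := h2 m ((hmem m).2 (.inl ⟨hm, hmf⟩)) (.inr hmT)
      exact hboth hr hfr hm
  · obtain ⟨k, hk, h1, h2⟩ := hn.2 r (h.path hr hfr)
    refine ⟨k, hk, fun r' hr' hkr' => ?_, fun m hm hmT => h2 m hm (.inr hmT)⟩
    by_cases hfr' : f ∈ r'
    · obtain ⟨r₁', hr₁', hmem'⟩ := h.twin hef he hf hr' hfr'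
      obtain rfl := h1 r₁' hr₁' ((hmem' k).2 (.inl ⟨hkr', fun hkf => hfr (hkf ▸ hk)⟩))
      obtain rfl := h2 e ((hmem' e).2 (.inr rfl)) (.inl rfl)
      exact absurd hkr' (hboth hr' hfr')
    · exact h1 r' (h.path hr' hfr') hkr'

theorem IsGluedAt.removesEdge (hg : IsGluedAt G G₁ G₂ c) (h : RemovesEdge G H f)
    (h₁ : RemovesEdge G₁ H₁ f) (hf : f ∈ G₁.edgeSet) : IsGluedAt H H₁ G₂ c := by
  have hf2 := Set.disjoint_left.1 hg.disjoint_edgeSet hf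
  refine ⟨h.le_of_le (h₁.le.trans hg.left_le) ?_, h.le_of_le hg.right_le hf2, ?_, ?_, ?_, ?_⟩
  · rw [h₁.edgeSet_eq]; simp
  · rw [h₁.vertexSet_eq, h.vertexSet_eq, hg.vertexSet_eq]
  · rw [h₁.edgeSet_eq, h.edgeSet_eq, ← hg.edgeSet_eq, Set.union_sdiff_distrib,
      Set.sdiff_singleton_eq_self hf2]
  · rw [h₁.vertexSet_eq, hg.inter_vertexSet]
  · exact hg.disjoint_edgeSet.mono_left h₁.le.edgeSet_mono

/-- Parallel edges lie on the same side of a cut vertex. -/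
theorem IsGluedAt.parallel_mem (hg : IsGluedAt G G₁ G₂ c) (he : G.IsLink e x y)
    (hf : G.IsLink f x y) (hxy : x ≠ y) (he₁ : e ∈ G₁.edgeSet) : f ∈ G₁.edgeSet := by
  have hf' : f ∈ G₁.edgeSet ∪ G₂.edgeSet := by rw [hg.edgeSet_eq]; exact hf.edge_mem
  refine hf'.resolve_right fun hf2 => hxy ?_
  have h1 := (hg.left_le.isLink_iff he₁).2 he
  have h2 := (hg.right_le.isLink_iff hf2).2 hf
  rw [(hg.left_mem_iff h1.left_mem).1 h2.left_mem, (hg.left_mem_iff h1.right_mem).1 h2.right_mem]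

theorem IsThickSLI.removesEdge (hn : IsThickSLI T G O D) (h : RemovesEdge G H f) (hef : e ≠ f)
    (he : G.IsLink e x y) (hf : G.IsLink f x y) (hxy : x ≠ y) :
    IsThickSLI (insert e T) H O D := by
  induction hn generalizing H with
  | of_isThickLI hn => exact .of_isThickLI (h.isThickLI hef he hf hn)
  | @series G G₁ G₂ O c D h1 h2 hg ih1 ih2 =>
    -- In the part that does not contain `e`, making `e` thick has no effect.
    have hmono : ∀ {K : Graph α β} {O D}, e ∉ K.edgeSet → IsThickSLI T K O D →
        IsThickSLI (insert e T) K O D := fun hK h => h.mono fun k hk hkT =>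
      hkT.resolve_left fun hke => hK (hke ▸ hk)
    have he' : e ∈ G₁.edgeSet ∪ G₂.edgeSet := by rw [hg.edgeSet_eq]; exact he.edge_mem
    rcases he' with he' | he'
    · have hf' := hg.parallel_mem he hf hxy he'
      exact .series (ih1 (removesEdge_deleteEdges G₁ f) ((hg.left_le.isLink_iff he').2 he)
          ((hg.left_le.isLink_iff hf').2 hf))
        (hmono (Set.disjoint_left.1 hg.disjoint_edgeSet he') h2)
        (hg.removesEdge h (removesEdge_deleteEdges G₁ f) hf')
    · have hf' := hg.symm.parallel_mem he hf hxy he'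
      exact .series (hmono (Set.disjoint_right.1 hg.disjoint_edgeSet he') h1)
        (ih2 (removesEdge_deleteEdges G₂ f) ((hg.right_le.isLink_iff he').2 he)
          ((hg.right_le.isLink_iff hf').2 hf))
        (hg.symm.removesEdge h (removesEdge_deleteEdges G₂ f) hf').symm

/-- Putting back an edge on one side of a cut vertex. -/
theorem IsGluedAt.exists_restore (hg : IsGluedAt H H₁ H₂ c) (h : RemovesEdge G H f) (hef : e ≠ f)
    (he : G.IsLink e x y) (hf : G.IsLink f x y) (he₁ : e ∈ H₁.edgeSet) :
    ∃ G₁, RemovesEdge G₁ H₁ f ∧ IsGluedAt G G₁ H₂ c ∧ G₁.IsLink e x y ∧ G₁.IsLink f x y := by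
  have hfH : f ∉ H.edgeSet := by rw [h.edgeSet_eq]; simp
  have hf1 : f ∉ H₁.edgeSet := fun hm => hfH (hg.left_le.edgeSet_mono hm)
  have hf2 : f ∉ H₂.edgeSet := fun hm => hfH (hg.right_le.edgeSet_mono hm)
  have hle := hg.left_le.trans h.le
  have hl := (hle.isLink_iff he₁).2 he
  have hs : IsSubPair G H₁.vertexSet (insert f H₁.edgeSet) := by
    refine ⟨hle.vertexSet_mono, Set.insert_subset hf.edge_mem hle.edgeSet_mono, ?_⟩
    rintro k (rfl | hk) z hz
    · rcases hz.eq_or_eq_of_isLink hf with rfl | rfl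
      exacts [hl.left_mem, hl.right_mem]
    · exact ((hle.inc_congr hk).2 hz).vertex_mem
  refine ⟨sub G H₁.vertexSet (insert f H₁.edgeSet), ⟨⟨?_, fun k a b hk => ?_⟩, ?_, ?_⟩,
    ⟨sub_le, hg.right_le.trans h.le, ?_, ?_, ?_, ?_⟩, ?_, ?_⟩
  · rw [hs.sub_vertexSet]
  · exact hs.sub_isLink.2 ⟨.inr hk.edge_mem, hk.mono hle⟩
  · rw [hs.sub_vertexSet]
  · rw [hs.sub_edgeSet]; simp [hf1]
  · rw [hs.sub_vertexSet, hg.vertexSet_eq, h.vertexSet_eq]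
  · rw [hs.sub_edgeSet, Set.insert_union, hg.edgeSet_eq, h.edgeSet_eq, Set.insert_sdiff_singleton,
      Set.insert_eq_of_mem hf.edge_mem]
  · rw [hs.sub_vertexSet, hg.inter_vertexSet]
  · rw [hs.sub_edgeSet, Set.disjoint_insert_left]
    exact ⟨hf2, hg.disjoint_edgeSet⟩
  · exact hs.sub_isLink.2 ⟨.inr he₁, he⟩
  · exact hs.sub_isLink.2 ⟨.inl rfl, hf⟩

theorem IsThickSLI.of_removesEdge (hn : IsThickSLI (insert e T) H O D) (h : RemovesEdge G H f)
    (hef : e ≠ f) (he : G.IsLink e x y) (hf : G.IsLink f x y) (hxy : x ≠ y) :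
    IsThickSLI T G O D := by
  induction hn generalizing G with
  | of_isThickLI hn => exact .of_isThickLI (h.isThickLI_of hef he hf hxy hn)
  | @series H H₁ H₂ O c D h1 h2 hg ih1 ih2 =>
    have hmono : ∀ {K : Graph α β} {O D}, IsThickSLI (insert e T) K O D → IsThickSLI T K O D :=
      fun h => h.mono fun k _ hkT => .inr hkT
    have he' : e ∈ H₁.edgeSet ∪ H₂.edgeSet := by
      rw [hg.edgeSet_eq, h.edgeSet_eq]; exact ⟨he.edge_mem, hef⟩
    rcases he' with he' | he'
    · obtain ⟨G₁, hr, hgl, he1, hf1⟩ := hg.exists_restore h hef he hf he'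
      exact .series (ih1 hr he1 hf1) (hmono h2) hgl
    · obtain ⟨G₂, hr, hgl, he1, hf1⟩ := hg.symm.exists_restore h hef he hf he'
      exact .series (hmono h1) (ih2 hr he1 hf1) hgl.symm

end TwoTerminal

namespace TwoTerminal

variable {α β : Type*} {G H G₁ G₂ H₁ H₂ K : Graph α β} {u v w x y z O D c : α} {e f k : β}
  {p q r : List β} {T : Set β}

/-! ## Contracting an edge at a vertex of degree two -/

/-- `v` has exactly two edges in `G`, namely `e` to `x` and `f` to `y ≠ x`, and `H` arises from
`G` by contracting `f` into `y`. -/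
structure Contracts (G H : Graph α β) (v x y : α) (e f : β) : Prop where
  link_left : G.IsLink e v x
  link_right : G.IsLink f v y
  edge_ne : e ≠ f
  ends_ne : x ≠ y
  ne_left : v ≠ x
  ne_right : v ≠ y
  only : ∀ k, G.Inc k v → k = e ∨ k = f
  vertexSet_eq : H.vertexSet = G.vertexSet \ {v}
  isLink_iff : ∀ k a b, H.IsLink k a b ↔
    (k = e ∧ (a = x ∧ b = y ∨ a = y ∧ b = x)) ∨ (k ≠ e ∧ k ≠ f ∧ G.IsLink k a b)

/-- The graph with `v` contracted into `y`. -/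
def contract (G : Graph α β) (v x y : α) (e f : β) (hx : x ∈ G.vertexSet \ {v})
    (hy : y ∈ G.vertexSet \ {v}) (only : ∀ k, G.Inc k v → k = e ∨ k = f) : Graph α β where
  vertexSet := G.vertexSet \ {v}
  IsLink k a b := (k = e ∧ (a = x ∧ b = y ∨ a = y ∧ b = x)) ∨ (k ≠ e ∧ k ≠ f ∧ G.IsLink k a b)
  isLink_symm k _ := ⟨fun a b h => by
    rcases h with ⟨h1, h2⟩ | ⟨h1, h2, h3⟩
    · exact .inl ⟨h1, by tauto⟩
    · exact .inr ⟨h1, h2, h3.symm⟩⟩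
  eq_or_eq_of_isLink_of_isLink := by
    rintro k a b a' b' (⟨h1, h2⟩ | ⟨h1, h2, h3⟩) (⟨h1', h2'⟩ | ⟨h1', h2', h3'⟩)
    · rcases h2 with ⟨rfl, rfl⟩ | ⟨rfl, rfl⟩ <;> rcases h2' with ⟨rfl, rfl⟩ | ⟨rfl, rfl⟩ <;> simp
    · exact absurd h1 h1'
    · exact absurd h1' h1
    · exact h3.left_eq_or_eq h3'
  left_mem_of_isLink := by
    rintro k a b (⟨h1, ⟨rfl, rfl⟩ | ⟨rfl, rfl⟩⟩ | ⟨h1, h2, h3⟩)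
    · exact hx
    · exact hy
    · refine ⟨h3.left_mem, ?_⟩
      rintro rfl
      exact (only k h3.inc_left).elim h1 h2

namespace Contracts

theorem edge_mem_iff (h : Contracts G H v x y e f) : k ∈ H.edgeSet ↔ k ∈ G.edgeSet ∧ k ≠ f := by
  rw [H.edge_mem_iff_exists_isLink, G.edge_mem_iff_exists_isLink]
  simp only [h.isLink_iff]
  constructor
  · rintro ⟨a, b, ⟨rfl, _⟩ | ⟨h1, h2, h3⟩⟩
    · exact ⟨⟨v, x, h.link_left⟩, h.edge_ne⟩
    · exact ⟨⟨a, b, h3⟩, h2⟩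
  · rintro ⟨⟨a, b, hl⟩, hf⟩
    by_cases hk : k = e
    · exact ⟨x, y, .inl ⟨hk, .inl ⟨rfl, rfl⟩⟩⟩
    · exact ⟨a, b, .inr ⟨hk, hf, hl⟩⟩

theorem edgeSet_eq (h : Contracts G H v x y e f) : H.edgeSet = G.edgeSet \ {f} :=
  Set.ext fun _ => h.edge_mem_iff

theorem inc_iff (h : Contracts G H v x y e f) :
    H.Inc k z ↔ (k = e ∧ (z = x ∨ z = y)) ∨ (k ≠ e ∧ k ≠ f ∧ G.Inc k z) := by
  unfold Graph.Inc
  simp only [h.isLink_iff]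
  constructor
  · rintro ⟨b, ⟨h1, h2⟩ | ⟨h1, h2, h3⟩⟩
    · exact .inl ⟨h1, by tauto⟩
    · exact .inr ⟨h1, h2, b, h3⟩
  · rintro (⟨h1, rfl | rfl⟩ | ⟨h1, h2, b, h3⟩)
    · exact ⟨y, .inl ⟨h1, by simp⟩⟩
    · exact ⟨x, .inl ⟨h1, by simp⟩⟩
    · exact ⟨b, .inr ⟨h1, h2, h3⟩⟩

theorem mem_iff (h : Contracts G H v x y e f) : z ∈ H.vertexSet ↔ z ∈ G.vertexSet ∧ z ≠ v := by
  rw [h.vertexSet_eq]; rfl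

/-- Paths between vertices other than `v` survive the contraction. -/
theorem drop_path (h : Contracts G H v x y e f) (hp : IsPath G u p w) (hu : u ≠ v) (hw : w ≠ v) :
    ∃ p', IsPath H u p' w ∧ (∀ k, k ∈ p' ↔ k ∈ p ∧ k ≠ f) ∧ (e ∈ p ↔ f ∈ p) ∧
      ∀ z, OnPath H u p' z → OnPath G u p z := by
  -- Strong induction on the length, because a passage through `v` uses up two edges at once.
  induction hn : p.length using Nat.strong_induction_on generalizing p u with
  | _ n ih =>
  cases p with
  | nil =>
    obtain rfl := hp.eq_of_nil
    exact ⟨[], .nil (h.mem_iff.2 ⟨hp.left_mem, hu⟩), by simp, by simp, fun z hz => by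
      rw [onPath_nil] at hz ⊢; exact hz⟩
  | cons k p =>
    obtain ⟨w', hl, hp', hne, hin⟩ := hp.cons_inv
    by_cases hwv : w' = v
    · subst hwv
      cases p with
      | nil => exact absurd hp'.eq_of_nil.symm hw
      | cons k' p =>
        obtain ⟨w'', hl', hp'', hne', hin'⟩ := hp'.cons_inv
        have hkk : k ≠ k' := fun hk => hin k' (by simp) (hk ▸ hl.inc_left)
        have hO : OnPath G w'' p u → False := fun hO =>
          not_onPath_tail hl hne hin ((onPath_cons hl').2 (.inr hO))
        obtain ⟨p', hp1, hp2, hp3, hp4⟩ := ih p.length (by simp at hn; omega) hp'' hne'.symm rfl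
        have hkp : k ∉ p := fun hm => hin k (by simp [hm]) hl.inc_left
        have hkp' : k' ∉ p := fun hm => hin' k' hm hl'.inc_left
        -- The path enters and leaves `v` by its only two edges, in one of the two directions. In
        -- `H` both are replaced by `e` alone.
        have hends : (k = e ∧ k' = f ∧ u = x ∧ w'' = y) ∨ (k = f ∧ k' = e ∧ u = y ∧ w'' = x) := by
          rcases h.only k hl.inc_right with rfl | rfl <;> rcases h.only k' hl'.inc_left with rfl | rfl
          · exact absurd rfl hkk
          · exact .inl ⟨rfl, rfl, hl.symm.right_unique h.link_left, hl'.right_unique h.link_right⟩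
          · exact .inr ⟨rfl, rfl, hl.symm.right_unique h.link_right, hl'.right_unique h.link_left⟩
          · exact absurd rfl hkk
        have hlH : H.IsLink e u w'' := (h.isLink_iff _ _ _).2 (.inl ⟨rfl, by tauto⟩)
        have hef := h.edge_ne
        refine ⟨e :: p', .cons' hlH hp1 fun hz => hO (hp4 u hz), fun m => ?_, ?_, fun z hz => ?_⟩
        · rw [List.mem_cons, hp2, List.mem_cons, List.mem_cons]
          rcases hends with ⟨rfl, rfl, -, -⟩ | ⟨rfl, rfl, -, -⟩
          · by_cases hm : m = k
            · subst hm; simp [hef]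
            · simp only [hm]; tauto
          · by_cases hm : m = k'
            · subst hm; simp [hef]
            · simp only [hm]; tauto
        · rcases hends with ⟨rfl, rfl, -, -⟩ | ⟨rfl, rfl, -, -⟩ <;> simp
        · rw [onPath_cons hl, onPath_cons hl']
          rcases (onPath_cons hlH).1 hz with rfl | hz
          · exact .inl rfl
          · exact .inr (.inr (hp4 z hz))
    · obtain ⟨p', hp1, hp2, hp3, hp4⟩ := ih p.length (by simp at hn; omega) hp' hwv rfl
      have hke : k ≠ e := by
        rintro rfl
        rcases h.link_left.left_eq_or_eq hl with h1 | h1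
        exacts [hu h1.symm, hwv h1.symm]
      have hkf : k ≠ f := by
        rintro rfl
        rcases h.link_right.left_eq_or_eq hl with h1 | h1
        exacts [hu h1.symm, hwv h1.symm]
      have hlH : H.IsLink k u w' := (h.isLink_iff _ _ _).2 (.inr ⟨hke, hkf, hl⟩)
      refine ⟨k :: p', .cons' hlH hp1 fun hz => not_onPath_tail hl hne hin (hp4 u hz),
        fun m => ?_, ?_, fun z hz => ?_⟩
      · rw [List.mem_cons, hp2, List.mem_cons]
        by_cases hm : m = k
        · subst hm; simp [hkf]
        · simp [hm]
      · simp [hke.symm, hkf.symm, hp3]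
      · rw [onPath_cons hl]
        exact ((onPath_cons hlH).1 hz).imp_right (hp4 z)

/-- Paths of the contracted graph come from paths of the original graph. -/
theorem lift_path (h : Contracts G H v x y e f) (hp : IsPath H u p w) :
    ∃ p', IsPath G u p' w ∧ (∀ k, k ∈ p ↔ k ∈ p' ∧ k ≠ f) ∧ (e ∈ p' ↔ f ∈ p') ∧
      ∀ z, OnPath G u p' z → OnPath H u p z ∨ (z = v ∧ e ∈ p) := by
  induction hp with
  | nil hu =>
    exact ⟨[], .nil (h.mem_iff.1 hu).1, by simp, by simp, fun z hz => by
      rw [onPath_nil] at hz ⊢; exact .inl hz⟩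
  | @cons u w' w k p hl hp hne hin ih =>
    obtain ⟨p', hp1, hp2, hp3, hp4⟩ := ih
    have huv := (h.mem_iff.1 hl.left_mem).2
    have hwv := (h.mem_iff.1 hl.right_mem).2
    have hO : ¬ OnPath G w' p' u := fun hO => by
      rcases hp4 u hO with h1 | h1
      · exact not_onPath_tail hl hne hin h1
      · exact huv h1.1
    rcases (h.isLink_iff _ _ _).1 hl with ⟨rfl, hxy⟩ | ⟨hke, hkf, hlG⟩
    · have hkp : k ∉ p := fun hm => hin k hm hl.inc_left
      -- The lifted tail can contain `v` only if the tail contains the contracted edge, which has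
      -- just been used.
      have hOv : ¬ OnPath G w' p' v := fun hO => by
        rcases hp4 v hO with h1 | h1
        · exact (h.mem_iff.1 (hp.mem_of_onPath h1)).2 rfl
        · exact hkp h1.2
      have hex : ∃ m m', ((m = k ∧ m' = f) ∨ (m = f ∧ m' = k)) ∧ G.IsLink m u v ∧
          G.IsLink m' v w' := by
        rcases hxy with ⟨rfl, rfl⟩ | ⟨rfl, rfl⟩
        · exact ⟨k, f, .inl ⟨rfl, rfl⟩, h.link_left.symm, h.link_right⟩
        · exact ⟨f, k, .inr ⟨rfl, rfl⟩, h.link_right.symm, h.link_left⟩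
      obtain ⟨m, m', hmm, h1, h2⟩ := hex
      have hef := h.edge_ne
      refine ⟨m :: m' :: p', .cons' h1 (.cons' h2 hp1 hOv) ?_, fun a => ?_, ?_, fun z hz => ?_⟩
      · rw [onPath_cons h2]
        exact fun hz => hz.elim huv hO
      · rw [List.mem_cons, hp2, List.mem_cons, List.mem_cons]
        by_cases ha : a = k
        · subst ha; rcases hmm with ⟨rfl, rfl⟩ | ⟨rfl, rfl⟩ <;> simp [hef]
        · rcases hmm with ⟨rfl, rfl⟩ | ⟨rfl, rfl⟩ <;> simp only [ha] <;> tauto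
      · rcases hmm with ⟨rfl, rfl⟩ | ⟨rfl, rfl⟩ <;> simp
      · rw [onPath_cons h1, onPath_cons h2] at hz
        rw [onPath_cons hl]
        rcases hz with rfl | rfl | hz
        · exact .inl (.inl rfl)
        · exact .inr ⟨rfl, by simp⟩
        · rcases hp4 z hz with h3 | h3
          · exact .inl (.inr h3)
          · exact .inr ⟨h3.1, by simp⟩
    · refine ⟨k :: p', .cons' hlG hp1 hO, fun a => ?_, ?_, fun z hz => ?_⟩
      · rw [List.mem_cons, hp2, List.mem_cons]
        by_cases ha : a = k
        · subst ha; simp [hkf]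
        · simp [ha]
      · simp [hke.symm, hkf.symm, hp3]
      · rw [onPath_cons hl]
        rcases (onPath_cons hlG).1 hz with rfl | hz
        · exact .inl (.inl rfl)
        · rcases hp4 z hz with h3 | h3
          · exact .inl (.inr h3)
          · exact .inr ⟨h3.1, by simp [h3.2]⟩

theorem isNetwork (h : Contracts G H v x y e f) (hn : IsNetwork G O D) (hO : O ≠ v) (hD : D ≠ v) :
    IsNetwork H O D := by
  have hedge : ∀ k ∈ H.edgeSet, ∃ r, IsPath H O r D ∧ k ∈ r := fun k hk => by
    rw [h.edge_mem_iff] at hk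
    obtain ⟨r, hr, hkr⟩ := hn.edge_on_route k hk.1
    obtain ⟨r', hr', hmem, _⟩ := h.drop_path hr hO hD
    exact ⟨r', hr', (hmem k).2 ⟨hkr, hk.2⟩⟩
  refine ⟨hn.1.subset ?_, hn.2.subset ?_, ?_, h.mem_iff.2 ⟨hn.4, hO⟩, h.mem_iff.2 ⟨hn.5, hD⟩, hn.6,
    hedge, fun z hz => ?_⟩
  · rw [h.vertexSet_eq]; exact Set.sdiff_subset
  · rw [h.edgeSet_eq]; exact Set.sdiff_subset
  · rw [Graph.loopless_iff_forall_ne_of_adj]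
    rintro a b ⟨k, hl⟩ rfl
    rcases (h.isLink_iff _ _ _).1 hl with ⟨_, ⟨h1, h2⟩ | ⟨h1, h2⟩⟩ | ⟨_, _, hl⟩
    · exact h.ends_ne (h1.symm.trans h2)
    · exact h.ends_ne (h2.symm.trans h1)
    · have := hn.loopless
      exact hl.ne rfl
  · obtain ⟨hz, hzv⟩ := h.mem_iff.1 hz
    obtain ⟨r, hr, k, hk, hi⟩ := hn.vertex_on_route z hz
    have : ∃ k, H.Inc k z := by
      by_cases hke : k = e
      · subst hke
        exact ⟨k, h.inc_iff.2 (.inl ⟨rfl, .inl (hi.eq_of_isLink_of_ne_left h.link_left hzv)⟩)⟩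
      by_cases hkf : k = f
      · subst hkf
        exact ⟨e, h.inc_iff.2 (.inl ⟨rfl, .inr (hi.eq_of_isLink_of_ne_left h.link_right hzv)⟩)⟩
      exact ⟨k, h.inc_iff.2 (.inr ⟨hke, hkf, hi⟩)⟩
    obtain ⟨k, hi⟩ := this
    obtain ⟨r, hr, hk⟩ := hedge k hi.edge_mem
    exact ⟨r, hr, k, hk, hi⟩

theorem isNetwork_of (h : Contracts G H v x y e f) (hn : IsNetwork H O D) : IsNetwork G O D := by
  have hedge : ∀ k ∈ G.edgeSet, ∃ r, IsPath G O r D ∧ k ∈ r := fun k hk => by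
    by_cases hkf : k = f
    · subst hkf
      obtain ⟨r, hr, her⟩ := hn.edge_on_route e
        (h.edge_mem_iff.2 ⟨h.link_left.edge_mem, h.edge_ne⟩)
      obtain ⟨r', hr', hmem, hiff, _⟩ := h.lift_path hr
      exact ⟨r', hr', hiff.1 ((hmem e).1 her).1⟩
    · obtain ⟨r, hr, hkr⟩ := hn.edge_on_route k (h.edge_mem_iff.2 ⟨hk, hkf⟩)
      obtain ⟨r', hr', hmem, _⟩ := h.lift_path hr
      exact ⟨r', hr', ((hmem k).1 hkr).1⟩
  refine ⟨(hn.1.insert v).subset fun z hz => ?_, (hn.2.insert f).subset fun k hk => ?_, ?_,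
    (h.mem_iff.1 hn.4).1, (h.mem_iff.1 hn.5).1, hn.6, hedge, fun z hz => ?_⟩
  · by_cases hzv : z = v
    · exact .inl hzv
    · exact .inr (h.mem_iff.2 ⟨hz, hzv⟩)
  · by_cases hkf : k = f
    · exact .inl hkf
    · exact .inr (h.edge_mem_iff.2 ⟨hk, hkf⟩)
  · rw [Graph.loopless_iff_forall_ne_of_adj]
    rintro a b ⟨k, hl⟩ rfl
    by_cases hke : k = e
    · subst hke
      rcases hl.eq_and_eq_or_eq_and_eq h.link_left with ⟨h1, h2⟩ | ⟨h1, h2⟩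
      · exact h.ne_left (h1.symm.trans h2)
      · exact h.ne_left (h2.symm.trans h1)
    by_cases hkf : k = f
    · subst hkf
      rcases hl.eq_and_eq_or_eq_and_eq h.link_right with ⟨h1, h2⟩ | ⟨h1, h2⟩
      · exact h.ne_right (h1.symm.trans h2)
      · exact h.ne_right (h2.symm.trans h1)
    have := hn.loopless
    exact ((h.isLink_iff _ _ _).2 (.inr ⟨hke, hkf, hl⟩)).ne rfl
  · have : ∃ k, G.Inc k z := by
      by_cases hzv : z = v
      · exact ⟨e, hzv ▸ h.link_left.inc_left⟩
      · obtain ⟨r, hr, k, hk, hi⟩ := hn.vertex_on_route z (h.mem_iff.2 ⟨hz, hzv⟩)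
        rcases h.inc_iff.1 hi with ⟨_, rfl | rfl⟩ | ⟨_, _, hi⟩
        exacts [⟨e, h.link_left.inc_right⟩, ⟨f, h.link_right.inc_right⟩, ⟨k, hi⟩]
    obtain ⟨k, hi⟩ := this
    obtain ⟨r, hr, hk⟩ := hedge k hi.edge_mem
    exact ⟨r, hr, k, hk, hi⟩

/-- Routes of `H` lift to routes of `G` with the same edges apart from `f`, and a lifted route
contains `f` exactly if it contains `e`. So privacy carries over, with `e` in the role of `f` when
necessary. -/
theorem isThickLI (h : Contracts G H v x y e f) (hO : O ≠ v) (hD : D ≠ v)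
    (hn : IsThickLI T G O D) : IsThickLI T H O D := by
  refine ⟨h.isNetwork hn.1 hO hD, fun r hr => ?_⟩
  obtain ⟨s, hs, hmem, hiff, _⟩ := h.lift_path hr
  obtain ⟨k, hk, h1, h2⟩ := hn.2 s hs
  have key : ∀ r', IsPath H O r' D → (∀ s' : List β, (∀ k, k ∈ r' ↔ k ∈ s' ∧ k ≠ f) →
      (e ∈ s' ↔ f ∈ s') → k ∈ s') → r' = r := by
    intro r' hr' hks
    obtain ⟨s', hs', hmem', hiff', _⟩ := h.lift_path hr'
    obtain rfl := h1 s' hs' (hks s' hmem' hiff')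
    exact hr'.eq_of_subset hr fun m hm => (hmem m).2 ((hmem' m).1 hm)
  by_cases hkf : k = f
  · subst hkf
    refine ⟨e, (hmem e).2 ⟨hiff.2 hk, h.edge_ne⟩, fun r' hr' he => key r' hr' ?_,
      fun m hm hmT => ?_⟩
    · exact fun s' hm hi => hi.1 ((hm e).1 he).1
    · obtain ⟨hm, hmf⟩ := (hmem m).1 hm
      -- When `f` is the private edge upstairs, no other edge of the route is thick, so the route in
      -- `H` has no thick edge at all.
      exact absurd (h2 m hm hmT) hmf
  · refine ⟨k, (hmem k).2 ⟨hk, hkf⟩, fun r' hr' he => key r' hr' ?_,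
      fun m hm hmT => h2 m ((hmem m).1 hm).1 hmT⟩
    exact fun s' hm _ => ((hm k).1 he).1

/-- In `H` only the status of `e` is remembered. Thinness of `f` ensures that nothing is lost: a
thick `f` could be a second thick edge on a route. -/
theorem isThickLI_of (h : Contracts G H v x y e f) (hf : f ∉ T)
    (hn : IsThickLI T H O D) : IsThickLI T G O D := by
  have hO := (h.mem_iff.1 hn.1.origin_mem).2
  have hD := (h.mem_iff.1 hn.1.dest_mem).2
  refine ⟨h.isNetwork_of hn.1, fun r hr => ?_⟩
  obtain ⟨s, hs, hmem, hiff, _⟩ := h.drop_path hr hO hD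
  obtain ⟨k, hk, h1, h2⟩ := hn.2 s hs
  have hkf := ((hmem k).1 hk).2
  refine ⟨k, ((hmem k).1 hk).1, fun r' hr' hkr' => ?_, fun m hm hmT =>
    h2 m ((hmem m).2 ⟨hm, fun hmf => hf (hmf ▸ hmT)⟩) hmT⟩
  obtain ⟨s', hs', hmem', hiff', _⟩ := h.drop_path hr' hO hD
  obtain rfl := h1 s' hs' ((hmem' k).2 ⟨hkr', hkf⟩)
  refine hr'.eq_of_subset hr fun m hm => ?_
  by_cases hmf : m = f
  · subst hmf
    exact hiff.1 ((hmem e).1 ((hmem' e).2 ⟨hiff'.2 hm, h.edge_ne⟩)).1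
  · exact ((hmem m).1 ((hmem' m).2 ⟨hm, hmf⟩)).1

end Contracts

end TwoTerminal

/-! ### Contraction in a series of networks -/

namespace TwoTerminal

variable {α β : Type*} {G H G₁ G₂ H₁ H₂ K : Graph α β} {u v w x y z O D c : α} {e f k : β}
  {p q r : List β} {T : Set β}

theorem eq_of_le_of_sets_eq (h1 : H ≤ G) (h2 : K ≤ G) (hV : H.vertexSet = K.vertexSet)
    (hE : H.edgeSet = K.edgeSet) : H = K := by
  refine Graph.ext hV fun e a b => ?_
  by_cases he : e ∈ H.edgeSet
  · rw [h1.isLink_iff he, h2.isLink_iff (hE ▸ he)]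
  · exact ⟨fun h => absurd h.edge_mem he, fun h => absurd (hE ▸ h.edge_mem) he⟩

theorem IsPath.eq_nil (h : IsPath G u p u) : p = [] := by
  cases h with
  | nil => rfl
  | cons hl hp hne hin => exact absurd hp.onPath_end (not_onPath_tail hl hne hin)

/-! ### Removing an end vertex of degree one -/

/-- `f` is the only edge at `c`, its other end is `y`, and `H` is `G` without `c` and `f`. -/
structure RemovesLeaf (G H : Graph α β) (c y : α) (f : β) : Prop where
  le : H ≤ G
  link : G.IsLink f c y
  ne : c ≠ y
  only : ∀ k, G.Inc k c → k = f
  vertexSet_eq : H.vertexSet = G.vertexSet \ {c}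
  edgeSet_eq : H.edgeSet = G.edgeSet \ {f}

namespace RemovesLeaf

theorem mem_iff (h : RemovesLeaf G H c y f) : z ∈ H.vertexSet ↔ z ∈ G.vertexSet ∧ z ≠ c := by
  rw [h.vertexSet_eq]; rfl

theorem edge_mem_iff (h : RemovesLeaf G H c y f) : k ∈ H.edgeSet ↔ k ∈ G.edgeSet ∧ k ≠ f := by
  rw [h.edgeSet_eq]; rfl

theorem path_inv (h : RemovesLeaf G H c y f) (hr : IsPath G c r D) (hD : c ≠ D) :
    ∃ p, r = f :: p ∧ IsPath H y p D ∧ f ∉ p := by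
  cases r with
  | nil => exact absurd hr.eq_of_nil hD
  | cons k p =>
    obtain ⟨w, hl, hp, hne, hin⟩ := hr.cons_inv
    obtain rfl := h.only k hl.inc_left
    obtain rfl := hl.right_unique h.link
    have hkp : k ∉ p := fun hm => hin k hm hl.inc_left
    refine ⟨p, rfl, hp.anti h.le (h.mem_iff.2 ⟨hl.right_mem, hne.symm⟩) fun m hm => ?_, hkp⟩
    exact h.edge_mem_iff.2 ⟨hp.edge_mem hm, fun hmk => hkp (hmk ▸ hm)⟩

theorem path_cons (h : RemovesLeaf G H c y f) (hp : IsPath H y p D) : IsPath G c (f :: p) D := by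
  refine .cons h.link (hp.mono h.le) h.ne fun k hk hi => ?_
  exact (h.edge_mem_iff.1 (hp.edge_mem hk)).2 (h.only k hi)

theorem isNetwork (h : RemovesLeaf G H c y f) (hn : IsNetwork G c D) (hy : y ≠ D) :
    IsNetwork H y D := by
  refine ⟨hn.1.subset h.le.vertexSet_mono, hn.2.subset h.le.edgeSet_mono, ?_,
    h.mem_iff.2 ⟨h.link.right_mem, h.ne.symm⟩, h.mem_iff.2 ⟨hn.5, hn.6.symm⟩, hy,
    fun k hk => ?_, fun z hz => ?_⟩
  · have := hn.loopless
    exact .anti h.le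
  · obtain ⟨hk, hkf⟩ := h.edge_mem_iff.1 hk
    obtain ⟨r, hr, hkr⟩ := hn.edge_on_route k hk
    obtain ⟨p, rfl, hp, _⟩ := h.path_inv hr hn.6
    exact ⟨p, hp, (List.mem_cons.1 hkr).resolve_left hkf⟩
  · obtain ⟨hz, hzc⟩ := h.mem_iff.1 hz
    obtain ⟨r, hr, k, hkr, hi⟩ := hn.vertex_on_route z hz
    obtain ⟨p, rfl, hp, _⟩ := h.path_inv hr hn.6
    rcases List.mem_cons.1 hkr with rfl | hkp
    · obtain rfl := hi.eq_of_isLink_of_ne_left h.link hzc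
      obtain ⟨m, hm, hi⟩ := hp.exists_first (hp.ne_nil hy)
      exact ⟨p, hp, m, hm, hi⟩
    · exact ⟨p, hp, k, hkp, (h.le.inc_congr (hp.edge_mem hkp)).2 hi⟩

/-- All routes begin with `f`. If `f` is private, there is only one route and no thick edge on its
remainder, so any edge of the remainder will do; otherwise the private edge survives. -/
theorem isThickLI (h : RemovesLeaf G H c y f) (hn : IsThickLI T G c D) (hy : y ≠ D) :
    IsThickLI T H y D := by
  refine ⟨h.isNetwork hn.1 hy, fun p hp => ?_⟩
  obtain ⟨k, hk, h1, h2⟩ := hn.2 _ (h.path_cons hp)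
  have hfp : f ∉ p := fun hm => (h.edge_mem_iff.1 (hp.edge_mem hm)).2 rfl
  rcases List.mem_cons.1 hk with rfl | hkp
  · obtain ⟨m, hm⟩ := List.exists_mem_of_ne_nil p (hp.ne_nil hy)
    refine ⟨m, hm, fun p' hp' _ => ?_, fun m' hm' hmT => ?_⟩
    · exact (List.cons.inj (h1 _ (h.path_cons hp') (by simp))).2
    · exact absurd (h2 m' (by simp [hm']) hmT ▸ hm') hfp
  · refine ⟨k, hkp, fun p' hp' hk' => ?_, fun m hm => h2 m (by simp [hm])⟩
    exact (List.cons.inj (h1 _ (h.path_cons hp') (by simp [hk']))).2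

/-- The only route is the edge `f` itself, and a network consists of the vertices and edges of its
routes. -/
theorem sets_eq (h : RemovesLeaf G H c y f) (hn : IsNetwork G c y) :
    G.edgeSet = {f} ∧ G.vertexSet = {c, y} := by
  have hroute : ∀ r, IsPath G c r y → r = [f] := fun r hr => by
    obtain ⟨p, rfl, hp, _⟩ := h.path_inv hr hn.6
    rw [hp.eq_nil]
  refine ⟨Set.Subset.antisymm (fun k hk => ?_) (by simpa using h.link.edge_mem),
    Set.Subset.antisymm (fun z hz => ?_) ?_⟩
  · obtain ⟨r, hr, hkr⟩ := hn.edge_on_route k hk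
    rw [hroute r hr] at hkr
    simpa using hkr
  · obtain ⟨r, hr, k, hkr, hi⟩ := hn.vertex_on_route z hz
    rw [hroute r hr, List.mem_singleton] at hkr
    subst hkr
    exact hi.eq_or_eq_of_isLink h.link
  · rintro z (rfl | rfl)
    exacts [h.link.left_mem, h.link.right_mem]

end RemovesLeaf

theorem removesLeaf_sub (hl : G.IsLink f c y) (hne : c ≠ y) (only : ∀ k, G.Inc k c → k = f) :
    RemovesLeaf G (sub G (G.vertexSet \ {c}) (G.edgeSet \ {f})) c y f := by
  have hs : IsSubPair G (G.vertexSet \ {c}) (G.edgeSet \ {f}) := by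
    refine ⟨Set.sdiff_subset, Set.sdiff_subset, fun k hk z hz => ⟨hz.vertex_mem, ?_⟩⟩
    rintro rfl
    exact hk.2 (only k hz)
  exact ⟨sub_le, hl, hne, only, hs.sub_vertexSet, hs.sub_edgeSet⟩

/-- Removing an origin of degree one leaves a series of linearly independent networks, unless
nothing remains. -/
theorem IsThickSLI.removesLeaf (hn : IsThickSLI T G c D) (h : RemovesLeaf G H c y f) :
    (y = D ∧ G.edgeSet = {f} ∧ G.vertexSet = {c, y}) ∨ IsThickSLI T H y D := by
  induction hn generalizing H with
  | @of_isThickLI G c D hn =>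
    by_cases hy : y = D
    · subst hy
      exact .inl ⟨rfl, h.sets_eq hn.1⟩
    · exact .inr (.of_isThickLI (h.isThickLI hn hy))
  | @series G G₁ G₂ c d D h1 h2 hg ih1 _ =>
    right
    have hl := hg.isLink_left h1.origin_mem h1.ne h.link
    have hf2 := Set.disjoint_left.1 hg.disjoint_edgeSet hl.edge_mem
    have hc2 : c ∉ G₂.vertexSet := fun hc => h1.ne ((hg.left_mem_iff h1.origin_mem).1 hc)
    have h₁ := removesLeaf_sub hl h.ne fun k hk => h.only k (hk.mono hg.left_le)
    set H₁ := sub G₁ (G₁.vertexSet \ {c}) (G₁.edgeSet \ {f})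
    -- Either the first part was just the edge `f`, and then the second part is all that remains, or
    -- the first part survives in reduced form and is still glued to the second at the same vertex.
    rcases ih1 h₁ with ⟨rfl, hE, hV⟩ | ih
    · have : H = G₂ := by
        refine eq_of_le_of_sets_eq h.le hg.right_le ?_ ?_
        · rw [h.vertexSet_eq, ← hg.vertexSet_eq, hV]
          ext z
          have := h2.origin_mem
          simp only [Set.mem_sdiff, Set.mem_union, Set.mem_insert_iff, Set.mem_singleton_iff]
          constructor
          · rintro ⟨(rfl | rfl) | hz, hzc⟩
            exacts [absurd rfl hzc, this, hz]
          · exact fun hz => ⟨.inr hz, fun hzc => hc2 (hzc ▸ hz)⟩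
        · rw [h.edgeSet_eq, ← hg.edgeSet_eq, hE]
          ext k
          simp only [Set.mem_sdiff, Set.mem_union, Set.mem_singleton_iff]
          exact ⟨fun hk => hk.1.resolve_left hk.2, fun hk => ⟨.inr hk, fun hkf => hf2 (hkf ▸ hk)⟩⟩
      exact this ▸ h2
    · refine .series ih h2 ⟨⟨?_, fun k a b hk => ?_⟩, ⟨?_, fun k a b hk => ?_⟩, ?_, ?_, ?_, ?_⟩
      · rw [h.vertexSet_eq, h₁.vertexSet_eq]
        exact Set.sdiff_subset_sdiff_left hg.left_le.vertexSet_mono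
      · refine (h.le.isLink_iff (h.edge_mem_iff.2 ⟨?_, ?_⟩)).2 ((hk.mono h₁.le).mono hg.left_le)
        · exact ((hk.mono h₁.le).mono hg.left_le).edge_mem
        · exact (h₁.edge_mem_iff.1 hk.edge_mem).2
      · exact fun z hz => h.mem_iff.2 ⟨hg.right_le.vertexSet_mono hz, fun hzc => hc2 (hzc ▸ hz)⟩
      · refine (h.le.isLink_iff (h.edge_mem_iff.2 ⟨?_, ?_⟩)).2 (hk.mono hg.right_le)
        · exact (hk.mono hg.right_le).edge_mem
        · exact fun hkf => hf2 (hkf ▸ hk.edge_mem)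
      · rw [h.vertexSet_eq, h₁.vertexSet_eq, ← hg.vertexSet_eq, Set.union_sdiff_distrib,
          Set.sdiff_singleton_eq_self hc2]
      · rw [h.edgeSet_eq, h₁.edgeSet_eq, ← hg.edgeSet_eq, Set.union_sdiff_distrib,
          Set.sdiff_singleton_eq_self hf2]
      · rw [h₁.vertexSet_eq, Set.sdiff_inter_right_comm, hg.inter_vertexSet]
        exact Set.sdiff_singleton_eq_self (by simpa using h1.ne)
      · exact hg.disjoint_edgeSet.mono_left h₁.le.edgeSet_mono

/-! ### Contraction and gluing -/

theorem Contracts.ends_mem (h : Contracts G H v x y e f) (hg : IsGluedAt G G₁ G₂ c)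
    (hv : v ∈ G₁.vertexSet) (hvc : v ≠ c) : G₁.IsLink e v x ∧ G₁.IsLink f v y :=
  ⟨hg.isLink_left hv hvc h.link_left, hg.isLink_left hv hvc h.link_right⟩

/-- Away from the cut vertex both edges at `v` lie in the part of `v`, so the contraction takes
place inside this part. -/
theorem Contracts.glued (h : Contracts G H v x y e f) (hg : IsGluedAt G G₁ G₂ c)
    (hv : v ∈ G₁.vertexSet) (hvc : v ≠ c) :
    ∃ H₁, Contracts G₁ H₁ v x y e f ∧ IsGluedAt H H₁ G₂ c := by
  obtain ⟨he, hf⟩ := h.ends_mem hg hv hvc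
  have hv2 : v ∉ G₂.vertexSet := fun hv' => hvc ((hg.left_mem_iff hv).1 hv')
  have he2 := Set.disjoint_left.1 hg.disjoint_edgeSet he.edge_mem
  have hf2 := Set.disjoint_left.1 hg.disjoint_edgeSet hf.edge_mem
  have hs : IsSubPair H (G₁.vertexSet \ {v}) (G₁.edgeSet \ {f}) := by
    refine ⟨fun z hz => h.mem_iff.2 ⟨hg.left_le.vertexSet_mono hz.1, hz.2⟩, fun k hk =>
      h.edge_mem_iff.2 ⟨hg.left_le.edgeSet_mono hk.1, hk.2⟩, fun k hk z hz => ⟨?_, ?_⟩⟩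
    · rcases h.inc_iff.1 hz with ⟨_, rfl | rfl⟩ | ⟨_, _, hi⟩
      exacts [he.right_mem, hf.right_mem, ((hg.left_le.inc_congr hk.1).2 hi).vertex_mem]
    · exact (h.mem_iff.1 hz.vertex_mem).2
  refine ⟨sub H (G₁.vertexSet \ {v}) (G₁.edgeSet \ {f}), ⟨he, hf, h.edge_ne, h.ends_ne, h.ne_left,
    h.ne_right, fun k hk => h.only k (hk.mono hg.left_le), hs.sub_vertexSet, fun k a b => ?_⟩,
    ⟨sub_le, ⟨fun z hz => ?_, fun k a b hk => ?_⟩, ?_, ?_, ?_, ?_⟩⟩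
  · rw [hs.sub_isLink, h.isLink_iff]
    constructor
    · rintro ⟨hk, hk' | ⟨h1, h2, hl⟩⟩
      · exact .inl hk'
      · exact .inr ⟨h1, h2, (hg.left_le.isLink_iff hk.1).2 hl⟩
    · rintro (⟨rfl, hk⟩ | ⟨h1, h2, hl⟩)
      · exact ⟨⟨he.edge_mem, h.edge_ne⟩, .inl ⟨rfl, hk⟩⟩
      · exact ⟨⟨hl.edge_mem, h2⟩, .inr ⟨h1, h2, hl.mono hg.left_le⟩⟩
  · exact h.mem_iff.2 ⟨hg.right_le.vertexSet_mono hz, fun hzv => hv2 (hzv ▸ hz)⟩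
  · exact (h.isLink_iff _ _ _).2 (.inr ⟨fun hke => he2 (hke ▸ hk.edge_mem),
      fun hkf => hf2 (hkf ▸ hk.edge_mem), hk.mono hg.right_le⟩)
  · rw [hs.sub_vertexSet, h.vertexSet_eq, ← hg.vertexSet_eq, Set.union_sdiff_distrib,
      Set.sdiff_singleton_eq_self hv2]
  · rw [hs.sub_edgeSet, h.edgeSet_eq, ← hg.edgeSet_eq, Set.union_sdiff_distrib,
      Set.sdiff_singleton_eq_self hf2]
  · rw [hs.sub_vertexSet, Set.sdiff_inter_right_comm, hg.inter_vertexSet]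
    exact Set.sdiff_singleton_eq_self (by simpa using hvc)
  · rw [hs.sub_edgeSet]
    exact hg.disjoint_edgeSet.mono_left Set.sdiff_subset

theorem Contracts.exists_glued (h : Contracts G H v x y e f) (hg : IsGluedAt H H₁ H₂ c)
    (he : e ∈ H₁.edgeSet) : ∃ G₁, Contracts G₁ H₁ v x y e f ∧ IsGluedAt G G₁ H₂ c := by
  have hvH : v ∉ H.vertexSet := fun hv => (h.mem_iff.1 hv).2 rfl
  have hv1 : v ∉ H₁.vertexSet := fun hv => hvH (hg.left_le.vertexSet_mono hv)
  have hv2 : v ∉ H₂.vertexSet := fun hv => hvH (hg.right_le.vertexSet_mono hv)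
  have hfH : f ∉ H.edgeSet := fun hf => (h.edge_mem_iff.1 hf).2 rfl
  have hf1 : f ∉ H₁.edgeSet := fun hf => hfH (hg.left_le.edgeSet_mono hf)
  have hf2 : f ∉ H₂.edgeSet := fun hf => hfH (hg.right_le.edgeSet_mono hf)
  have he2 := Set.disjoint_left.1 hg.disjoint_edgeSet he
  have hl : H₁.IsLink e x y := (hg.left_le.isLink_iff he).2
    ((h.isLink_iff _ _ _).2 (.inl ⟨rfl, .inl ⟨rfl, rfl⟩⟩))
  have hlink : ∀ k ≠ e, ∀ a b, H.IsLink k a b → G.IsLink k a b := fun k hk a b hl => by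
    rcases (h.isLink_iff _ _ _).1 hl with h1 | h1
    exacts [absurd h1.1 hk, h1.2.2]
  have hs : IsSubPair G (insert v H₁.vertexSet) (insert f H₁.edgeSet) := by
    refine ⟨Set.insert_subset h.link_left.left_mem fun z hz =>
      (h.mem_iff.1 (hg.left_le.vertexSet_mono hz)).1, Set.insert_subset h.link_right.edge_mem
      fun k hk => (h.edge_mem_iff.1 (hg.left_le.edgeSet_mono hk)).1, ?_⟩
    rintro k (rfl | hk) z hz
    · rcases hz.eq_or_eq_of_isLink h.link_right with rfl | rfl
      exacts [.inl rfl, .inr hl.right_mem]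
    · by_cases hke : k = e
      · subst hke
        rcases hz.eq_or_eq_of_isLink h.link_left with rfl | rfl
        exacts [.inl rfl, .inr hl.left_mem]
      · have := h.inc_iff.2 (.inr ⟨hke, fun hkf => hf1 (hkf ▸ hk), hz⟩)
        exact .inr ((hg.left_le.inc_congr hk).2 this).vertex_mem
  refine ⟨sub G (insert v H₁.vertexSet) (insert f H₁.edgeSet), ⟨?_, ?_, h.edge_ne, h.ends_ne,
    h.ne_left, h.ne_right, fun k hk => h.only k (hk.mono sub_le), ?_, fun k a b => ?_⟩,
    ⟨sub_le, ⟨fun z hz => ?_, fun k a b hk => ?_⟩, ?_, ?_, ?_, ?_⟩⟩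
  · exact hs.sub_isLink.2 ⟨.inr he, h.link_left⟩
  · exact hs.sub_isLink.2 ⟨.inl rfl, h.link_right⟩
  · rw [hs.sub_vertexSet]; simp [hv1]
  · rw [hs.sub_isLink]
    constructor
    · intro hk
      rcases (h.isLink_iff _ _ _).1 (hk.mono hg.left_le) with h1 | ⟨h1, h2, h3⟩
      · exact .inl h1
      · exact .inr ⟨h1, h2, .inr hk.edge_mem, h3⟩
    · rintro (⟨rfl, hk⟩ | ⟨h1, h2, hk, h3⟩)
      · exact (hg.left_le.isLink_iff he).2 ((h.isLink_iff _ _ _).2 (.inl ⟨rfl, hk⟩))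
      · exact (hg.left_le.isLink_iff (hk.resolve_left h2)).2
          ((h.isLink_iff _ _ _).2 (.inr ⟨h1, h2, h3⟩))
  · exact (h.mem_iff.1 (hg.right_le.vertexSet_mono hz)).1
  · exact hlink k (fun hke => he2 (hke ▸ hk.edge_mem)) a b (hk.mono hg.right_le)
  · rw [hs.sub_vertexSet, Set.insert_union, hg.vertexSet_eq, h.vertexSet_eq,
      Set.insert_sdiff_singleton, Set.insert_eq_of_mem h.link_left.left_mem]
  · rw [hs.sub_edgeSet, Set.insert_union, hg.edgeSet_eq, h.edgeSet_eq,
      Set.insert_sdiff_singleton, Set.insert_eq_of_mem h.link_right.edge_mem]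
  · rw [hs.sub_vertexSet, Set.insert_inter_of_notMem hv2, hg.inter_vertexSet]
  · rw [hs.sub_edgeSet, Set.disjoint_insert_left]
    exact ⟨hf2, hg.disjoint_edgeSet⟩

/-- This direction needs no case of a cut vertex: `v` is not a vertex of `H`, and subdividing `e`
again happens within the part that contains `e`. -/
theorem IsThickSLI.of_contracts (hn : IsThickSLI T H O D) (h : Contracts G H v x y e f)
    (hf : f ∉ T) : IsThickSLI T G O D := by
  induction hn generalizing G with
  | of_isThickLI hn => exact .of_isThickLI (h.isThickLI_of hf hn)
  | @series H H₁ H₂ O c D h1 h2 hg ih1 ih2 =>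
    have he' : e ∈ H₁.edgeSet ∪ H₂.edgeSet := by
      rw [hg.edgeSet_eq, h.edgeSet_eq]; exact ⟨h.link_left.edge_mem, h.edge_ne⟩
    rcases he' with he' | he'
    · obtain ⟨G₁, hc, hgl⟩ := h.exists_glued hg he'
      exact .series (ih1 hc) h2 hgl
    · obtain ⟨G₂, hc, hgl⟩ := h.exists_glued hg.symm he'
      exact .series h1 (ih2 hc) hgl.symm

/-- Contraction at the vertex at which two networks are glued. -/
theorem Contracts.isThickSLI_of_glued (h : Contracts G H c x y e f) (hg : IsGluedAt G G₁ G₂ c)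
    (h1 : IsThickSLI T G₁ O c) (h2 : IsThickSLI T G₂ c D) (he : e ∈ G₁.edgeSet)
    (hf : f ∈ G₂.edgeSet) : IsThickSLI T H O D := by
  classical
  have he2 := Set.disjoint_left.1 hg.disjoint_edgeSet he
  have hf1 := Set.disjoint_right.1 hg.disjoint_edgeSet hf
  have hle := (hg.left_le.isLink_iff he).2 h.link_left
  have hlf := (hg.right_le.isLink_iff hf).2 h.link_right
  have hy1 : y ∉ G₁.vertexSet := fun hy => h.ne_right ((hg.left_mem_iff hy).1 hlf.right_mem).symm
  have hOy : O ≠ y := fun hOy => hy1 (hOy ▸ h1.origin_mem)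
  have hR : IsSubPair H (insert y (G₁.vertexSet \ {c})) G₁.edgeSet := by
    refine ⟨Set.insert_subset (h.mem_iff.2 ⟨h.link_right.right_mem, h.ne_right.symm⟩) fun z hz =>
      h.mem_iff.2 ⟨hg.left_le.vertexSet_mono hz.1, hz.2⟩, fun k hk => h.edge_mem_iff.2
      ⟨hg.left_le.edgeSet_mono hk, fun hkf => hf1 (hkf ▸ hk)⟩, fun k hk z hz => ?_⟩
    rcases h.inc_iff.1 hz with ⟨_, rfl | rfl⟩ | ⟨_, _, hi⟩
    · exact .inr ⟨hle.right_mem, h.ne_left.symm⟩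
    · exact .inl rfl
    · exact .inr ⟨((hg.left_le.inc_congr hk).2 hi).vertex_mem, (h.mem_iff.1 hz.vertex_mem).2⟩
  -- In `H` the first part survives as a copy in which `y` takes the place of `c`.
  have hiso : GraphIso (Function.update id y c) id (sub H (insert y (G₁.vertexSet \ {c})) G₁.edgeSet)
      G₁ := by
    have hup : ∀ z ∈ insert y (G₁.vertexSet \ {c}), (z = y ∧ Function.update id y c z = c) ∨
        (z ≠ y ∧ z ≠ c ∧ z ∈ G₁.vertexSet ∧ Function.update id y c z = z) := by
      rintro z (rfl | hz)
      · exact .inl ⟨rfl, by simp⟩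
      · have hzy : z ≠ y := fun hzy => hy1 (hzy ▸ hz.1)
        exact .inr ⟨hzy, hz.2, hz.1, by simp [hzy]⟩
    refine ⟨?_, by rw [hR.sub_edgeSet]; exact Set.bijOn_id _, fun k hk a ha b hb => ?_⟩
    · rw [hR.sub_vertexSet]
      refine ⟨fun z hz => ?_, fun z hz z' hz' hzz => ?_, fun z hz => ?_⟩
      · rcases hup z hz with ⟨_, h3⟩ | ⟨_, _, h3, h4⟩
        · rw [h3]; exact hle.left_mem
        · rw [h4]; exact h3
      · rcases hup z hz with ⟨h3, h4⟩ | ⟨_, h3, _, h4⟩ <;>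
          rcases hup z' hz' with ⟨h3', h4'⟩ | ⟨_, h3', _, h4'⟩ <;> rw [h4, h4'] at hzz
        · rw [h3, h3']
        · exact absurd hzz.symm h3'
        · exact absurd hzz h3
        · exact hzz
      · by_cases hzc : z = c
        · subst hzc; exact ⟨y, .inl rfl, by simp⟩
        · have hzy : z ≠ y := fun hzy => hy1 (hzy ▸ hz)
          exact ⟨z, .inr ⟨hz, hzc⟩, by simp [hzy]⟩
    · rw [hR.sub_edgeSet] at hk
      rw [hR.sub_vertexSet] at ha hb
      rw [hR.sub_isLink, h.isLink_iff, id_eq, hg.left_le.isLink_iff hk]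
      have hkf : k ≠ f := fun hkf => hf1 (hkf ▸ hk)
      have hcx := h.ne_left
      have hxy := h.ends_ne
      by_cases hke : k = e
      · subst hke
        rcases hup a ha with ⟨rfl, h4⟩ | ⟨hay, hac, _, h4⟩ <;>
          rcases hup b hb with ⟨rfl, h4'⟩ | ⟨hby, hbc, _, h4'⟩ <;>
          simp only [h4, h4', h.link_left.isLink_iff, hk, ne_eq, not_true_eq_false, false_and, or_false, true_and] <;> grind
      · have hky : ∀ b, ¬ G.IsLink k y b := fun b hl =>
          hy1 ((hg.left_le.isLink_iff hk).2 hl).left_mem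
        have hkc : ∀ b, ¬ G.IsLink k c b := fun b hl => (h.only k hl.inc_left).elim hke hkf
        rcases hup a ha with ⟨rfl, h4⟩ | ⟨hay, hac, _, h4⟩
        · rw [h4]; simp [hk, hke, hkf, hky, hkc]
        rcases hup b hb with ⟨rfl, h4'⟩ | ⟨hby, hbc, _, h4'⟩
        · rw [h4', G.isLink_comm, G.isLink_comm (y := c)]; simp [hk, hke, hkf, hky, hkc]
        rw [h4, h4']; simp [hk, hke, hkf]
  have hRS : IsThickSLI T (sub H (insert y (G₁.vertexSet \ {c})) G₁.edgeSet) O y := by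
    refine h1.of_graphIso hiso (fun k _ hk => hk) ?_ ?_ (by simp [hOy]) (by simp)
    · rw [hR.sub_vertexSet]; exact .inr ⟨h1.origin_mem, h1.ne⟩
    · rw [hR.sub_vertexSet]; exact .inl rfl
  -- The second part has only `f` at `c`, so it loses a leaf and begins at `y` from now on. If
  -- nothing is left of it, the copy of the first part is all of `H`.
  have honly : ∀ k, G₂.Inc k c → k = f := fun k hk =>
    (h.only k (hk.mono hg.right_le)).resolve_left fun hke => he2 (hke ▸ hk.edge_mem)
  have hleaf := removesLeaf_sub hlf h.ne_right honly
  have hyV : y ∈ G₂.vertexSet \ {c} := ⟨hlf.right_mem, h.ne_right.symm⟩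
  rcases h2.removesLeaf hleaf with ⟨rfl, hE, hV⟩ | hL
  · have : sub H (insert y (G₁.vertexSet \ {c})) G₁.edgeSet = H := by
      refine eq_of_le_of_sets_eq sub_le le_rfl ?_ ?_
      · rw [hR.sub_vertexSet, h.vertexSet_eq, ← hg.vertexSet_eq, hV, Set.union_sdiff_distrib]
        have : ({c, y} : Set α) \ {c} = {y} := by
          ext z
          simp only [Set.mem_sdiff, Set.mem_insert_iff, Set.mem_singleton_iff]
          exact ⟨fun hz => hz.1.resolve_left hz.2, fun hz => ⟨.inr hz, hz ▸ h.ne_right.symm⟩⟩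
        rw [this, Set.union_singleton]
      · rw [hR.sub_edgeSet, h.edgeSet_eq, ← hg.edgeSet_eq, hE, Set.union_sdiff_distrib,
          Set.sdiff_singleton_eq_self hf1]
        simp
    exact this ▸ hRS
  · refine .series hRS hL ⟨sub_le, ⟨fun z hz => ?_, fun k a b hk => ?_⟩, ?_, ?_, ?_, ?_⟩
    · rw [hleaf.vertexSet_eq] at hz
      exact h.mem_iff.2 ⟨hg.right_le.vertexSet_mono hz.1, hz.2⟩
    · have hk2 := hk.mono sub_le
      exact (h.isLink_iff _ _ _).2 (.inr ⟨fun hke => he2 (hke ▸ hk2.edge_mem),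
        (hleaf.edge_mem_iff.1 hk.edge_mem).2, hk2.mono hg.right_le⟩)
    · rw [hR.sub_vertexSet, hleaf.vertexSet_eq, Set.insert_union, ← Set.union_sdiff_distrib,
        hg.vertexSet_eq, h.vertexSet_eq, Set.insert_eq_of_mem]
      exact ⟨h.link_right.right_mem, h.ne_right.symm⟩
    · rw [hR.sub_edgeSet, hleaf.edgeSet_eq, h.edgeSet_eq, ← hg.edgeSet_eq,
        Set.union_sdiff_distrib, Set.sdiff_singleton_eq_self hf1]
    · rw [hR.sub_vertexSet, hleaf.vertexSet_eq, Set.insert_inter_of_mem hyV]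
      have : (G₁.vertexSet \ {c}) ∩ (G₂.vertexSet \ {c}) = ∅ :=
        Set.eq_empty_of_forall_notMem fun z hz => hz.1.2 ((hg.left_mem_iff hz.1.1).1 hz.2.1)
      rw [this]
      simp
    · rw [hR.sub_edgeSet]
      exact hg.disjoint_edgeSet.mono_right hleaf.le.edgeSet_mono

theorem IsThickSLI.contracts (hn : IsThickSLI T G O D) (h : Contracts G H v x y e f) (hO : O ≠ v)
    (hD : D ≠ v) : IsThickSLI T H O D := by
  induction hn generalizing H with
  | of_isThickLI hn => exact .of_isThickLI (h.isThickLI hO hD hn)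
  | @series G G₁ G₂ O c D h1 h2 hg ih1 ih2 =>
    by_cases hvc : v = c
    · subst hvc
      have hcases : ∀ {k}, k ∈ G.edgeSet → k ∈ G₁.edgeSet ∨ k ∈ G₂.edgeSet := fun hk => by
        rwa [← hg.edgeSet_eq] at hk
      obtain ⟨k₁, hk₁⟩ := h1.reverse.exists_inc_origin
      -- Each part has an edge at the cut vertex, so one of `e` and `f` belongs to each. If `f`
      -- belongs to the first part, the series is read backwards.
      obtain ⟨k₂, hk₂⟩ := h2.exists_inc_origin
      have hne : k₁ ≠ k₂ := fun hk =>
        Set.disjoint_left.1 hg.disjoint_edgeSet hk₁.edge_mem (hk ▸ hk₂.edge_mem)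
      rcases h.only k₁ (hk₁.mono hg.left_le) with rfl | rfl <;>
        rcases h.only k₂ (hk₂.mono hg.right_le) with rfl | rfl
      · exact absurd rfl hne
      · exact h.isThickSLI_of_glued hg h1 h2 hk₁.edge_mem hk₂.edge_mem
      · exact (h.isThickSLI_of_glued hg.symm h2.reverse h1.reverse hk₂.edge_mem
          hk₁.edge_mem).reverse
      · exact absurd rfl hne
    · have hv : v ∈ G₁.vertexSet ∪ G₂.vertexSet := by
        rw [hg.vertexSet_eq]; exact h.link_left.left_mem
      rcases hv with hv | hv
      · obtain ⟨H₁, hc, hgl⟩ := h.glued hg hv hvc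
        exact .series (ih1 hc hO (Ne.symm hvc)) h2 hgl
      · obtain ⟨H₂, hc, hgl⟩ := h.glued hg.symm hv hvc
        exact .series h1 (ih2 hc (Ne.symm hvc) hD) hgl.symm

end TwoTerminal

namespace TwoTerminal

variable {α β : Type*} {G H G₁ G₂ H₁ H₂ K : Graph α β} {u v w x y z O D c a b s t : α} {e f k : β}
  {p q r p₁ p₂ M : List β} {T : Set β}

/-! ## Irreducible networks -/

/-- `v` has at least three neighbours. -/
def HasThreeNeighbors (G : Graph α β) (v : α) : Prop :=
  ∃ a b c, a ≠ b ∧ a ≠ c ∧ b ≠ c ∧ G.Adj v a ∧ G.Adj v b ∧ G.Adj v c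

theorem IsPath.splice (h1 : IsPath G u p₁ a) (hM : IsPath G a M b) (h2 : IsPath G b p₂ v)
    (hd : ∀ x, OnPath G u p₁ x → ¬ OnPath G b p₂ x)
    (hM1 : ∀ x, OnPath G a M x → OnPath G u p₁ x → x = a)
    (hM2 : ∀ x, OnPath G a M x → OnPath G b p₂ x → x = b) :
    IsPath G u (p₁ ++ (M ++ p₂)) v := by
  refine h1.append (hM.append h2 hM2) fun x hx hx' => ?_
  rcases (onPath_append hM).1 hx' with hx' | hx'
  · exact hM1 x hx' hx
  · exact absurd hx' (hd x hx)

theorem IsPath.exists_first_hit (h : IsPath G u p v) (P : α → Prop)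
    (hP : ∃ x, OnPath G u p x ∧ P x) :
    ∃ p₁ p₂ t, p = p₁ ++ p₂ ∧ IsPath G u p₁ t ∧ IsPath G t p₂ v ∧ P t ∧
      (∀ x, OnPath G u p₁ x → OnPath G t p₂ x → x = t) ∧ ∀ x, OnPath G u p₁ x → P x → x = t := by
  induction h with
  | nil h =>
    obtain ⟨x, hx, hPx⟩ := hP
    obtain rfl := onPath_nil.1 hx
    exact ⟨[], [], _, rfl, .nil h, .nil h, hPx, fun x hx _ => onPath_nil.1 hx,
      fun x hx _ => onPath_nil.1 hx⟩
  | @cons u w v e p h hp hne hin ih =>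
    by_cases hu : P u
    · exact ⟨[], e :: p, u, rfl, .nil h.left_mem, .cons h hp hne hin, hu,
        fun x hx _ => onPath_nil.1 hx, fun x hx _ => onPath_nil.1 hx⟩
    · obtain ⟨x, hx, hPx⟩ := hP
      have hx := ((onPath_cons h).1 hx).resolve_left fun hxu => hu (hxu ▸ hPx)
      obtain ⟨p₁, p₂, t, rfl, h1, h2, ht, h3, h4⟩ := ih ⟨x, hx, hPx⟩
      refine ⟨e :: p₁, p₂, t, rfl, .cons h h1 hne fun e' he' => hin e' (by simp [he']), h2, ht,
        fun x hx hx' => ?_, fun x hx hPx => ?_⟩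
      · rcases (onPath_cons h).1 hx with rfl | hx
        · exact absurd ((onPath_append h1).2 (.inr hx')) (not_onPath_tail h hne hin)
        · exact h3 x hx hx'
      · rcases (onPath_cons h).1 hx with rfl | hx
        exacts [absurd hPx hu, h4 x hx hPx]

/-- Every edge at a vertex `z` of a network that is not a terminal starts a path from `z` to one
of the terminals. -/
theorem IsNetwork.exists_path_of_inc (hn : IsNetwork G O D) (hz : G.Inc k z) : ∃ q t, (t = O ∨ t = D) ∧ IsPath G z (k :: q) t := by
  obtain ⟨s, hs, hks⟩ := hn.edge_on_route k hz.edge_mem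
  obtain ⟨s₁, s₂, rfl, h1, h2, -⟩ := hs.exists_split (.inr ⟨k, hks, hz⟩)
  have key : ∀ {s t}, IsPath G z s t → k ∈ s → ∃ q, s = k :: q := fun {s t} h hk => by
    cases s with
    | nil => simp at hk
    | cons m q => exact ⟨q, by rw [h.eq_of_inc_start hk hz]⟩
  rcases List.mem_append.1 hks with hk | hk
  · obtain ⟨q, hq⟩ := key h1.reverse.1 (by simpa using hk)
    exact ⟨q, O, .inl rfl, hq ▸ h1.reverse.1⟩
  · obtain ⟨q, hq⟩ := key h2 hk
    exact ⟨q, D, .inr rfl, hq ▸ h2⟩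

/-- Let `e` be a private edge of a longest route. Then an ear at the vertex before `e` returns to
the route behind the vertex after `e`. -/
theorem IsNetwork.exists_ear (hn : IsNetwork G O D) (h1 : IsPath G O p₁ a) (hl : G.IsLink e a b)
    (h2 : IsPath G b p₂ D) (hd : ∀ x, OnPath G O p₁ x → ¬ OnPath G b p₂ x)
    (hmax : ∀ r, IsPath G O r D → r.length ≤ (p₁ ++ e :: p₂).length)
    (hpriv : ∀ r, IsPath G O r D → e ∈ r → r = p₁ ++ e :: p₂)
    (haO : a ≠ O) (ha : HasThreeNeighbors G a) :
    ∃ M t, IsPath G a M t ∧ OnPath G b p₂ t ∧ t ≠ b ∧ (∃ g ∈ M, g ∉ p₁ ++ e :: p₂) ∧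
      ∀ x, OnPath G a M x → (OnPath G O p₁ x → x = a) ∧ (OnPath G b p₂ x → x = t) := by
  have haD : a ≠ D := fun haD => hd a h1.onPath_end (haD ▸ h2.onPath_end)
  have hab : a ≠ b := fun hab => hd a h1.onPath_end (hab ▸ .start)
  have h2a : ¬ OnPath G b p₂ a := hd a h1.onPath_end
  have h2' : IsPath G a (e :: p₂) D := .cons' hl h2 h2a
  -- the edges of the route at `a` lead to `b` and to one further vertex
  obtain ⟨c, hc⟩ : ∃ c, ∀ g ∈ p₁, ∀ w, G.IsLink g a w → w = c := by
    have hrev := h1.reverse.1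
    cases hp : p₁.reverse with
    | nil => exact ⟨a, fun g hg => by simp [List.reverse_eq_nil_iff.1 hp] at hg⟩
    | cons m q =>
      rw [hp] at hrev
      obtain ⟨c, hlc, -⟩ := hrev.cons_inv
      refine ⟨c, fun g hg w hw => ?_⟩
      obtain rfl := hrev.eq_of_inc_start (by rw [← hp]; simpa using hg) hw.inc_left
      exact hw.right_unique hlc
  -- Of three neighbours one differs from the two that the route uses, so its edge `g` is not on the
  -- route.
  obtain ⟨w, hwb, hwc, g, hg⟩ : ∃ w, w ≠ b ∧ w ≠ c ∧ G.Adj a w := by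
    obtain ⟨w₁, w₂, w₃, h12, h13, h23, ha1, ha2, ha3⟩ := ha
    by_cases c1 : w₁ ≠ b ∧ w₁ ≠ c
    · exact ⟨w₁, c1.1, c1.2, ha1⟩
    by_cases c2 : w₂ ≠ b ∧ w₂ ≠ c
    · exact ⟨w₂, c2.1, c2.2, ha2⟩
    by_cases c3 : w₃ ≠ b ∧ w₃ ≠ c
    · exact ⟨w₃, c3.1, c3.2, ha3⟩
    grind
  have hgr : g ∉ p₁ ++ e :: p₂ := fun hm => by
    rcases List.mem_append.1 hm with hm | hm
    · exact hwc (hc g hm w hg)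
    · obtain rfl := h2'.eq_of_inc_start hm hg.inc_left
      exact hwb (hg.right_unique hl)
  obtain ⟨q₀, t₀, ht₀, hq₀⟩ := hn.exists_path_of_inc hg.inc_left
  obtain ⟨w', hg', hq₁, hne, hin⟩ := hq₀.cons_inv
  obtain rfl := hg.right_unique hg'
  -- The path through `g` runs to a terminal, hence meets the route again; the ear stops at the
  -- first such vertex `t`.
  obtain ⟨q, q', t, rfl, hq, -, ht, -, hfirst⟩ := hq₁.exists_first_hit
    (fun x => OnPath G O p₁ x ∨ OnPath G b p₂ x) 
    ⟨t₀, hq₁.onPath_end, by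
      rcases ht₀ with rfl | rfl
      exacts [.inl .start, .inr h2.onPath_end]⟩
  have haq : ¬ OnPath G w q a := fun h => not_onPath_tail hg hne hin ((onPath_append hq).2 (.inl h))
  have hta : t ≠ a := fun hta => haq (hta ▸ hq.onPath_end)
  have hM : IsPath G a (g :: q) t := .cons' hg hq haq
  have hMon : ∀ x, OnPath G a (g :: q) x → OnPath G O p₁ x ∨ OnPath G b p₂ x → x = a ∨ x = t :=
    fun x hx hr => ((onPath_cons hg).1 hx).imp_right fun hx => hfirst x hx hr
  -- If the ear ended before `a`, then the route up to `t`, the ear backwards and the rest from `a`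
  -- would be another route through `e`, since it uses `g`.
  have ht1 : ¬ OnPath G O p₁ t := fun ht1 => by
    obtain ⟨pa, pb, rfl, ha1, hb1, hab1⟩ := h1.exists_split ht1
    have hna : ¬ OnPath G O pa a := fun h => hta (hab1 a h hb1.onPath_end).symm
    have hroute := ha1.splice hM.reverse.1 h2' (fun x hx hx' => ?_) (fun x hx hx' => ?_)
      (fun x hx hx' => ?_)
    · have := hpriv _ hroute (by simp)
      exact hgr (this ▸ by simp)
    · rcases (onPath_cons hl).1 hx' with rfl | hx'
      · exact hna hx
      · exact hd x ((onPath_append ha1).2 (.inl hx)) hx'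
    · rcases hMon x ((hM.reverse.2 x).1 hx) (.inl ((onPath_append ha1).2 (.inl hx'))) with rfl | h
      exacts [absurd hx' hna, h]
    · rcases (onPath_cons hl).1 hx' with h | hx'
      · exact h
      · rcases hMon x ((hM.reverse.2 x).1 hx) (.inr hx') with h | rfl
        exacts [h, absurd hx' (hd x ht1)]
  have ht2 := ht.resolve_left ht1
  have hon : ∀ x, OnPath G a (g :: q) x → (OnPath G O p₁ x → x = a) ∧ (OnPath G b p₂ x → x = t) :=
    fun x hx => ⟨fun h => (hMon x hx (.inl h)).resolve_right fun hxt => ht1 (hxt ▸ h),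
      fun h => (hMon x hx (.inr h)).resolve_left fun hxa => h2a (hxa ▸ h)⟩
  refine ⟨g :: q, t, hM, ht2, ?_, ⟨g, by simp, hgr⟩, hon⟩
  -- An ear that ends in `b` has at least two edges, so putting it in the place of `e` would
  -- lengthen a longest route.
  rintro rfl
  have := hmax _ (h1.splice hM h2 hd (fun x hx => (hon x hx).1) fun x hx => (hon x hx).2)
  have hq0 : q ≠ [] := hq.ne_nil hwb
  have := List.length_pos_iff.2 hq0
  simp only [List.length_append, List.length_cons] at *
  omega

/-- A route does not repeat an edge, so the number of edges bounds all lengths. -/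
theorem IsNetwork.exists_longest (hn : IsNetwork G O D) :
    ∃ r, IsPath G O r D ∧ ∀ r', IsPath G O r' D → r'.length ≤ r.length := by
  classical
  have hbd : ∀ r, IsPath G O r D → r.length ≤ G.edgeSet.ncard := fun r hr => by
    rw [← List.toFinset_card_of_nodup hr.nodup, ← Set.ncard_coe_finset]
    refine Set.ncard_le_ncard (fun e he => ?_) hn.finite_edgeSet
    exact hr.edge_mem (by simpa using he)
  obtain ⟨r₀, hr₀, -⟩ := hn.vertex_on_route O hn.origin_mem
  have hbdd : BddAbove {n | ∃ r, IsPath G O r D ∧ r.length = n} :=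
    ⟨G.edgeSet.ncard, by rintro n ⟨r, hr, rfl⟩; exact hbd r hr⟩
  have hne : {n | ∃ r, IsPath G O r D ∧ r.length = n}.Nonempty := ⟨_, r₀, hr₀, rfl⟩
  obtain ⟨r, hr, hrn⟩ := Nat.sSup_mem hne hbdd
  exact ⟨r, hr, fun r' hr' => hrn ▸ le_csSup hbdd ⟨r', hr', rfl⟩⟩

/-- In a linearly independent network all of whose inner vertices have at least three neighbours
every route is a single edge. -/
theorem IsThickLI.route_length (hn : IsThickLI T G O D)
    (h3 : ∀ v ∈ G.vertexSet, v ≠ O → v ≠ D → HasThreeNeighbors G v) (hr : IsPath G O r D) :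
    r.length ≤ 1 := by
  obtain ⟨m, hm, hmax⟩ := hn.1.exists_longest
  refine (hmax r hr).trans ?_
  by_contra hlen
  obtain ⟨e, he, hpriv, -⟩ := hn.2 m hm
  obtain ⟨p₁, p₂, rfl⟩ := List.append_of_mem he
  obtain ⟨a, h1, h2', hdis⟩ := hm.split
  obtain ⟨b, hl, h2, hne, hin⟩ := h2'.cons_inv
  have h2a : ¬ OnPath G b p₂ a := not_onPath_tail hl hne hin
  have hd : ∀ x, OnPath G O p₁ x → ¬ OnPath G b p₂ x := fun x hx hx' =>
    h2a (hdis x hx ((onPath_cons hl).2 (.inr hx')) ▸ hx')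
  have h1b : ¬ OnPath G O p₁ b := fun h => hd b h .start
  have ear1 : a ≠ O → _ := fun haO => hn.1.exists_ear h1 hl h2 hd hmax hpriv haO
    (h3 a h1.right_mem haO fun haD => h2a (haD ▸ h2.onPath_end))
  have hrev : (p₁ ++ e :: p₂).reverse = p₂.reverse ++ e :: p₁.reverse := by simp
  have ear2 : b ≠ D → _ := fun hbD => hn.1.reverse.exists_ear h2.reverse.1 hl.symm h1.reverse.1
    (fun x hx hx' => hd x ((h1.reverse.2 x).1 hx') ((h2.reverse.2 x).1 hx))
    (fun r hr => by
      have := hmax _ hr.reverse.1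
      rw [← hrev]; simpa only [List.length_reverse] using this)
    (fun r hr her => by
      rw [← hrev, ← hpriv _ hr.reverse.1 (by simpa using her), List.reverse_reverse]) hbD
    (h3 b h2.left_mem (fun hbO => h1b (hbO ▸ .start)) hbD)
  -- The ear at `a` ends strictly behind `b`, so `b` cannot be the last vertex. Symmetrically `a`
  -- cannot be the first, and both ears exist.
  have hbD : a ≠ O → b ≠ D := by
    rintro haO rfl
    obtain ⟨M, t, -, ht, htb, -⟩ := ear1 haO
    rw [h2.eq_nil, onPath_nil] at ht
    exact htb ht
  have haO : a ≠ O := by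
    rintro rfl
    have hbD : b ≠ D := by
      rintro rfl
      rw [h1.eq_nil, h2.eq_nil] at hlen
      simp at hlen
    obtain ⟨M, t, -, ht, htb, -⟩ := ear2 hbD
    rw [h1.eq_nil, List.reverse_nil, onPath_nil] at ht
    exact htb ht
  obtain ⟨P, t, hP, ht, htb, ⟨g, hgP, hgr⟩, hPon⟩ := ear1 haO
  obtain ⟨Q, s, hQ, hs, hsa, -, hQon⟩ := ear2 (hbD haO)
  have hs := (h1.reverse.2 s).1 hs
  have hQon : ∀ x, OnPath G b Q x → (OnPath G b p₂ x → x = b) ∧ (OnPath G O p₁ x → x = s) :=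
    fun x hx => ⟨fun h => (hQon x hx).1 ((h2.reverse.2 x).2 h),
      fun h => (hQon x hx).2 ((h1.reverse.2 x).2 h)⟩
  have hQa : ¬ OnPath G b Q a := fun h => hsa ((hQon a h).2 h1.onPath_end).symm
  have hPb : ¬ OnPath G a P b := fun h => htb ((hPon b h).2 .start).symm
  by_cases hPQ : ∃ x, OnPath G a P x ∧ OnPath G b Q x
  · obtain ⟨P₁, P₂, x, rfl, hP₁, hP₂, hxQ, hPd, hxP⟩ := hP.exists_first_hit (OnPath G b Q) hPQ
    obtain ⟨Q₁, Q₂, rfl, hQ₁, hQ₂, hQd⟩ := hQ.exists_split hxQ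
    have hP₁on : ∀ z, OnPath G a P₁ z → OnPath G a (P₁ ++ P₂) z := fun z hz =>
      (onPath_append hP₁).2 (.inl hz)
    have hQ₁on : ∀ z, OnPath G b Q₁ z → OnPath G b (Q₁ ++ Q₂) z := fun z hz =>
      (onPath_append hQ₁).2 (.inl hz)
    have hmid : IsPath G a (P₁ ++ Q₁.reverse) b := hP₁.append hQ₁.reverse.1 fun z hz hz' =>
      hxP z hz (hQ₁on z ((hQ₁.reverse.2 z).1 hz'))
    have hmidon : ∀ z, OnPath G a (P₁ ++ Q₁.reverse) z → OnPath G a P₁ z ∨ OnPath G b Q₁ z :=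
      fun z hz => ((onPath_append hP₁).1 hz).imp_right (hQ₁.reverse.2 z).1
    have hxa : x ≠ a := fun hxa => hQa (hxa ▸ hxQ)
    have hxb : x ≠ b := fun hxb => hPb (hxb ▸ hP₁on x hP₁.onPath_end)
    have hroute := h1.splice hmid h2 hd (fun z hz hz1 => ?_) (fun z hz hz2 => ?_)
    · have := hmax _ hroute
      have := List.length_pos_iff.2 (hP₁.ne_nil hxa.symm)
      have := List.length_pos_iff.2 (hQ₁.ne_nil hxb.symm)
      simp only [List.length_append, List.length_cons, List.length_reverse] at *
      omega
    · rcases hmidon z hz with hz | hz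
      · exact (hPon z (hP₁on z hz)).1 hz1
      · obtain rfl := (hQon z (hQ₁on z hz)).2 hz1
        obtain rfl := hQd z hz hQ₂.onPath_end
        exact (hPon z (hP₁on z hP₁.onPath_end)).1 hz1
    · rcases hmidon z hz with hz | hz
      · obtain rfl := (hPon z (hP₁on z hz)).2 hz2
        obtain rfl := hPd z hz hP₂.onPath_end
        exact (hQon z hxQ).1 hz2
      · exact (hQon z (hQ₁on z hz)).1 hz2
  · push Not at hPQ
    -- If the ears are disjoint, there is a route that goes to `s`, takes the ear to `b`, crosses
    -- `e` in the opposite direction to `a`, takes the other ear to `t` and goes on to `D`. It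
    -- contains the private edge `e` and the foreign edge `g`.
    obtain ⟨pa, pb, rfl, hpa, hpb, hpd⟩ := h1.exists_split hs
    obtain ⟨qa, qb, rfl, hqa, hqb, hqd⟩ := h2.exists_split ht
    have hpaon : ∀ z, OnPath G O pa z → OnPath G O (pa ++ pb) z := fun z hz =>
      (onPath_append hpa).2 (.inl hz)
    have hqbon : ∀ z, OnPath G t qb z → OnPath G b (qa ++ qb) z := fun z hz =>
      (onPath_append hqa).2 (.inr hz)
    have hePath : IsPath G b (e :: P) t := .cons' hl.symm hP hPb
    have hmid : IsPath G s (Q.reverse ++ e :: P) t := by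
      refine hQ.reverse.1.append hePath fun z hz hz' => ?_
      rcases (onPath_cons hl.symm).1 hz' with rfl | hz'
      exacts [rfl, absurd ((hQ.reverse.2 z).1 hz) (hPQ z hz')]
    have hmidon : ∀ z, OnPath G s (Q.reverse ++ e :: P) z → OnPath G b Q z ∨ OnPath G a P z := by
      intro z hz
      rcases (onPath_append hQ.reverse.1).1 hz with hz | hz
      · exact .inl ((hQ.reverse.2 z).1 hz)
      · rcases (onPath_cons hl.symm).1 hz with rfl | hz
        exacts [.inl .start, .inr hz]
    have hroute := hpa.splice hmid hqb (fun z hz hz' => hd z (hpaon z hz) (hqbon z hz'))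
      (fun z hz hz1 => ?_) (fun z hz hz2 => ?_)
    · exact hgr (hpriv _ hroute (by simp) ▸ by simp [hgP])
    · rcases hmidon z hz with hz | hz
      · exact (hQon z hz).2 (hpaon z hz1)
      · obtain rfl := (hPon z hz).1 (hpaon z hz1)
        exact absurd (hpd z hz1 hpb.onPath_end) hsa.symm
    · rcases hmidon z hz with hz | hz
      · obtain rfl := (hQon z hz).1 (hqbon z hz2)
        exact absurd (hqd z .start hz2) htb.symm
      · exact (hPon z hz).2 (hqbon z hz2)

end TwoTerminal

/-! ### Networks in which no reduction is possible -/

namespace TwoTerminal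

variable {α β : Type*} {G H G₁ G₂ H₁ H₂ K : Graph α β} {u v w x y z O D c a b s t : α} {e f k : β}
  {p q r p₁ p₂ M : List β} {T : Set β}

/-- No reduction at `v` is possible, or `v` has three neighbours. -/
def Stuck (T : Set β) (G : Graph α β) (O D v : α) : Prop :=
  HasThreeNeighbors G v ∨ ((∀ e f w, G.IsLink e v w → G.IsLink f v w → e = f) ∧
    (v ≠ O → v ≠ D → ∀ e f, G.Inc e v → G.Inc f v → e ≠ f → e ∈ T))

theorem IsNetwork.exists_two_edges (hn : IsNetwork G O D) (hv : v ∈ G.vertexSet) (hO : v ≠ O)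
    (hD : v ≠ D) : ∃ r, IsPath G O r D ∧ ∃ e ∈ r, ∃ f ∈ r, e ≠ f ∧ G.Inc e v ∧ G.Inc f v := by
  obtain ⟨r, hr, k, hk, hi⟩ := hn.vertex_on_route v hv
  exact ⟨r, hr, hr.exists_two_edges (.inr ⟨k, hk, hi⟩) hO hD⟩

/-- In a series of linearly independent networks without inner vertices that can be reduced, the
terminals have one neighbour and the inner vertices have at most two. -/
theorem IsThickSLI.neighbors (hn : IsThickSLI T G O D)
    (hs : ∀ v ∈ G.vertexSet, v ≠ O → v ≠ D → HasThreeNeighbors G v ∨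
      ∀ e f, G.Inc e v → G.Inc f v → e ≠ f → e ∈ T) :
    (∀ w w', G.Adj O w → G.Adj O w' → w = w') ∧ (∀ w w', G.Adj D w → G.Adj D w' → w = w') ∧
      ∀ v ∈ G.vertexSet, v ≠ O → v ≠ D → ¬ HasThreeNeighbors G v := by
  induction hn with
  | @of_isThickLI G O D hn =>
    have h3 : ∀ v ∈ G.vertexSet, v ≠ O → v ≠ D → HasThreeNeighbors G v := fun v hv hO hD => by
      -- A route through `v` has two edges there. If both were thick, both would have to be the one
      -- private edge of this route.
      refine (hs v hv hO hD).resolve_right fun hT => ?_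
      obtain ⟨r, hr, e, he, f, hf, hef, hev, hfv⟩ := hn.1.exists_two_edges hv hO hD
      obtain ⟨k, -, -, hk⟩ := hn.2 r hr
      exact hef ((hk e he (hT e f hev hfv hef)).trans (hk f hf (hT f e hfv hev hef.symm)).symm)
    -- Every edge lies on a route, which is now a single edge; so the part is a bundle of edges
    -- between its terminals.
    have hlink : ∀ k ∈ G.edgeSet, G.IsLink k O D := fun k hk => by
      obtain ⟨r, hr, hkr⟩ := hn.1.edge_on_route k hk
      have hlen := hn.route_length h3 hr
      match r, hr, hkr, hlen with
      | [m], hr, hkr, _ =>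
        obtain ⟨w, hl, hp, -⟩ := hr.cons_inv
        obtain rfl := hp.eq_of_nil
        rw [List.mem_singleton.1 hkr]
        exact hl
    refine ⟨fun w w' ⟨k, h⟩ ⟨k', h'⟩ => ?_, fun w w' ⟨k, h⟩ ⟨k', h'⟩ => ?_, fun v hv hO hD => ?_⟩
    · rw [h.right_unique (hlink k h.edge_mem), h'.right_unique (hlink k' h'.edge_mem)]
    · rw [h.right_unique (hlink k h.edge_mem).symm, h'.right_unique (hlink k' h'.edge_mem).symm]
    · obtain ⟨r, -, k, -, hi⟩ := hn.1.vertex_on_route v hv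
      rcases hi.eq_or_eq_of_isLink (hlink k hi.edge_mem) with h | h
      exacts [absurd h hO, absurd h hD]
  | @series G G₁ G₂ O c D h1 h2 hg ih1 ih2 =>
    have hdown : ∀ {G₁ G₂ : Graph α β}, IsGluedAt G G₁ G₂ c → ∀ v ∈ G₁.vertexSet, v ≠ c →
        (∀ w, G.Adj v w → G₁.Adj v w) := fun hg v hv hvc w ⟨k, hk⟩ =>
      ⟨k, hg.isLink_left hv hvc hk⟩
    have hstuck : ∀ {G₁ G₂ : Graph α β}, IsGluedAt G G₁ G₂ c → ∀ v ∈ G₁.vertexSet, v ≠ c → v ≠ O →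
        v ≠ D → HasThreeNeighbors G₁ v ∨ ∀ e f, G₁.Inc e v → G₁.Inc f v → e ≠ f → e ∈ T := by
      intro G₁ G₂ hg v hv hvc hO hD
      refine (hs v (hg.left_le.vertexSet_mono hv) hO hD).imp ?_ ?_
      · rintro ⟨a, b, d, h1, h2, h3, h4, h5, h6⟩
        exact ⟨a, b, d, h1, h2, h3, hdown hg v hv hvc a h4, hdown hg v hv hvc b h5,
          hdown hg v hv hvc d h6⟩
      · exact fun h e f he hf => h e f (he.mono hg.left_le) (hf.mono hg.left_le)
    have hD1 : ∀ v ∈ G₁.vertexSet, v ≠ c → v ≠ D := by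
      rintro v hv hvc rfl
      exact hvc ((hg.left_mem_iff hv).1 h2.dest_mem)
    have hO2 : ∀ v ∈ G₂.vertexSet, v ≠ c → v ≠ O := by
      rintro v hv hvc rfl
      exact hvc ((hg.symm.left_mem_iff hv).1 h1.origin_mem)
    obtain ⟨hO, hc1, hi1⟩ := ih1 fun v hv hvO hvc => hstuck hg v hv hvc hvO (hD1 v hv hvc)
    obtain ⟨hc2, hD, hi2⟩ := ih2 fun v hv hvc hvD => hstuck hg.symm v hv hvc (hO2 v hv hvc) hvD
    have hthree : ∀ {G₁ G₂ : Graph α β}, IsGluedAt G G₁ G₂ c → ∀ v ∈ G₁.vertexSet, v ≠ c →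
        HasThreeNeighbors G v → HasThreeNeighbors G₁ v := by
      rintro G₁ G₂ hg v hv hvc ⟨a, b, d, h1, h2, h3, h4, h5, h6⟩
      exact ⟨a, b, d, h1, h2, h3, hdown hg v hv hvc a h4, hdown hg v hv hvc b h5,
        hdown hg v hv hvc d h6⟩
    refine ⟨fun w w' hw hw' => hO w w' (hdown hg O h1.origin_mem h1.ne w hw)
        (hdown hg O h1.origin_mem h1.ne w' hw'), fun w w' hw hw' => hD w w'
        (hdown hg.symm D h2.dest_mem h2.ne.symm w hw)
        (hdown hg.symm D h2.dest_mem h2.ne.symm w' hw'), fun v hv hvO hvD h3 => ?_⟩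
    by_cases hvc : v = c
    · subst hvc
      obtain ⟨a, b, d, hab, had, hbd, ⟨ka, ha⟩, ⟨kb, hb⟩, ⟨kd, hd⟩⟩ := h3
      -- The cut vertex is a terminal of both parts and has one neighbour in each. Of three
      -- neighbours two would lie in the same part.
      have hcases : ∀ {k w}, G.IsLink k v w → G₁.Adj v w ∨ G₂.Adj v w := fun {k w} hk => by
        have hk' : k ∈ G₁.edgeSet ∪ G₂.edgeSet := by rw [hg.edgeSet_eq]; exact hk.edge_mem
        exact hk'.imp (fun h => ⟨k, (hg.left_le.isLink_iff h).2 hk⟩)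
          (fun h => ⟨k, (hg.right_le.isLink_iff h).2 hk⟩)
      rcases hcases ha with ha | ha <;> rcases hcases hb with hb | hb <;>
        rcases hcases hd with hd | hd
      · exact hab (hc1 _ _ ha hb)
      · exact hab (hc1 _ _ ha hb)
      · exact had (hc1 _ _ ha hd)
      · exact hbd (hc2 _ _ hb hd)
      · exact hbd (hc1 _ _ hb hd)
      · exact had (hc2 _ _ ha hd)
      · exact hab (hc2 _ _ ha hb)
      · exact hab (hc2 _ _ ha hb)
    · rcases (hg.vertexSet_eq ▸ hv : v ∈ G₁.vertexSet ∪ G₂.vertexSet) with hv | hv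
      · exact hi1 v hv hvO hvc (hthree hg v hv hvc h3)
      · exact hi2 v hv hvc hvD (hthree hg.symm v hv hvc h3)

/-! ### Counting -/

theorem IsNetwork.sum_ncard (hn : IsNetwork G O D) :
    ∑ v ∈ hn.finite_vertexSet.toFinset, {e | G.Inc e v}.ncard = 2 * G.edgeSet.ncard := by
  classical
  have := hn.loopless
  have h := Finset.sum_card_bipartiteAbove_eq_sum_card_bipartiteBelow (fun v e => G.Inc e v)
    (s := hn.finite_vertexSet.toFinset) (t := hn.finite_edgeSet.toFinset)
  have h1 : ∀ v, {e | G.Inc e v}.ncard =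
      (hn.finite_edgeSet.toFinset.bipartiteAbove (fun v e => G.Inc e v) v).card := fun v => by
    rw [← Set.ncard_coe_finset]
    congr 1
    ext e
    simp only [Set.mem_ofPred_eq, Finset.mem_coe, Finset.mem_bipartiteAbove, Set.Finite.mem_toFinset]
    exact ⟨fun h => ⟨h.edge_mem, h⟩, fun h => h.2⟩
  have h2 : ∀ e ∈ hn.finite_edgeSet.toFinset,
      (hn.finite_vertexSet.toFinset.bipartiteBelow (fun v e => G.Inc e v) e).card = 2 := by
    intro e he
    obtain ⟨x, y, hl⟩ := G.exists_isLink_of_mem_edgeSet (hn.finite_edgeSet.mem_toFinset.1 he)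
    rw [Finset.card_eq_two]
    refine ⟨x, y, hl.ne, ?_⟩
    ext z
    simp only [Finset.mem_bipartiteBelow, Set.Finite.mem_toFinset, Finset.mem_insert,
      Finset.mem_singleton]
    constructor
    · exact fun h => h.2.eq_or_eq_of_isLink hl
    · rintro (rfl | rfl)
      exacts [⟨hl.left_mem, hl.inc_left⟩, ⟨hl.right_mem, hl.inc_right⟩]
  simp_rw [h1]
  rw [h, Finset.sum_congr rfl h2, Finset.sum_const, smul_eq_mul, mul_comm,
    Set.ncard_eq_toFinset_card _ hn.finite_edgeSet]

theorem IsNetwork.finite_inc (hn : IsNetwork G O D) (v : α) : {e | G.Inc e v}.Finite :=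
  hn.finite_edgeSet.subset fun _ h => h.edge_mem

theorem IsNetwork.one_le_degree (hn : IsNetwork G O D) (hv : v ∈ G.vertexSet) :
    1 ≤ {e | G.Inc e v}.ncard := by
  obtain ⟨r, -, k, -, hi⟩ := hn.vertex_on_route v hv
  exact (Set.ncard_pos (hn.finite_inc v)).2 ⟨k, hi⟩

theorem IsNetwork.two_le_degree (hn : IsNetwork G O D) (hv : v ∈ G.vertexSet) (hO : v ≠ O)
    (hD : v ≠ D) : 2 ≤ {e | G.Inc e v}.ncard := by
  obtain ⟨r, -, e, -, f, -, hef, he, hf⟩ := hn.exists_two_edges hv hO hD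
  exact (Set.one_lt_ncard (hn.finite_inc v)).2 ⟨e, he, f, hf, hef⟩

/-- The least possible number of edges at a vertex of a network. -/
theorem IsNetwork.sum_min_degree [DecidableEq α] (hn : IsNetwork G O D) :
    ∑ v ∈ hn.finite_vertexSet.toFinset, (if v = O ∨ v = D then 1 else 2) + 2 =
      2 * G.vertexSet.ncard := by
  have hO := hn.finite_vertexSet.mem_toFinset.2 hn.origin_mem
  have hD := hn.finite_vertexSet.mem_toFinset.2 hn.dest_mem
  have hne := hn.origin_ne_dest
  have h2 : ∑ v ∈ hn.finite_vertexSet.toFinset, (if v = O ∨ v = D then 1 else 0) = 2 := by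
    rw [← Finset.sum_filter, Finset.sum_const, smul_eq_mul, mul_one, Finset.card_eq_two]
    refine ⟨O, D, hne, ?_⟩
    ext z
    simp only [Finset.mem_filter, Finset.mem_insert, Finset.mem_singleton]
    refine ⟨fun h => h.2, ?_⟩
    rintro (rfl | rfl)
    exacts [⟨hO, .inl rfl⟩, ⟨hD, .inr rfl⟩]
  have h3 : ∑ v ∈ hn.finite_vertexSet.toFinset, ((if v = O ∨ v = D then 1 else 2) +
      (if v = O ∨ v = D then 1 else 0)) = ∑ v ∈ hn.finite_vertexSet.toFinset, 2 :=
    Finset.sum_congr rfl fun v _ => by split_ifs <;> rfl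
  rw [Finset.sum_add_distrib, h2, Finset.sum_const, smul_eq_mul, mul_comm] at h3
  rw [h3, Set.ncard_eq_toFinset_card _ hn.finite_vertexSet]

theorem IsNetwork.min_degree_le [DecidableEq α] (hn : IsNetwork G O D) (hv : v ∈ G.vertexSet) :
    (if v = O ∨ v = D then 1 else 2) ≤ {e | G.Inc e v}.ncard := by
  split_ifs with h
  · exact hn.one_le_degree hv
  · push Not at h
    exact hn.two_le_degree hv h.1 h.2

/-- No vertex has three neighbours, so being stuck excludes parallel edges. Hence terminals have at
most one edge and inner vertices at most two. These are also the least numbers possible in a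
network, and the sum of the degrees is determined. -/
theorem IsThickSLI.card (hn : IsThickSLI T G O D) (hN : IsNetwork G O D)
    (hs : ∀ v ∈ G.vertexSet, Stuck T G O D v) : G.edgeSet.ncard + 1 = G.vertexSet.ncard := by
  classical
  obtain ⟨hO, hD, hi⟩ := hn.neighbors fun v hv hvO hvD => (hs v hv).imp_right fun h => h.2 hvO hvD
  have hpar : ∀ v ∈ G.vertexSet, ∀ e f w, G.IsLink e v w → G.IsLink f v w → e = f := by
    intro v hv
    refine ((hs v hv).resolve_left ?_).1
    by_cases hvO : v = O
    · subst hvO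
      rintro ⟨a, b, d, hab, -, -, ha, hb, -⟩
      exact hab (hO _ _ ha hb)
    by_cases hvD : v = D
    · subst hvD
      rintro ⟨a, b, d, hab, -, -, ha, hb, -⟩
      exact hab (hD _ _ ha hb)
    exact hi v hv hvO hvD
  have hterm : ∀ v, (∀ w w', G.Adj v w → G.Adj v w' → w = w') → v ∈ G.vertexSet →
      {e | G.Inc e v}.ncard ≤ 1 := by
    intro v h hv
    rw [Set.ncard_le_one (hN.finite_inc v)]
    rintro e ⟨w, he⟩ f ⟨w', hf⟩
    obtain rfl := h w w' ⟨e, he⟩ ⟨f, hf⟩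
    exact hpar v hv e f w he hf
  have hdeg : ∀ v ∈ hN.finite_vertexSet.toFinset, {e | G.Inc e v}.ncard ≤
      if v = O ∨ v = D then 1 else 2 := by
    intro v hv
    replace hv := hN.finite_vertexSet.mem_toFinset.1 hv
    split_ifs with h
    · rcases h with rfl | rfl
      exacts [hterm _ hO hv, hterm _ hD hv]
    · push Not at h
      by_contra hlt
      obtain ⟨e, f, k, ⟨a, he⟩, ⟨b, hf⟩, ⟨d, hk⟩, hef, hek, hfk⟩ :=
        (Set.two_lt_ncard_iff (hN.finite_inc v)).1 (not_le.1 hlt)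
      refine hi v hv h.1 h.2 ⟨a, b, d, ?_, ?_, ?_, ⟨e, he⟩, ⟨f, hf⟩, ⟨k, hk⟩⟩
      · rintro rfl; exact hef (hpar v hv e f a he hf)
      · rintro rfl; exact hek (hpar v hv e k a he hk)
      · rintro rfl; exact hfk (hpar v hv f k b hf hk)
  have h1 := Finset.sum_le_sum hdeg
  have h2 := Finset.sum_le_sum fun v hv => hN.min_degree_le (hN.finite_vertexSet.mem_toFinset.1 hv)
  have h3 := hN.sum_min_degree
  have h4 := hN.sum_ncard
  omega

/-- The status of the edge is irrelevant: on the only route it is the only candidate for a private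
edge and the only edge that can be thick. Hence no assumption on `T` is needed for chains. -/
theorem isThickLI_of_single (hl : G.IsLink e u v) (huv : u ≠ v) (hE : G.edgeSet = {e})
    (hV : G.vertexSet ⊆ {u, v}) : IsThickLI T G u v := by
  have he : ∀ {k}, k ∈ G.edgeSet → k = e := fun hk => by rwa [hE] at hk
  have hroute : ∀ r, IsPath G u r v → r = [e] := fun r hr => by
    cases r with
    | nil => exact absurd hr.eq_of_nil huv
    | cons k p =>
      obtain ⟨w, hl', hp, -⟩ := hr.cons_inv
      obtain rfl := he hl'.edge_mem
      obtain rfl := hl.right_unique hl'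
      rw [hp.eq_nil]
  refine ⟨⟨(Set.toFinite _).subset hV, hE ▸ Set.finite_singleton e, ?_, hl.left_mem, hl.right_mem,
    huv, fun k hk => ⟨[e], .single hl huv, by simp [he hk]⟩, fun z hz =>
      ⟨[e], .single hl huv, e, by simp, ?_⟩⟩, fun r hr => ⟨e, by simp [hroute r hr],
      fun r' hr' _ => by rw [hroute r hr, hroute r' hr'], fun f hf _ => ?_⟩⟩
  · rw [Graph.loopless_iff_forall_ne_of_adj]
    rintro x y ⟨k, hk⟩ rfl
    obtain rfl := he hk.edge_mem
    rcases hl.eq_and_eq_or_eq_and_eq hk with ⟨h1, h2⟩ | ⟨h1, h2⟩ <;> exact huv (h1.trans h2.symm)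
  · rcases hV hz with rfl | rfl
    exacts [hl.inc_left, hl.inc_right]
  · simpa [hroute r hr] using hf

/-- A chain of edges is a series of linearly independent networks. -/
theorem IsPath.isThickSLI (hr : IsPath G u r v) (hr0 : r ≠ []) (hE : ∀ e ∈ G.edgeSet, e ∈ r)
    (hV : ∀ x ∈ G.vertexSet, OnPath G u r x) : IsThickSLI T G u v := by
  induction r generalizing G u with
  | nil => exact absurd rfl hr0
  | cons e p ih =>
    obtain ⟨w, hl, hp, hne, hin⟩ := hr.cons_inv
    by_cases hp0 : p = []
    · subst hp0
      obtain rfl := hp.eq_of_nil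
      refine .of_isThickLI (isThickLI_of_single hl hne ?_ fun x hx => ?_)
      · exact Set.Subset.antisymm (fun k hk => by simpa using hE k hk)
          (by simpa using hl.edge_mem)
      · rcases (onPath_cons hl).1 (hV x hx) with h | h
        exacts [.inl h, .inr (onPath_nil.1 h)]
    have hep : e ∉ p := fun hm => hin e hm hl.inc_left
    have h1 : IsSubPair G {u, w} {e} := by
      refine ⟨?_, by simpa using hl.edge_mem, ?_⟩
      · rintro x (rfl | rfl)
        exacts [hl.left_mem, hl.right_mem]
      · rintro k rfl x hx
        exact hx.eq_or_eq_of_isLink hl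
    have h2 : IsSubPair G (G.vertexSet \ {u}) (G.edgeSet \ {e}) := by
      refine ⟨Set.sdiff_subset, Set.sdiff_subset, fun k hk x hx => ⟨hx.vertex_mem, ?_⟩⟩
      rintro rfl
      exact hin k ((List.mem_cons.1 (hE k hk.1)).resolve_left hk.2) hx
    have hpE : ∀ k ∈ p, k ∈ (sub G (G.vertexSet \ {u}) (G.edgeSet \ {e})).edgeSet := by
      intro k hk
      rw [h2.sub_edgeSet]
      exact ⟨hp.edge_mem hk, fun hke => hep (hke ▸ hk)⟩
    have hp' : IsPath (sub G (G.vertexSet \ {u}) (G.edgeSet \ {e})) w p v := by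
      refine hp.anti sub_le ?_ hpE
      rw [h2.sub_vertexSet]
      exact ⟨hl.right_mem, hne.symm⟩
    refine .series (.of_isThickLI (isThickLI_of_single (h1.sub_isLink.2 ⟨rfl, hl⟩) hne
        h1.sub_edgeSet h1.sub_vertexSet.subset)) (ih hp' hp0 (fun k hk => ?_) fun x hx => ?_)
      (isGluedAt_sub h1 h2 ?_ ?_ ?_ ?_)
    · rw [h2.sub_edgeSet] at hk
      exact (List.mem_cons.1 (hE k hk.1)).resolve_left hk.2
    · rw [h2.sub_vertexSet] at hx
      rw [onPath_congr_of_le sub_le hpE]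
      exact ((onPath_cons hl).1 (hV x hx.1)).resolve_left hx.2
    · ext x
      constructor
      · rintro ((rfl | rfl) | hx)
        exacts [hl.left_mem, hl.right_mem, hx.1]
      · intro hx
        by_cases hxu : x = u
        exacts [.inl (.inl hxu), .inr ⟨hx, hxu⟩]
    · rw [Set.union_sdiff_self, Set.union_eq_right.2]
      simpa using hl.edge_mem
    · ext x
      constructor
      · rintro ⟨rfl | rfl, hx⟩
        exacts [absurd rfl hx.2, rfl]
      · rintro rfl
        exact ⟨.inr rfl, hl.right_mem, hne.symm⟩
    · rw [Set.disjoint_singleton_left]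
      exact fun h => h.2 rfl

/-- If no vertex has more than two edges, a path that has come to `u` through `k` has no choice how
to go on. -/
theorem IsPath.eq_of_degree_le_two (hp : IsPath G u p v) (hq : IsPath G u q v)
    (h3 : ∀ x e f k, G.Inc e x → G.Inc f x → G.Inc k x → e = f ∨ e = k ∨ f = k)
    (hk : G.Inc k u) (hkp : k ∉ p) (hkq : k ∉ q) : p = q := by
  induction hp generalizing q k with
  | nil => rw [hq.eq_nil]
  | @cons u w v e p hl hp hne hin ih =>
    cases q with
    | nil =>
      obtain rfl := hq.eq_of_nil
      exact absurd hp.onPath_end (not_onPath_tail hl hne hin)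
    | cons f q =>
      obtain ⟨w', hl', hq', hne', hin'⟩ := hq.cons_inv
      have hef : e = f := by
        rcases h3 u e f k hl.inc_left hl'.inc_left hk with h | rfl | rfl
        · exact h
        · simp at hkp
        · simp at hkq
      subst hef
      obtain rfl := hl.right_unique hl'
      rw [ih hq' hl.inc_right (fun hm => hin e hm hl.inc_left) fun hm => hin' e hm hl.inc_left]

/-- The sum of the degrees attains its minimum, so each degree does. Then the route is unique, and
since every edge and every vertex lies on a route, the network is this one chain. -/
theorem IsNetwork.isThickSLI_of_card (hn : IsNetwork G O D)
    (hc : G.edgeSet.ncard + 1 = G.vertexSet.ncard) : IsThickSLI T G O D := by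
  classical
  have hdeg : ∀ v ∈ hn.finite_vertexSet.toFinset,
      (if v = O ∨ v = D then 1 else 2) = {e | G.Inc e v}.ncard := by
    refine (Finset.sum_eq_sum_iff_of_le fun v hv =>
      hn.min_degree_le (hn.finite_vertexSet.mem_toFinset.1 hv)).1 ?_
    have h3 := hn.sum_min_degree
    have h4 := hn.sum_ncard
    omega
  have h3 : ∀ x e f k, G.Inc e x → G.Inc f x → G.Inc k x → e = f ∨ e = k ∨ f = k := by
    intro x e f k he hf hk
    by_contra! hne
    have h1 := (Set.two_lt_ncard_iff (hn.finite_inc x)).2 ⟨e, f, k, he, hf, hk, hne⟩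
    have h2 := hdeg x (hn.finite_vertexSet.mem_toFinset.2 he.vertex_mem)
    rw [← h2] at h1
    split_ifs at h1 <;> omega
  have hO : ∀ e f, G.Inc e O → G.Inc f O → e = f := fun e f he hf => by
    have h2 := hdeg O (hn.finite_vertexSet.mem_toFinset.2 hn.origin_mem)
    rw [if_pos (.inl rfl)] at h2
    exact (Set.ncard_le_one (hn.finite_inc O)).1 h2.symm.le e he f hf
  have huniq : ∀ p q, IsPath G O p D → IsPath G O q D → p = q := by
    intro p q hp hq
    cases p with
    | nil => exact absurd hp.eq_of_nil hn.origin_ne_dest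
    | cons e p =>
      cases q with
      | nil => exact absurd hq.eq_of_nil hn.origin_ne_dest
      | cons f q =>
        obtain ⟨w, hl, hp', hne, hin⟩ := hp.cons_inv
        obtain ⟨w', hl', hq', hne', hin'⟩ := hq.cons_inv
        obtain rfl := hO e f hl.inc_left hl'.inc_left
        obtain rfl := hl.right_unique hl'
        rw [hp'.eq_of_degree_le_two hq' h3 hl.inc_right (fun hm => hin e hm hl.inc_left)
          fun hm => hin' e hm hl.inc_left]
  obtain ⟨r, hr, -⟩ := hn.vertex_on_route O hn.origin_mem
  refine hr.isThickSLI (hr.ne_nil hn.origin_ne_dest) (fun e he => ?_) fun x hx => ?_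
  · obtain ⟨r', hr', her⟩ := hn.edge_on_route e he
    rwa [huniq r r' hr hr']
  · obtain ⟨r', hr', k, hk, hi⟩ := hn.vertex_on_route x hx
    rw [huniq r r' hr hr']
    exact .inr ⟨k, hk, hi⟩

end TwoTerminal

namespace TwoTerminal

/-! ## The invariant of the reduction algorithm -/

/-- The current network `G` of the reduction algorithm, as described by the numbers in memory:
`a` and `b` are the ends of the edges, `st` is their status (`0` thin, `1` thick, `2` removed), `M` is
the number of vertices plus the number of merged edges, `L u` lists the edges at `u`, possibly with
some removed ones. The vertices at which a reduction is possible satisfy `P`. The network is a series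
of linearly independent ones if and only if `S` holds. -/
structure Reduced (S : Prop) (nV nE O D : ℕ) (a b st : ℕ → ℕ) (M : ℕ) (G : Graph ℕ ℕ)
    (L : ℕ → List ℕ) (P : ℕ → Prop) : Prop where
  net : IsNetwork G O D
  sli : IsThickSLI {e | st e ≠ 0} G O D ↔ S
  vert : ∀ v ∈ G.vertexSet, v < nV
  edge : ∀ e, e ∈ G.edgeSet ↔ e < nE ∧ st e ≠ 2
  link : ∀ e ∈ G.edgeSet, G.IsLink e (a e) (b e)
  card : G.edgeSet.ncard + M = nE + G.vertexSet.ncard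
  nodup : ∀ u, (L u).Nodup
  lt : ∀ u, ∀ e ∈ L u, e < nE
  inc : ∀ u, ∀ e ∈ L u, e ∈ G.edgeSet → G.Inc e u
  cov : ∀ u e, G.Inc e u → e ∈ L u
  stuck : ∀ u ∈ G.vertexSet, P u ∨ Stuck {e | st e ≠ 0} G O D u

variable {S : Prop} {nV nE O D M v w x y e f : ℕ} {a b st : ℕ → ℕ} {G H : Graph ℕ ℕ}
  {L L' : ℕ → List ℕ} {P P' : ℕ → Prop}

/-- Removed edges may stay on the lists or be dropped, and the order is immaterial; this is what
permits deletion to be lazy. -/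
theorem Reduced.congr_list (h : Reduced S nV nE O D a b st M G L P)
    (hnodup : ∀ u, (L' u).Nodup) (hsub : ∀ u, ∀ e ∈ L' u, e ∈ L u)
    (hcov : ∀ u, ∀ e ∈ L u, e ∈ G.edgeSet → e ∈ L' u) :
    Reduced S nV nE O D a b st M G L' P where
  __ := h
  nodup := hnodup
  lt u e he := h.lt u e (hsub u e he)
  inc u e he := h.inc u e (hsub u e he)
  cov u e hi := hcov u e (h.cov u e hi) hi.edge_mem

theorem Reduced.congr_pending (h : Reduced S nV nE O D a b st M G L P)
    (hP : ∀ u ∈ G.vertexSet, P u → P' u ∨ Stuck {e | st e ≠ 0} G O D u) :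
    Reduced S nV nE O D a b st M G L P' where
  __ := h
  stuck u hu := (h.stuck u hu).elim (hP u hu) .inr

/-- The edge `e` disappears and `f` becomes thick; the counter rises by one as the number of edges
falls. No vertex needs a new visit. -/
theorem Reduced.merge (h : Reduced S nV nE O D a b st M G L P) (hef : e ≠ f)
    (he : G.IsLink e v w) (hf : G.IsLink f v w) :
    Reduced S nV nE O D a b (Function.update (Function.update st e 2) f 1) (M + 1)
      (G.deleteEdges {e}) L P := by
  have hr := removesEdge_deleteEdges G e
  have := h.net.loopless
  have hE : ∀ k, k ∈ (G.deleteEdges {e}).edgeSet ↔ k ∈ G.edgeSet ∧ k ≠ e := fun k => by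
    rw [hr.edgeSet_eq]; rfl
  have hT : ∀ k ∈ (G.deleteEdges {e}).edgeSet,
      (Function.update (Function.update st e 2) f 1 k ≠ 0 ↔ k = f ∨ st k ≠ 0) := fun k hk => by
    have hke := ((hE k).1 hk).2
    by_cases hkf : k = f
    · subst hkf; simp
    · simp [hkf, hke]
  refine ⟨hr.isNetwork hef.symm hf he h.net, ?_, fun u hu => h.vert u (hr.vertexSet_eq ▸ hu),
    fun k => ?_, fun k hk => (hr.le.isLink_iff hk).2 (h.link k ((hE k).1 hk).1), ?_, h.nodup, h.lt,
    fun u k hk hkE => (hr.le.inc_congr hkE).2 (h.inc u k hk ((hE k).1 hkE).1),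
    fun u k hi => h.cov u k (hi.mono hr.le), fun u hu => ?_⟩
  · rw [← h.sli]
    constructor
    · intro hs
      exact (hs.mono (T' := insert f {e | st e ≠ 0}) fun k hk hkT => (hT k hk).2 hkT).of_removesEdge
        hr hef.symm hf he he.ne
    · intro hs
      exact (hs.removesEdge hr hef.symm hf he he.ne).mono fun k hk hkT => (hT k hk).1 hkT
  · rw [hE, h.edge]
    by_cases hkf : k = f
    · subst hkf
      have := (h.edge k).1 hf.edge_mem
      simp [this, hef.symm]
    · by_cases hke : k = e
      · subst hke; simp [hkf]
      · simp [hkf, hke]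
  · rw [hr.edgeSet_eq, hr.vertexSet_eq, ← h.card,
      ← Set.ncard_sdiff_singleton_add_one he.edge_mem h.net.finite_edgeSet]
    omega
  · rw [hr.vertexSet_eq] at hu
    refine (h.stuck u hu).imp_right (Or.imp ?_ ?_)
    · have hadj : ∀ z, G.Adj u z → (G.deleteEdges {e}).Adj u z := by
        rintro z ⟨k, hk⟩
        by_cases hke : k = e
        · subst hke
          refine ⟨f, (hr.le.isLink_iff ((hE f).2 ⟨hf.edge_mem, hef.symm⟩)).2 ?_⟩
          rw [hf.isLink_iff]
          exact he.eq_and_eq_or_eq_and_eq hk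
        · exact ⟨k, (hr.le.isLink_iff ((hE k).2 ⟨hk.edge_mem, hke⟩)).2 hk⟩
      rintro ⟨a, b, c, h1, h2, h3, h4, h5, h6⟩
      exact ⟨a, b, c, h1, h2, h3, hadj a h4, hadj b h5, hadj c h6⟩
    · rintro ⟨h1, h2⟩
      refine ⟨fun k m z hk hm => h1 k m z (hk.mono hr.le) (hm.mono hr.le), fun hO hD k m hk hm hkm => ?_⟩
      exact (hT k hk.edge_mem).2 (.inr (h2 hO hD k m (hk.mono hr.le) (hm.mono hr.le) hkm))

/-- Only at `x` and `y` do the edges change, so only these two must become pending. The edge `e` is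
already listed at `x` and is added at `y`, where `f` may remain as a removed edge. Edges and
vertices both decrease by one, so the counter stays. -/
theorem Reduced.contracted (h : Reduced S nV nE O D a b st M G L P) (hef : e ≠ f) (hxy : x ≠ y)
    (he : G.IsLink e v x) (hf : G.IsLink f v y) (only : ∀ k, G.Inc k v → k = e ∨ k = f)
    (hO : v ≠ O) (hD : v ≠ D) (hst : st f = 0) (hPx : P' x) (hPy : P' y)
    (hP : ∀ u, u ≠ v → P u → P' u) :
    ∃ H : Graph ℕ ℕ, H.vertexSet.ncard + 1 = G.vertexSet.ncard ∧
      Reduced S nV nE O D (Function.update a e x) (Function.update b e y)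
        (Function.update st f 2) M H (Function.update (Function.update L v []) y (e :: L y)) P' := by
  have := h.net.loopless
  have hvx := he.ne
  have hvy := hf.ne
  have hc : Contracts G (contract G v x y e f ⟨he.right_mem, hvx.symm⟩ ⟨hf.right_mem, hvy.symm⟩ only)
      v x y e f := ⟨he, hf, hef, hxy, hvx, hvy, only, rfl, fun _ _ _ => Iff.rfl⟩
  set H := contract G v x y e f ⟨he.right_mem, hvx.symm⟩ ⟨hf.right_mem, hvy.symm⟩ only
  have hfH : f ∉ H.edgeSet := fun hm => (hc.edge_mem_iff.1 hm).2 rfl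
  have hV : H.vertexSet.ncard + 1 = G.vertexSet.ncard := by
    rw [hc.vertexSet_eq, Set.ncard_sdiff_singleton_add_one he.left_mem h.net.finite_vertexSet]
  have hT : ∀ k ∈ H.edgeSet, (Function.update st f 2 k ≠ 0 ↔ st k ≠ 0) := fun k hk => by
    have hkf := (hc.edge_mem_iff.1 hk).2
    simp [hkf]
  have hei : ∀ u, G.Inc e u → u = v ∨ u = x := fun u hu => hu.eq_or_eq_of_isLink he
  have hfi : ∀ u, G.Inc f u → u = v ∨ u = y := fun u hu => hu.eq_or_eq_of_isLink hf
  refine ⟨H, hV, hc.isNetwork h.net hO.symm hD.symm, ?_,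
    fun u hu => h.vert u (hc.mem_iff.1 hu).1, fun k => ?_, fun k hk => ?_, ?_, fun u => ?_,
    fun u k hk => ?_, fun u k hk hkH => ?_, fun u k hi => ?_, fun u hu => ?_⟩
  · rw [← h.sli]
    constructor
    · intro hs
      exact (hs.mono (T' := {e | st e ≠ 0}) fun k hk hkT => (hT k hk).2 hkT).of_contracts hc
        (by simp [hst])
    · intro hs
      exact (hs.contracts hc hO.symm hD.symm).mono fun k hk hkT => (hT k hk).1 hkT
  · rw [hc.edge_mem_iff, h.edge]
    by_cases hkf : k = f
    · subst hkf; simp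
    · simp [hkf]
  · rw [hc.isLink_iff]
    by_cases hke : k = e
    · subst hke; simp
    · obtain ⟨hk, hkf⟩ := hc.edge_mem_iff.1 hk
      simpa [hke, hkf] using h.link k hk
  · have hcard := h.card
    have := Set.ncard_sdiff_singleton_add_one hf.edge_mem h.net.finite_edgeSet
    rw [hc.edgeSet_eq]
    omega
  · by_cases huy : u = y
    · subst huy
      rw [Function.update_self, List.nodup_cons]
      -- Before the contraction `e` ends in `v` and `x`, so it cannot yet be on the list of `y`.
      refine ⟨fun hm => ?_, h.nodup u⟩
      rcases hei u (h.inc u e hm he.edge_mem) with h1 | h1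
      exacts [hvy h1.symm, hxy h1.symm]
    · rw [Function.update_of_ne huy]
      by_cases huv : u = v
      · subst huv; simp
      · rw [Function.update_of_ne huv]; exact h.nodup u
  · by_cases huy : u = y
    · subst huy
      rw [Function.update_self] at hk
      rcases List.mem_cons.1 hk with rfl | hk
      exacts [((h.edge k).1 he.edge_mem).1, h.lt u k hk]
    · rw [Function.update_of_ne huy] at hk
      by_cases huv : u = v
      · subst huv; simp at hk
      · rw [Function.update_of_ne huv] at hk; exact h.lt u k hk
  · obtain ⟨hkG, hkf⟩ := hc.edge_mem_iff.1 hkH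
    rw [hc.inc_iff]
    by_cases huy : u = y
    · subst huy
      rw [Function.update_self] at hk
      by_cases hke : k = e
      · exact .inl ⟨hke, .inr rfl⟩
      · exact .inr ⟨hke, hkf, h.inc u k ((List.mem_cons.1 hk).resolve_left hke) hkG⟩
    · rw [Function.update_of_ne huy] at hk
      by_cases huv : u = v
      · subst huv; simp at hk
      · rw [Function.update_of_ne huv] at hk
        have hi := h.inc u k hk hkG
        by_cases hke : k = e
        · subst hke
          exact .inl ⟨rfl, .inl ((hei u hi).resolve_left huv)⟩
        · exact .inr ⟨hke, hkf, hi⟩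
  · have huv : u ≠ v := (hc.mem_iff.1 hi.vertex_mem).2
    rcases hc.inc_iff.1 hi with ⟨rfl, rfl | rfl⟩ | ⟨hke, hkf, hi⟩
    · rw [Function.update_of_ne hxy, Function.update_of_ne huv]
      exact h.cov u k he.inc_right
    · simp
    · have := h.cov u k hi
      by_cases huy : u = y
      · subst huy; simp [this]
      · rwa [Function.update_of_ne huy, Function.update_of_ne huv]
  · obtain ⟨huG, huv⟩ := hc.mem_iff.1 hu
    by_cases hux : u = x
    · exact .inl (hux ▸ hPx)
    by_cases huy : u = y
    · exact .inl (huy ▸ hPy)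
    have hlink : ∀ k z, H.IsLink k u z ↔ G.IsLink k u z := by
      intro k z
      rw [hc.isLink_iff]
      constructor
      · rintro (⟨-, ⟨h1, -⟩ | ⟨h1, -⟩⟩ | ⟨-, -, h1⟩)
        exacts [absurd h1 hux, absurd h1 huy, h1]
      · intro h1
        refine .inr ⟨?_, ?_, h1⟩
        · rintro rfl; exact (hei u h1.inc_left).elim huv hux
        · rintro rfl; exact (hfi u h1.inc_left).elim huv huy
    refine (h.stuck u huG).imp (hP u huv) (Or.imp ?_ ?_)
    · rintro ⟨a, b, c, h1, h2, h3, ⟨k4, h4⟩, ⟨k5, h5⟩, ⟨k6, h6⟩⟩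
      exact ⟨a, b, c, h1, h2, h3, ⟨k4, (hlink _ _).2 h4⟩, ⟨k5, (hlink _ _).2 h5⟩,
        ⟨k6, (hlink _ _).2 h6⟩⟩
    · rintro ⟨h1, h2⟩
      refine ⟨fun k m z hk hm => h1 k m z ((hlink _ _).1 hk) ((hlink _ _).1 hm), ?_⟩
      rintro hO hD k m ⟨z, hk⟩ ⟨z', hm⟩ hkm
      refine (hT k hk.edge_mem).2 (h2 hO hD k m ⟨z, (hlink _ _).1 hk⟩ ⟨z', (hlink _ _).1 hm⟩ hkm)

/-- When no reduction is possible any more, counting decides. -/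
theorem Reduced.decide (h : Reduced S nV nE O D a b st M G L fun _ => False) :
    S ↔ M = nE + 1 := by
  have hs : ∀ v ∈ G.vertexSet, Stuck {e | st e ≠ 0} G O D v := fun v hv =>
    (h.stuck v hv).resolve_left id
  have hcard := h.card
  rw [← h.sli]
  constructor
  · intro hS
    have := hS.card h.net hs
    omega
  · intro hM
    exact h.net.isThickSLI_of_card (by omega)

end TwoTerminal

namespace Ram

variable {s s' : State} {Q Q' : ℕ → State → Prop}

@[simp] theorem State.reg_setReg (s : State) (x k y : ℕ) :
    (s.setReg x k).reg y = if y = x then k else s.reg y := by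
  simp [State.setReg, Function.update_apply]

@[simp] theorem State.arr_setReg (s : State) (x k : ℕ) : (s.setReg x k).arr = s.arr := rfl

@[simp] theorem State.reg_setArr (s : State) (a i k : ℕ) : (s.setArr a i k).reg = s.reg := rfl

@[simp] theorem State.arr_setArr (s : State) (a i k c : ℕ) :
    (s.setArr a i k).arr c = if c = a then Function.update (s.arr a) i k else s.arr c := by
  simp [State.setArr, Function.update_apply]

/-! ## Reasoning about programs -/

/-- The program `p`, started in `s`, halts; the number of steps and the final state satisfy `Q`. -/
def Wp (p : Prog) (s : State) (Q : ℕ → State → Prop) : Prop :=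
  ∃ t s', Runs p s t s' ∧ Q t s'

theorem Wp.mono {p : Prog} (h : Wp p s Q) (hQ : ∀ t s', Q t s' → Q' t s') : Wp p s Q' := by
  obtain ⟨t, s', hr, hq⟩ := h
  exact ⟨t, s', hr, hQ t s' hq⟩

@[simp] theorem wp_skip : Wp .skip s Q ↔ Q 1 s :=
  ⟨fun ⟨_, _, hr, hq⟩ => by cases hr; exact hq, fun h => ⟨_, _, .skip, h⟩⟩

@[simp] theorem wp_const {x k : ℕ} : Wp (.const x k) s Q ↔ Q 1 (s.setReg x k) :=
  ⟨fun ⟨_, _, hr, hq⟩ => by cases hr; exact hq, fun h => ⟨_, _, .const, h⟩⟩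

@[simp] theorem wp_move {x y : ℕ} : Wp (.move x y) s Q ↔ Q 1 (s.setReg x (s.reg y)) :=
  ⟨fun ⟨_, _, hr, hq⟩ => by cases hr; exact hq, fun h => ⟨_, _, .move, h⟩⟩

@[simp] theorem wp_succ {x : ℕ} : Wp (.succ x) s Q ↔ Q 1 (s.setReg x (s.reg x + 1)) :=
  ⟨fun ⟨_, _, hr, hq⟩ => by cases hr; exact hq, fun h => ⟨_, _, .succ, h⟩⟩

@[simp] theorem wp_load {x a i : ℕ} :
    Wp (.load x a i) s Q ↔ Q 1 (s.setReg x (s.arr a (s.reg i))) :=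
  ⟨fun ⟨_, _, hr, hq⟩ => by cases hr; exact hq, fun h => ⟨_, _, .load, h⟩⟩

@[simp] theorem wp_store {a i x : ℕ} :
    Wp (.store a i x) s Q ↔ Q 1 (s.setArr a (s.reg i) (s.reg x)) :=
  ⟨fun ⟨_, _, hr, hq⟩ => by cases hr; exact hq, fun h => ⟨_, _, .store, h⟩⟩

@[simp] theorem wp_seq {p q : Prog} :
    Wp (.seq p q) s Q ↔ Wp p s fun t s' => Wp q s' fun t' s'' => Q (t + t') s'' := by
  constructor
  · rintro ⟨_, _, hr, hq⟩
    cases hr with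
    | seq h1 h2 => exact ⟨_, _, h1, _, _, h2, hq⟩
  · rintro ⟨_, _, h1, _, _, h2, hq⟩
    exact ⟨_, _, .seq h1 h2, hq⟩

@[simp] theorem wp_cond {b : Test} {p q : Prog} : Wp (.cond b p q) s Q ↔
    (b.Holds s → Wp p s fun t s' => Q (t + 1) s') ∧
      (¬ b.Holds s → Wp q s fun t s' => Q (t + 1) s') := by
  constructor
  · rintro ⟨_, _, hr, hq⟩
    cases hr with
    | cond_true hb h => exact ⟨fun _ => ⟨_, _, h, hq⟩, fun hb' => absurd hb hb'⟩
    | cond_false hb h => exact ⟨fun hb' => absurd hb' hb, fun _ => ⟨_, _, h, hq⟩⟩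
  · rintro ⟨h1, h2⟩
    by_cases hb : b.Holds s
    · obtain ⟨_, _, h, hq⟩ := h1 hb
      exact ⟨_, _, .cond_true hb h, hq⟩
    · obtain ⟨_, _, h, hq⟩ := h2 hb
      exact ⟨_, _, .cond_false hb h, hq⟩

@[simp] theorem holds_eq {x y : ℕ} : (Test.eq x y).Holds s ↔ s.reg x = s.reg y := Iff.rfl

@[simp] theorem holds_lt {x y : ℕ} : (Test.lt x y).Holds s ↔ s.reg x < s.reg y := Iff.rfl

/-- A loop with invariant `I` whose second argument bounds the number of steps still to be done. -/
theorem wp_loop {b : Test} {p : Prog} (I : State → ℕ → Prop)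
    (h : ∀ s n, I s n → b.Holds s → Wp p s fun t s' => ∃ n', I s' n' ∧ t + 1 + n' ≤ n)
    {n : ℕ} (hs : I s n) :
    Wp (.loop b p) s fun t s' => ∃ n', I s' n' ∧ ¬ b.Holds s' ∧ t + n' ≤ n + 1 := by
  induction n using Nat.strong_induction_on generalizing s with
  | _ n ih =>
  by_cases hb : b.Holds s
  · obtain ⟨t, s', hr, n', hI, hn⟩ := h s n hs hb
    obtain ⟨t', s'', hr', n'', hI', hb', hn'⟩ := ih n' (by omega) hI
    exact ⟨_, _, .loop_true hb hr hr', n'', hI', hb', by omega⟩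
  · exact ⟨_, _, .loop_false hb, n, hs, hb, by omega⟩

/-- Instructions in sequence. -/
def block : List Prog → Prog
  | [] => .skip
  | p :: l => .seq p (block l)

@[simp] theorem wp_block_nil : Wp (block []) s Q ↔ Q 1 s := wp_skip

@[simp] theorem wp_block_cons {p : Prog} {l : List Prog} : Wp (block (p :: l)) s Q ↔
    Wp p s fun t s' => Wp (block l) s' fun t' s'' => Q (t + t') s'' := wp_seq

/-! ## Linked lists -/

/-- In memory cells below `fr`, with contents `el` and links `nx`, the linked list that starts in
cell `c` is `l`; the cell `0` stands for the empty list. -/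
inductive IsList (el nx : ℕ → ℕ) (fr : ℕ) : ℕ → List ℕ → Prop
  | nil : IsList el nx fr 0 []
  | cons {c : ℕ} {l : List ℕ} : 0 < c → c < fr → IsList el nx fr (nx c) l →
      IsList el nx fr c (el c :: l)

/-- Lists use only cells below `fr`, and cells are never reused; so all lists can share two arrays
without interfering. -/
theorem IsList.grow {el nx : ℕ → ℕ} {fr c : ℕ} {l : List ℕ} (h : IsList el nx fr c l) (x d : ℕ) :
    IsList (Function.update el fr x) (Function.update nx fr d) (fr + 1) c l := by
  induction h with
  | nil => exact .nil
  | @cons c l h0 hc _ ih =>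
    have h1 : Function.update el fr x c = el c := Function.update_of_ne hc.ne _ _
    have h2 : Function.update nx fr d c = nx c := Function.update_of_ne hc.ne _ _
    rw [← h1]
    exact .cons h0 (by omega) (h2 ▸ ih)

theorem IsList.push {el nx : ℕ → ℕ} {fr c : ℕ} {l : List ℕ} (h : IsList el nx fr c l) (x : ℕ)
    (hfr : 0 < fr) :
    IsList (Function.update el fr x) (Function.update nx fr c) (fr + 1) fr (x :: l) := by
  have := IsList.cons (el := Function.update el fr x) (nx := Function.update nx fr c) (fr := fr + 1)
    (c := fr) (l := l) hfr (by omega) (by simpa using h.grow x c)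
  simpa using this

theorem IsList.eq_nil {el nx : ℕ → ℕ} {fr : ℕ} {l : List ℕ} (h : IsList el nx fr 0 l) : l = [] := by
  cases h with
  | nil => rfl
  | cons h => exact absurd h (lt_irrefl 0)

theorem IsList.eq_cons {el nx : ℕ → ℕ} {fr c : ℕ} {l : List ℕ} (h : IsList el nx fr c l)
    (hc : c ≠ 0) : ∃ l', l = el c :: l' ∧ IsList el nx fr (nx c) l' := by
  cases h with
  | nil => exact absurd rfl hc
  | cons _ _ h => exact ⟨_, rfl, h⟩

/-! ## The memory of the reduction algorithm -/

/-- The sum of the lengths of the first `n` lists. -/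
def totalLength (n : ℕ) (L : ℕ → List ℕ) : ℕ := ∑ u ∈ Finset.range n, (L u).length

theorem totalLength_update {n v : ℕ} (hv : v < n) (L : ℕ → List ℕ) (l : List ℕ) :
    totalLength n (Function.update L v l) + (L v).length = totalLength n L + l.length := by
  unfold totalLength
  have hm := Finset.mem_range.2 hv
  have h : ∑ u ∈ (Finset.range n).erase v, (Function.update L v l u).length =
      ∑ u ∈ (Finset.range n).erase v, (L u).length :=
    Finset.sum_congr rfl fun u hu => by rw [Function.update_of_ne (Finset.ne_of_mem_erase hu)]
  have h1 := Finset.add_sum_erase _ (fun u => (Function.update L v l u).length) hm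
  have h2 := Finset.add_sum_erase _ (fun u => (L u).length) hm
  simp only [Function.update_self] at h1
  omega

/-- Registers `0` to `3` hold the input numbers, register `4` the number `0`, registers `19` and `20`
the numbers `1` and `2`. Arrays `4` and `5` hold the contents and the links of list cells; those from
number `reg 5` on are free. Array `3` holds the starts of the lists `L`, register `6` that of `W`. -/
structure Mem (nV nE O D : ℕ) (s : State) (L : ℕ → List ℕ) (W : List ℕ) : Prop where
  reg0 : s.reg 0 = nV
  reg1 : s.reg 1 = nE
  reg2 : s.reg 2 = O
  reg3 : s.reg 3 = D
  reg4 : s.reg 4 = 0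
  reg19 : s.reg 19 = 1
  reg20 : s.reg 20 = 2
  free : 0 < s.reg 5
  list : ∀ u, IsList (s.arr 4) (s.arr 5) (s.reg 5) (s.arr 3 u) (L u)
  work : IsList (s.arr 4) (s.arr 5) (s.reg 5) (s.reg 6) W
  work_lt : ∀ u ∈ W, u < nV

variable {nV nE O D : ℕ} {L : ℕ → List ℕ} {W : List ℕ}

theorem Mem.congr (h : Mem nV nE O D s L W)
    (hr : ∀ k, k < 7 ∨ k = 19 ∨ k = 20 → s'.reg k = s.reg k) (h3 : s'.arr 3 = s.arr 3)
    (h4 : s'.arr 4 = s.arr 4) (h5 : s'.arr 5 = s.arr 5) : Mem nV nE O D s' L W where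
  reg0 := by rw [hr 0 (by simp), h.reg0]
  reg1 := by rw [hr 1 (by simp), h.reg1]
  reg2 := by rw [hr 2 (by simp), h.reg2]
  reg3 := by rw [hr 3 (by simp), h.reg3]
  reg4 := by rw [hr 4 (by simp), h.reg4]
  reg19 := by rw [hr 19 (by simp), h.reg19]
  reg20 := by rw [hr 20 (by simp), h.reg20]
  free := by rw [hr 5 (by simp)]; exact h.free
  list := by rw [h3, h4, h5, hr 5 (by simp)]; exact h.list
  work := by rw [h4, h5, hr 5 (by simp), hr 6 (by simp)]; exact h.work
  work_lt := h.work_lt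

/-- Put the edge in register `e` on the list of the vertex in register `x`. -/
def pushEdge (x e : ℕ) : Prog :=
  block [.store 4 5 e, .load 17 3 x, .store 5 5 17, .store 3 x 5, .succ 5]

/-- Put the vertex in register `x` on the work list. -/
def pushVertex (x : ℕ) : Prog :=
  block [.store 4 5 x, .store 5 5 6, .move 6 5, .succ 5]

/-- Register `17` is overwritten before the vertex is read for the second time, whence the condition
on `x`; the edge has been stored by then. -/
theorem wp_pushEdge (h : Mem nV nE O D s L W) {x e : ℕ} (hx : x ≠ 17)
    (hQ : ∀ s', Mem nV nE O D s' (Function.update L (s.reg x) (s.reg e :: L (s.reg x))) W →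
      (∀ k, k ≠ 5 → k ≠ 17 → s'.reg k = s.reg k) → (∀ k < 3, s'.arr k = s.arr k) → Q 6 s') :
    Wp (pushEdge x e) s Q := by
  simp only [pushEdge, wp_block_cons, wp_block_nil, wp_store, wp_load, wp_succ, State.reg_setReg,
    State.reg_setArr, State.arr_setArr, hx, if_false]
  refine hQ _ ?_ (fun k h5 h17 => by simp [h5, h17]) fun k hk => ?_
  · have hl := h.list
    refine ⟨by simpa using h.reg0, by simpa using h.reg1, by simpa using h.reg2,
      by simpa using h.reg3, by simpa using h.reg4, by simpa using h.reg19,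
      by simpa using h.reg20, by simp, fun u => ?_, ?_, h.work_lt⟩
    · by_cases hu : u = s.reg x
      · subst hu
        simpa using (hl (s.reg x)).push (s.reg e) h.free
      · simpa [hu] using (hl u).grow (s.reg e) _
    · simpa using h.work.grow (s.reg e) _
  · have : k ≠ 3 ∧ k ≠ 4 ∧ k ≠ 5 := by omega
    simp [this]

theorem wp_pushVertex (h : Mem nV nE O D s L W) {x : ℕ} (hlt : s.reg x < nV)
    (hQ : ∀ s', Mem nV nE O D s' L (s.reg x :: W) →
      (∀ k, k ≠ 5 → k ≠ 6 → s'.reg k = s.reg k) → (∀ k < 4, s'.arr k = s.arr k) → Q 5 s') :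
    Wp (pushVertex x) s Q := by
  simp only [pushVertex, wp_block_cons, wp_block_nil, wp_store, wp_move, wp_succ, State.reg_setReg,
    State.reg_setArr]
  refine hQ _ ?_ (fun k h5 h6 => by simp [h5, h6]) fun k hk => ?_
  · refine ⟨by simpa using h.reg0, by simpa using h.reg1, by simpa using h.reg2,
      by simpa using h.reg3, by simpa using h.reg4, by simpa using h.reg19,
      by simpa using h.reg20, by simp, fun u => ?_, ?_, ?_⟩
    · simpa using (h.list u).grow (s.reg x) _
    · simpa using h.work.push (s.reg x) h.free
    · rintro u hu
      rcases List.mem_cons.1 hu with rfl | hu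
      exacts [hlt, h.work_lt u hu]
  · have : k ≠ 4 ∧ k ≠ 5 := by omega
    simp [this]

end Ram

namespace Ram

open TwoTerminal

variable {S : Prop} {nV nE O D v e m : ℕ} {s s' : State} {X : List ℕ} {G : Graph ℕ ℕ}
  {L : ℕ → List ℕ} {W : List ℕ} {Q : ℕ → State → Prop}

/-! ## Scanning the edges at a vertex -/

/-- The edges at `v` in the registers `9` and `11` lead to distinct vertices, which are in the
registers `10` and `12`; if these hold `v`, there is no such edge. -/
def Held (s : State) (G : Graph ℕ ℕ) (v : ℕ) (X : List ℕ) : Prop :=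
  (X = [] ∧ s.reg 10 = v ∧ s.reg 12 = v) ∨
  (X = [s.reg 9] ∧ s.reg 12 = v ∧ G.IsLink (s.reg 9) v (s.reg 10)) ∨
  (X = [s.reg 9, s.reg 11] ∧ G.IsLink (s.reg 9) v (s.reg 10) ∧ G.IsLink (s.reg 11) v (s.reg 12) ∧
    s.reg 10 ≠ s.reg 12)

/-- The state of affairs while the list of `v` is scanned. The edges in `Y` have been taken from the
list. -/
structure Scanning (S : Prop) (nV nE O D v : ℕ) (W : List ℕ) (m : ℕ) (s : State) (Y X : List ℕ)
    (G : Graph ℕ ℕ) (L : ℕ → List ℕ) : Prop where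
  mem : Mem nV nE O D s L W
  red : Reduced S nV nE O D (s.arr 0) (s.arr 1) (s.arr 2) (s.reg 7) G
    (Function.update L v (X ++ (Y ++ L v))) (fun u => u ∈ W ∨ u = v)
  cur : s.reg 8 = v
  lt : v < nV
  held : Held s G v X
  card : G.vertexSet.ncard = m

/-- Remove the edge in register `15`, which is parallel to the one in register `f`. -/
def mergeInto (f : ℕ) : Prog := block [.store 2 15 20, .store 2 f 19, .succ 7]

/-- Treat the edge in register `15`. -/
def classify : Prog :=
  block [.load 16 0 15, .cond (.eq 16 8) (.load 16 1 15) .skip,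
    .cond (.eq 16 10) (mergeInto 9) <| .cond (.eq 16 12) (mergeInto 11) <|
    .cond (.eq 10 8) (block [.move 9 15, .move 10 16]) <|
    .cond (.eq 12 8) (block [.move 11 15, .move 12 16]) <|
    block [pushEdge 8 15, .const 13 2]]

/-- Treat the next edge on the list of the vertex in register `8`; register `13` is set to `1` if
there is none, and to `2` if three neighbours have been found. -/
def scanStep : Prog :=
  block [.load 14 3 8, .cond (.eq 14 4) (.const 13 1) <|
    block [.load 15 4 14, .load 14 5 14, .store 3 8 14, .load 17 2 15,
      .cond (.eq 17 20) .skip classify]]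

theorem isLink_other (h : G.IsLink e v w) (a b : ℕ) (hab : G.IsLink e a b) (hvw : v ≠ w) :
    w = if a = v then b else a := by
  rcases h.eq_and_eq_or_eq_and_eq hab with ⟨rfl, rfl⟩ | ⟨rfl, rfl⟩
  · simp
  · simp [hvw.symm]

theorem Scanning.drop (h : Scanning S nV nE O D v W m s [e] X G L) (he : e ∉ G.edgeSet) :
    Scanning S nV nE O D v W m s [] X G L where
  __ := h
  red := by
    refine h.red.congr_list (fun u => ?_) (fun u k hk => ?_) (fun u k hk hkG => ?_)
    · have := h.red.nodup u
      by_cases huv : u = v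
      · subst huv
        simp only [Function.update_self] at this ⊢
        exact this.sublist (by simp)
      · simpa [huv] using this
    · by_cases huv : u = v
      · subst huv
        simp only [Function.update_self, List.mem_append] at hk ⊢
        tauto
      · simpa [huv] using hk
    · by_cases huv : u = v
      · subst huv
        have hke : k ≠ e := fun hke => he (hke ▸ hkG)
        simp only [Function.update_self, List.mem_append, List.mem_singleton, hke] at hk ⊢
        tauto
      · simpa [huv] using hk

theorem Scanning.edge_notMem (h : Scanning S nV nE O D v W m s [e] X G L) : e ∉ X := by
  have := h.red.nodup v
  rw [Function.update_self, List.nodup_append] at this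
  exact fun hm => this.2.2 e hm e (by simp) rfl

theorem Scanning.merge {f w : ℕ} (h : Scanning S nV nE O D v W m s [e] X G L) (hf : s.reg f ∈ X)
    (he : G.IsLink e v w) (hl : G.IsLink (s.reg f) v w) (h15 : s.reg 15 = e) :
    Wp (mergeInto f) s fun t s' => t = 4 ∧
      ∃ G', Scanning S nV nE O D v W m s' [] X G' L ∧ s'.reg 13 = s.reg 13 := by
  have hef : e ≠ s.reg f := fun hef => h.edge_notMem (hef ▸ hf)
  have hr := removesEdge_deleteEdges G e
  have hXe : ∀ k ∈ X, ∀ {x y}, G.IsLink k x y → (G.deleteEdges {e}).IsLink k x y :=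
    fun k hk x y hl => (hr.le.isLink_iff (by
      rw [hr.edgeSet_eq]; exact ⟨hl.edge_mem, fun hke => h.edge_notMem (hke ▸ hk)⟩)).2 hl
  simp only [mergeInto, wp_block_cons, wp_block_nil, wp_store, wp_succ, State.reg_setArr]
  refine ⟨trivial, G.deleteEdges {e}, Scanning.drop (e := e) ⟨?_, ?_, ?_, h.lt, ?_, ?_⟩ ?_, ?_⟩
  · refine h.mem.congr (fun k hk => ?_) ?_ ?_ ?_
    · have : k ≠ 7 := by omega
      simp [this]
    all_goals simp
  · simpa [h.mem.reg20, h.mem.reg19, h15] using h.red.merge hef he hl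
  · simpa using h.cur
  · rcases h.held with ⟨h1, h2, h3⟩ | ⟨h1, h2, h3⟩ | ⟨h1, h2, h3, h4⟩
    · exact .inl ⟨h1, by simpa using h2, by simpa using h3⟩
    · exact .inr (.inl ⟨by simpa using h1, by simpa using h2,
        by simpa using hXe _ (by simp [h1]) h3⟩)
    · exact .inr (.inr ⟨by simpa using h1, by simpa using hXe _ (by simp [h1]) h2,
        by simpa using hXe _ (by simp [h1]) h3, by simpa using h4⟩)
  · rw [hr.vertexSet_eq, h.card]
  · rw [hr.edgeSet_eq]; simp
  · simp

/-- The invariant of the scan does not speak about these registers, so they are free for flags and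
scratch values. -/
theorem Scanning.setReg {Y : List ℕ} (h : Scanning S nV nE O D v W m s Y X G L) {k : ℕ} (x : ℕ)
    (h1 : 12 < k) (h2 : k ≠ 19) (h3 : k ≠ 20) :
    Scanning S nV nE O D v W m (s.setReg k x) Y X G L := by
  have hk : ∀ j, j ≤ 12 ∨ j = 19 ∨ j = 20 → (s.setReg k x).reg j = s.reg j := fun j hj => by
    have : j ≠ k := by omega
    simp [this]
  refine ⟨h.mem.congr (fun j hj => hk j (by omega)) rfl rfl rfl, ?_, ?_, h.lt, ?_, h.card⟩
  · rw [hk 7 (by simp)]; exact h.red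
  · rw [hk 8 (by simp)]; exact h.cur
  · unfold Held
    rw [hk 9 (by simp), hk 10 (by simp), hk 11 (by simp), hk 12 (by simp)]
    exact h.held

/-- An edge is merged if it is parallel to a held one, is held if there is room, and otherwise shows
a third neighbour. An empty place contains `v`, which is never the other end of an edge at `v`, so
it is not mistaken for a parallel edge. -/
theorem Scanning.classify (h : Scanning S nV nE O D v W m s [e] X G L) (he : e ∈ G.edgeSet)
    (h15 : s.reg 15 = e) (h13 : s.reg 13 = 0) :
    Wp classify s fun t s' => t ≤ 20 ∧ ∃ X' G' L', Scanning S nV nE O D v W m s' [] X' G' L' ∧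
      ((s'.reg 13 = 0 ∧ totalLength nV L' = totalLength nV L) ∨
       (s'.reg 13 = 2 ∧ HasThreeNeighbors G' v ∧ totalLength nV L' = totalLength nV L + 1)) := by
  have := h.red.net.loopless
  obtain ⟨w, hw⟩ : G.Inc e v := h.red.inc v e (by simp) he
  have hvw := hw.ne
  have hother := isLink_other hw _ _ (h.red.link e he) hvw
  -- the state after the other end of the edge has been determined
  suffices key : ∀ s₁ : State, Scanning S nV nE O D v W m s₁ [e] X G L → s₁.reg 15 = e →
      s₁.reg 13 = 0 → s₁.reg 16 = w →
      Wp (.cond (.eq 16 10) (mergeInto 9) <| .cond (.eq 16 12) (mergeInto 11) <|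
        .cond (.eq 10 8) (block [.move 9 15, .move 10 16]) <|
        .cond (.eq 12 8) (block [.move 11 15, .move 12 16]) <|
        block [pushEdge 8 15, .const 13 2]) s₁ fun t s' => t ≤ 15 ∧
        ∃ X' G' L', Scanning S nV nE O D v W m s' [] X' G' L' ∧
      ((s'.reg 13 = 0 ∧ totalLength nV L' = totalLength nV L) ∨
       (s'.reg 13 = 2 ∧ HasThreeNeighbors G' v ∧ totalLength nV L' = totalLength nV L + 1)) by
    rw [Ram.classify, wp_block_cons, wp_load, wp_block_cons, wp_cond]
    have h16 := h.setReg (k := 16) (s.arr 0 (s.reg 15)) (by simp) (by simp) (by simp)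
    refine ⟨fun hb => ?_, fun hb => ?_⟩
    · rw [wp_load, wp_block_cons]
      refine (key _ (h16.setReg _ (by simp) (by simp) (by simp)) (by simp [h15]) (by simp [h13])
        ?_).mono fun t s' ⟨ht, hs⟩ => by rw [wp_block_nil]; exact ⟨by omega, hs⟩
      simp only [holds_eq, State.reg_setReg, if_true, h15] at hb
      simp only [h.cur, Nat.reduceEqDiff, if_false] at hb
      simp [h15, hother, hb]
    · rw [wp_skip, wp_block_cons]
      refine (key _ h16 (by simp [h15]) (by simp [h13])
        ?_).mono fun t s' ⟨ht, hs⟩ => by rw [wp_block_nil]; exact ⟨by omega, hs⟩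
      simp only [holds_eq, State.reg_setReg, if_true, h15] at hb
      simp only [h.cur, Nat.reduceEqDiff, if_false] at hb
      simp [h15, hother, hb]
  clear h15 h13 h hother
  intro s h h15 h13 h16
  rw [wp_cond, wp_cond, wp_cond, wp_cond]
  simp only [holds_eq, h16, h.cur]
  have h8 := h.cur
  refine ⟨fun h10 => ?_, fun h10 => ⟨fun h12 => ?_, fun h12 => ⟨fun h10v => ?_, fun h10v =>
    ⟨fun h12v => ?_, fun h12v => ?_⟩⟩⟩⟩
  · have : s.reg 9 ∈ X ∧ G.IsLink (s.reg 9) v w := by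
      rcases h.held with ⟨-, h2, -⟩ | ⟨h1, -, h3⟩ | ⟨h1, h2, -, -⟩
      · exact absurd (h2.symm.trans h10.symm) hvw
      · exact ⟨by simp [h1], h10 ▸ h3⟩
      · exact ⟨by simp [h1], h10 ▸ h2⟩
    refine (h.merge this.1 hw this.2 h15).mono fun t s' ⟨ht, G', hs, h13'⟩ => ?_
    exact ⟨by omega, X, G', L, hs, .inl ⟨h13'.trans h13, rfl⟩⟩
  · have : s.reg 11 ∈ X ∧ G.IsLink (s.reg 11) v w := by
      rcases h.held with ⟨-, -, h2⟩ | ⟨-, h2, -⟩ | ⟨h1, -, h3, -⟩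
      · exact absurd (h2.symm.trans h12.symm) hvw
      · exact absurd (h2.symm.trans h12.symm) hvw
      · exact ⟨by simp [h1], h12 ▸ h3⟩
    refine (h.merge this.1 hw this.2 h15).mono fun t s' ⟨ht, G', hs, h13'⟩ => ?_
    exact ⟨by omega, X, G', L, hs, .inl ⟨h13'.trans h13, rfl⟩⟩
  · obtain ⟨h1, -, h3⟩ : X = [] ∧ s.reg 10 = v ∧ s.reg 12 = v := by
      rcases h.held with h1 | ⟨-, -, h3⟩ | ⟨-, h3, -, -⟩
      · exact h1
      · exact absurd h10v.symm h3.ne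
      · exact absurd h10v.symm h3.ne
    subst h1
    simp only [wp_block_cons, wp_block_nil, wp_move]
    refine ⟨by omega, [e], G, L, ⟨?_, ?_, by simpa using h8, h.lt, ?_, h.card⟩,
      .inl ⟨by simpa using h13, rfl⟩⟩
    · refine h.mem.congr (fun k hk => ?_) rfl rfl rfl
      have : k ≠ 9 ∧ k ≠ 10 := by omega
      simp [this]
    · simpa using h.red
    · exact .inr (.inl ⟨by simp [h15], by simpa using h3, by simpa [h15, h16] using hw⟩)
  · obtain ⟨h1, -, h3⟩ : X = [s.reg 9] ∧ s.reg 12 = v ∧ G.IsLink (s.reg 9) v (s.reg 10) := by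
      rcases h.held with ⟨-, h3, -⟩ | h1 | ⟨-, -, h3, -⟩
      · exact absurd h3 h10v
      · exact h1
      · exact absurd h12v.symm h3.ne
    subst h1
    simp only [wp_block_cons, wp_block_nil, wp_move]
    refine ⟨by omega, [s.reg 9, e], G, L, ⟨?_, ?_, by simpa using h8, h.lt, ?_, h.card⟩,
      .inl ⟨by simpa using h13, rfl⟩⟩
    · refine h.mem.congr (fun k hk => ?_) rfl rfl rfl
      have : k ≠ 11 ∧ k ≠ 12 := by omega
      simp [this]
    · simpa using h.red
    · exact .inr (.inr ⟨by simp [h15], by simpa using h3, by simpa [h15, h16] using hw,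
        by simpa [h16] using Ne.symm h10⟩)
  · obtain ⟨h1, h2, h3, h4⟩ : X = [s.reg 9, s.reg 11] ∧ G.IsLink (s.reg 9) v (s.reg 10) ∧
        G.IsLink (s.reg 11) v (s.reg 12) ∧ s.reg 10 ≠ s.reg 12 := by
      rcases h.held with ⟨-, h3, -⟩ | ⟨-, h3, -⟩ | h1
      · exact absurd h3 h10v
      · exact absurd h3 h12v
      · exact h1
    -- Both places are taken, so the edge to the third neighbour returns to the list; this accounts
    -- for the additional list entry.
    rw [wp_block_cons]
    refine wp_pushEdge h.mem (by simp) fun s' hmem hreg harr => ?_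
    rw [h8, h15] at hmem
    rw [wp_block_cons, wp_const, wp_block_nil]
    refine ⟨by omega, X, G, Function.update L v (e :: L v),
      Scanning.setReg ⟨hmem, ?_, ?_, h.lt, ?_, h.card⟩ _ (by simp) (by simp) (by simp), .inr
      ⟨by simp, ⟨s.reg 10, s.reg 12, w, h4, Ne.symm h10, Ne.symm h12, ⟨_, h2⟩, ⟨_, h3⟩, ⟨_, hw⟩⟩, ?_⟩⟩
    · rw [harr 0 (by simp), harr 1 (by simp), harr 2 (by simp), hreg 7 (by simp) (by simp)]
      simpa using h.red
    · rw [hreg 8 (by simp) (by simp), h8]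
    · unfold Held
      rw [hreg 9 (by simp) (by simp), hreg 10 (by simp) (by simp), hreg 11 (by simp) (by simp),
        hreg 12 (by simp) (by simp)]
      exact h.held
    · have := totalLength_update h.lt L (e :: L v)
      simp only [List.length_cons] at this
      omega

/-- The loop that scans the list of the vertex in register `8`. -/
def scan : Prog := .loop (.eq 13 4) scanStep

theorem Scanning.step (h : Scanning S nV nE O D v W m s [] X G L) (h13 : s.reg 13 = 0) :
    Wp scanStep s fun t s' => t ≤ 30 ∧ ∃ X' G' L', Scanning S nV nE O D v W m s' [] X' G' L' ∧
      ((s'.reg 13 = 0 ∧ totalLength nV L' + 1 = totalLength nV L) ∨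
       (s'.reg 13 = 1 ∧ L' v = [] ∧ totalLength nV L' = totalLength nV L) ∨
       (s'.reg 13 = 2 ∧ HasThreeNeighbors G' v ∧ totalLength nV L' = totalLength nV L)) := by
  rw [scanStep, wp_block_cons, wp_load, wp_block_cons, wp_cond]
  have hlist := h.mem.list v
  refine ⟨fun hb => ?_, fun hb => ?_⟩
  · simp only [holds_eq, State.reg_setReg, if_true, h.cur, h.mem.reg4, Nat.reduceEqDiff,
      if_false] at hb
    rw [wp_const, wp_block_nil]
    rw [hb] at hlist
    exact ⟨by omega, X, G, L, (h.setReg _ (by simp) (by simp) (by simp)).setReg _ (by simp)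
      (by simp) (by simp), .inr (.inl ⟨by simp, hlist.eq_nil, rfl⟩)⟩
  · simp only [holds_eq, State.reg_setReg, if_true, h.cur, h.mem.reg4, Nat.reduceEqDiff,
      if_false] at hb
    obtain ⟨l, hl, hlist⟩ := hlist.eq_cons hb
    set e := s.arr 4 (s.arr 3 v) with he
    have hL := totalLength_update h.lt L l
    rw [hl, List.length_cons] at hL
    simp only [wp_block_cons, wp_load, wp_store, State.reg_setReg, State.reg_setArr,
      State.arr_setReg, State.arr_setArr, h.cur, Nat.reduceEqDiff, if_false, if_true, ← he]
    set s₁ := ((s.setReg 14 (s.arr 3 v)).setReg 15 e).setReg 14 (s.arr 5 (s.arr 3 v)) with hs₁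
    have h1 : Scanning S nV nE O D v W m s₁ [] X G L :=
      ((h.setReg _ (by simp) (by simp) (by simp)).setReg _ (by simp) (by simp) (by simp)).setReg _
        (by simp) (by simp) (by simp)
    have h2 : Scanning S nV nE O D v W m (s₁.setArr 3 v (s.arr 5 (s.arr 3 v))) [e] X G
        (Function.update L v l) := by
      have hm := h1.mem
      refine ⟨⟨hm.reg0, hm.reg1, hm.reg2, hm.reg3, hm.reg4, hm.reg19, hm.reg20, hm.free,
        fun u => ?_, by simpa using hm.work, hm.work_lt⟩, ?_, h1.cur, h.lt, h1.held, h.card⟩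
      · by_cases hu : u = v
        · subst hu
          simpa [hs₁] using hlist
        · simpa [hu] using hm.list u
      · simpa [hl] using h1.red
    refine Wp.mono (Q := fun t s' => t ≤ 22 ∧ ∃ X' G' L', Scanning S nV nE O D v W m s' [] X' G' L' ∧
      ((s'.reg 13 = 0 ∧ totalLength nV L' = totalLength nV (Function.update L v l)) ∨
       (s'.reg 13 = 2 ∧ HasThreeNeighbors G' v ∧
        totalLength nV L' = totalLength nV (Function.update L v l) + 1))) ?_ ?_
    · rw [wp_cond]
      have h3 := h2.setReg (k := 17) (s.arr 2 e) (by simp) (by simp) (by simp)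
      refine ⟨fun hb => ?_, fun hb => ?_⟩
      · have he : e ∉ G.edgeSet := fun he => ((h.red.edge e).1 he).2
          (by simpa [hs₁, h.mem.reg20] using hb)
        rw [wp_skip]
        refine ⟨by omega, X, G, _, ?_, .inl ⟨by simpa [hs₁] using h13, rfl⟩⟩
        simpa [hs₁] using h3.drop he
      · have he : e ∈ G.edgeSet := (h.red.edge e).2 ⟨h.red.lt v e (by simp [hl]),
          by simpa [hs₁, h.mem.reg20] using hb⟩
        have h4 := h3.classify he (by simp [hs₁]) (by simpa [hs₁] using h13)
        exact h4.mono fun t s' ⟨ht, h5⟩ => ⟨by omega, h5⟩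
    · rintro t s' ⟨ht, X', G', L', hsc, hor⟩
      simp only [wp_block_nil]
      refine ⟨by omega, X', G', L', hsc, ?_⟩
      rcases hor with ⟨h3, h4⟩ | ⟨h3, h4, h5⟩
      · exact .inl ⟨h3, by omega⟩
      · exact .inr (.inr ⟨h3, h4, by omega⟩)

/-- Every round but the last shortens the list and is paid for by 40 steps. The last round finds the
list empty or a third neighbour; the 50 additional steps are for it, and one more is for the final
test. -/
theorem Scanning.scan (h : Scanning S nV nE O D v W m s [] X G L) (h13 : s.reg 13 = 0) :
    Wp scan s fun t s' => ∃ X' G' L', Scanning S nV nE O D v W m s' [] X' G' L' ∧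
      (s'.reg 13 = 1 ∧ L' v = [] ∨ s'.reg 13 = 2 ∧ HasThreeNeighbors G' v) ∧
      t + 40 * totalLength nV L' ≤ 40 * totalLength nV L + 51 := by
  refine (wp_loop (fun s n => ∃ X G L, Scanning S nV nE O D v W m s [] X G L ∧
    (s.reg 13 = 0 ∧ n = 40 * totalLength nV L + 50 ∨ n = 40 * totalLength nV L ∧
      (s.reg 13 = 1 ∧ L v = [] ∨ s.reg 13 = 2 ∧ HasThreeNeighbors G v))) ?_
    ⟨X, G, L, h, .inl ⟨h13, rfl⟩⟩).mono ?_
  · rintro s n ⟨X, G, L, h, h2⟩ hb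
    rw [holds_eq, h.mem.reg4] at hb
    have hn : n = 40 * totalLength nV L + 50 := by
      rcases h2 with h2 | ⟨-, ⟨h2, -⟩ | ⟨h2, -⟩⟩ <;> omega
    refine (h.step hb).mono fun t s' => ?_
    rintro ⟨ht, X', G', L', hsc, ⟨h3, h4⟩ | ⟨h3, h4, h5⟩ | ⟨h3, h4, h5⟩⟩
    · exact ⟨_, ⟨X', G', L', hsc, .inl ⟨h3, rfl⟩⟩, by omega⟩
    · exact ⟨_, ⟨X', G', L', hsc, .inr ⟨rfl, .inl ⟨h3, h4⟩⟩⟩, by omega⟩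
    · exact ⟨_, ⟨X', G', L', hsc, .inr ⟨rfl, .inr ⟨h3, h4⟩⟩⟩, by omega⟩
  · rintro t s' ⟨n, ⟨X', G', L', hsc, h2⟩, hb, ht⟩
    rw [holds_eq, hsc.mem.reg4] at hb
    rcases h2 with ⟨h2, -⟩ | ⟨h2, h3⟩
    · exact absurd h2 hb
    · exact ⟨X', G', L', hsc, h3, by omega⟩

end Ram

namespace Ram

open TwoTerminal

variable {S : Prop} {nV nE O D v m : ℕ} {s s' : State} {X : List ℕ} {G : Graph ℕ ℕ}
  {L : ℕ → List ℕ} {W : List ℕ} {Q : ℕ → State → Prop}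

/-! ## Visiting a vertex -/

/-- Between two visits; the work still to be done takes at most `n` steps. -/
def Ready (S : Prop) (nV nE O D : ℕ) (s : State) (n : ℕ) : Prop :=
  ∃ G L W, Mem nV nE O D s L W ∧
    Reduced S nV nE O D (s.arr 0) (s.arr 1) (s.arr 2) (s.reg 7) G L (fun u => u ∈ W) ∧
    n = 40 * totalLength nV L + 300 * W.length + 800 * G.vertexSet.ncard

/-- Put the edges in the registers `9` and `11` back on the list of the vertex in register `8`. -/
def putBack : Prog :=
  block [.cond (.eq 10 8) .skip (pushEdge 8 9), .cond (.eq 12 8) .skip (pushEdge 8 11)]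

/-- Exchange the edges in the registers `9` and `11`. -/
def swapHeld : Prog :=
  block [.move 17 9, .move 9 11, .move 11 17, .move 17 10, .move 10 12, .move 12 17]

/-- Contract the edge in register `11`, one of two at the vertex in register `8`. -/
def contractHeld : Prog :=
  block [.store 2 11 20, .store 0 9 10, .store 1 9 12, pushEdge 12 9, pushVertex 10, pushVertex 12]

/-- Contract one of the edges in the registers `9` and `11`, if there is a thin one. -/
def tryContract : Prog :=
  block [.load 17 2 11, .cond (.eq 17 4) .skip swapHeld, .load 17 2 11,
    .cond (.eq 17 4) contractHeld putBack]

/-- Reduce at the first vertex of the work list. -/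
def visit : Prog :=
  block [.load 8 4 6, .load 6 5 6, .move 10 8, .move 12 8, .const 13 0, scan,
    .cond (.eq 13 20) putBack <| .cond (.eq 12 8) putBack <| .cond (.eq 8 2) putBack <|
      .cond (.eq 8 3) putBack tryContract]

/-- At most two held edges return to the list, each at the price of 40; hence the 80. As `v` is
stuck, it is no longer pending. -/
theorem Scanning.putBack (h : Scanning S nV nE O D v W m s [] X G L)
    (hs : v ∈ G.vertexSet → Stuck {e | s.arr 2 e ≠ 0} G O D v) :
    Wp putBack s fun t s' => t ≤ 20 ∧ ∃ n, Ready S nV nE O D s' n ∧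
      n ≤ 40 * totalLength nV L + 300 * W.length + 800 * m + 80 := by
  have hred := h.red.congr_pending (P' := fun u => u ∈ W) fun u hu h1 => by
    rcases h1 with h1 | rfl
    exacts [.inl h1, .inr (hs hu)]
  have := h.red.net.loopless
  -- The held edges may come back in another order, so the new list of `v` is specified up to
  -- permutation only.
  have final : ∀ s' L', Mem nV nE O D s' L' W → (∀ k < 3, s'.arr k = s.arr k) →
      s'.reg 7 = s.reg 7 → (∃ l, l.Perm (X ++ L v) ∧ L' = Function.update L v l) → X.length ≤ 2 →
      ∃ n, Ready S nV nE O D s' n ∧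
        n ≤ 40 * totalLength nV L + 300 * W.length + 800 * m + 80 := by
    rintro s' L' hm ha h7 ⟨l, hl, rfl⟩ hX
    refine ⟨_, ⟨G, _, W, hm, ?_, rfl⟩, ?_⟩
    · rw [ha 0 (by simp), ha 1 (by simp), ha 2 (by simp), h7]
      have hmem : ∀ u k, k ∈ Function.update L v l u ↔
          k ∈ Function.update L v (X ++ ([] ++ L v)) u := fun u k => by
        by_cases hu : u = v
        · subst hu; simp [hl.mem_iff]
        · simp [hu]
      refine hred.congr_list (fun u => ?_) (fun u k hk => (hmem u k).1 hk)
        fun u k hk _ => (hmem u k).2 hk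
      have := hred.nodup u
      by_cases hu : u = v
      · subst hu; simpa [hl.nodup_iff] using this
      · simpa [hu] using this
    · have h1 := totalLength_update h.lt L l
      have h2 := hl.length_eq
      rw [List.length_append] at h2
      rw [h.card]
      omega
  rcases h.held with ⟨h1, h2, h3⟩ | ⟨h1, h2, h3⟩ | ⟨h1, h2, h3, h4⟩
  · subst h1
    simp only [Ram.putBack, wp_block_cons, wp_block_nil, wp_cond, holds_eq, h2, h3, h.cur,
      wp_skip, not_true, false_implies, forall_const, and_true]
    exact ⟨by omega, final s L h.mem (fun _ _ => rfl) rfl ⟨L v, by simp, by simp⟩ (by simp)⟩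
  · have h10 : s.reg 10 ≠ s.reg 8 := fun hh => h3.ne (hh.trans h.cur).symm
    rw [Ram.putBack, wp_block_cons, wp_cond]
    refine ⟨fun hb => absurd hb h10, fun _ => ?_⟩
    refine wp_pushEdge h.mem (by simp) fun s₁ hm hr ha => ?_
    simp only [wp_block_cons, wp_block_nil, wp_cond, holds_eq, hr 12 (by simp) (by simp),
      hr 8 (by simp) (by simp), h2, h.cur, wp_skip, not_true, false_implies, forall_const, and_true]
    refine ⟨by omega, final s₁ _ hm ha (hr 7 (by simp) (by simp)) ⟨_, ?_, by rw [h.cur]⟩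
      (by simp [h1])⟩
    simp [h1]
  · have h10 : s.reg 10 ≠ s.reg 8 := fun hh => h2.ne (hh.trans h.cur).symm
    have h12 : s.reg 12 ≠ s.reg 8 := fun hh => h3.ne (hh.trans h.cur).symm
    rw [Ram.putBack, wp_block_cons, wp_cond]
    refine ⟨fun hb => absurd hb h10, fun _ => ?_⟩
    refine wp_pushEdge h.mem (by simp) fun s₁ hm hr ha => ?_
    rw [wp_block_cons, wp_cond, holds_eq, hr 12 (by simp) (by simp), hr 8 (by simp) (by simp)]
    refine ⟨fun hb => absurd hb h12, fun _ => ?_⟩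
    refine wp_pushEdge hm (by simp) fun s₂ hm₂ hr₂ ha₂ => ?_
    rw [wp_block_nil]
    refine ⟨by omega, final s₂ _ hm₂ (fun k hk => (ha₂ k hk).trans (ha k hk))
      ((hr₂ 7 (by simp) (by simp)).trans (hr 7 (by simp) (by simp))) ⟨s.reg 11 :: s.reg 9 :: L v, ?_, ?_⟩
      (by simp [h1])⟩
    · rw [h1]; exact .swap _ _ _
    · rw [hr 8 (by simp) (by simp), hr 11 (by simp) (by simp), h.cur]; simp

theorem Scanning.swapHeld (h : Scanning S nV nE O D v W m s [] [s.reg 9, s.reg 11] G L)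
    (h9 : G.IsLink (s.reg 9) v (s.reg 10)) (h11 : G.IsLink (s.reg 11) v (s.reg 12))
    (hne : s.reg 10 ≠ s.reg 12) :
    Wp swapHeld s fun t s' => t = 7 ∧ Scanning S nV nE O D v W m s' [] [s'.reg 9, s'.reg 11] G L ∧
      G.IsLink (s'.reg 9) v (s'.reg 10) ∧ G.IsLink (s'.reg 11) v (s'.reg 12) ∧
      s'.reg 10 ≠ s'.reg 12 ∧ s'.arr = s.arr ∧ s'.reg 9 = s.reg 11 ∧ s'.reg 11 = s.reg 9 := by
  simp only [Ram.swapHeld, wp_block_cons, wp_block_nil, wp_move]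
  refine ⟨trivial, ⟨?_, ?_, by simpa using h.cur, h.lt, ?_, h.card⟩, by simpa using h11,
    by simpa using h9, by simpa using hne.symm, rfl, by simp, by simp⟩
  · refine h.mem.congr (fun k hk => ?_) rfl rfl rfl
    have : k ≠ 9 ∧ k ≠ 10 ∧ k ≠ 11 ∧ k ≠ 12 ∧ k ≠ 17 := by omega
    simp [this]
  · have := h.red.congr_list (L' := Function.update L v ([s.reg 11, s.reg 9] ++ ([] ++ L v)))
      (fun u => ?_) (fun u k hk => ?_) fun u k hk _ => ?_
    · simpa using this
    · have := h.red.nodup u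
      by_cases hu : u = v
      · subst hu
        simp only [Function.update_self] at this ⊢
        exact (List.Perm.swap _ _ _).nodup_iff.1 this
      · simpa [hu] using this
    · by_cases hu : u = v
      · subst hu; simp at hk ⊢; tauto
      · simpa [hu] using hk
    · by_cases hu : u = v
      · subst hu; simp at hk ⊢; tauto
      · simpa [hu] using hk
  · exact .inr (.inr ⟨rfl, by simpa using h11, by simpa using h9, by simpa using hne.symm⟩)

/-- The lost vertex releases 800: 600 for returning two vertices to the work list, 40 for the new
list entry of `e`, and a surplus of 160. -/
theorem Scanning.contractHeld (h : Scanning S nV nE O D v W m s [] [s.reg 9, s.reg 11] G L)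
    (h9 : G.IsLink (s.reg 9) v (s.reg 10)) (h11 : G.IsLink (s.reg 11) v (s.reg 12))
    (hne : s.reg 10 ≠ s.reg 12) (hO : v ≠ O) (hD : v ≠ D) (hL : L v = [])
    (hst : s.arr 2 (s.reg 11) = 0) :
    Wp contractHeld s fun t s' => t ≤ 20 ∧ ∃ n, Ready S nV nE O D s' n ∧
      n + 160 ≤ 40 * totalLength nV L + 300 * W.length + 800 * m := by
  have := h.red.net.loopless
  have hef : s.reg 9 ≠ s.reg 11 := by
    have := h.red.nodup v
    rw [Function.update_self, List.cons_append, List.nodup_cons] at this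
    exact fun hh => this.1 (by simp [hh])
  obtain ⟨H, hH, hred⟩ := h.red.contracted (P' := fun u => u ∈ s.reg 12 :: s.reg 10 :: W) hef hne h9
    h11 (fun k hk => by simpa [hL] using h.red.cov v k hk) hO hD hst (by simp) (by simp)
    fun u hu hP => by simp [hP.resolve_right hu]
  -- The two edges at `v` are held in registers and its list in memory is already empty, so nothing
  -- needs to be erased there.
  have hlist : Function.update (Function.update (Function.update L v
      ([s.reg 9, s.reg 11] ++ ([] ++ L v))) v []) (s.reg 12)
      (s.reg 9 :: Function.update L v ([s.reg 9, s.reg 11] ++ ([] ++ L v)) (s.reg 12)) =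
      Function.update L (s.reg 12) (s.reg 9 :: L (s.reg 12)) := by
    rw [Function.update_idem, Function.update_of_ne h11.ne.symm, ← hL, Function.update_eq_self]
  rw [hlist] at hred
  have hx := h.red.vert _ h9.right_mem
  have hy := h.red.vert _ h11.right_mem
  simp only [Ram.contractHeld, wp_block_cons, wp_store, State.reg_setArr]
  have hm : Mem nV nE O D (((s.setArr 2 (s.reg 11) (s.reg 20)).setArr 0 (s.reg 9)
      (s.reg 10)).setArr 1 (s.reg 9) (s.reg 12)) L W :=
    h.mem.congr (fun _ _ => rfl) (by simp) (by simp) (by simp)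
  refine wp_pushEdge hm (by simp) fun s₁ hm₁ hr₁ ha₁ => ?_
  have h10₁ : s₁.reg 10 = s.reg 10 := hr₁ 10 (by simp) (by simp)
  have h12₁ : s₁.reg 12 = s.reg 12 := hr₁ 12 (by simp) (by simp)
  refine wp_pushVertex hm₁ (h10₁ ▸ hx) fun s₂ hm₂ hr₂ ha₂ => ?_
  have h12₂ : s₂.reg 12 = s.reg 12 := (hr₂ 12 (by simp) (by simp)).trans h12₁
  refine wp_pushVertex hm₂ (h12₂ ▸ hy) fun s₃ hm₃ hr₃ ha₃ => ?_
  rw [h12₂, h10₁] at hm₃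
  have ha : ∀ k < 3, s₃.arr k = (((s.setArr 2 (s.reg 11) (s.reg 20)).setArr 0 (s.reg 9)
      (s.reg 10)).setArr 1 (s.reg 9) (s.reg 12)).arr k := fun k hk =>
    (ha₃ k (by omega)).trans ((ha₂ k (by omega)).trans (ha₁ k hk))
  have h7 : s₃.reg 7 = s.reg 7 := (hr₃ 7 (by simp) (by simp)).trans
    ((hr₂ 7 (by simp) (by simp)).trans (hr₁ 7 (by simp) (by simp)))
  rw [wp_block_nil]
  refine ⟨by omega, _, ⟨H, _, _, hm₃, ?_, rfl⟩, ?_⟩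
  · rw [ha 0 (by simp), ha 1 (by simp), ha 2 (by simp), h7]
    simpa [h.mem.reg20] using hred
  · have h1 := totalLength_update hy L (s.reg 9 :: L (s.reg 12))
    have h2 := h.card
    simp only [List.length_cons, State.reg_setArr] at h1 ⊢
    omega

/-- After the possible exchange, register `11` holds a thin edge if there is one. Otherwise both
edges at `v` are thick and `v` is stuck. -/
theorem Scanning.tryContract (h : Scanning S nV nE O D v W m s [] [s.reg 9, s.reg 11] G L)
    (h9 : G.IsLink (s.reg 9) v (s.reg 10)) (h11 : G.IsLink (s.reg 11) v (s.reg 12))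
    (hne : s.reg 10 ≠ s.reg 12) (hO : v ≠ O) (hD : v ≠ D) (hL : L v = []) :
    Wp tryContract s fun t s' => t ≤ 40 ∧ ∃ n, Ready S nV nE O D s' n ∧
      n ≤ 40 * totalLength nV L + 300 * W.length + 800 * m + 80 := by
  have key : ∀ s : State, Scanning S nV nE O D v W m s [] [s.reg 9, s.reg 11] G L →
      G.IsLink (s.reg 9) v (s.reg 10) → G.IsLink (s.reg 11) v (s.reg 12) →
      s.reg 10 ≠ s.reg 12 → (s.arr 2 (s.reg 11) ≠ 0 → s.arr 2 (s.reg 9) ≠ 0) →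
      Wp (block [.load 17 2 11, .cond (.eq 17 4) Ram.contractHeld Ram.putBack]) s fun t s' => t ≤ 25 ∧
        ∃ n, Ready S nV nE O D s' n ∧
          n ≤ 40 * totalLength nV L + 300 * W.length + 800 * m + 80 := by
    intro s h h9 h11 hne hst
    have h' := h.setReg (k := 17) (s.arr 2 (s.reg 11)) (by simp) (by simp) (by simp)
    rw [wp_block_cons, wp_load, wp_block_cons, wp_cond]
    simp only [wp_block_nil]
    refine ⟨fun hb => ?_, fun hb => ?_⟩
    · refine (Scanning.contractHeld (by simpa using h') (by simpa using h9) (by simpa using h11)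
        (by simpa using hne) hO hD hL (by simpa [h.mem.reg4] using hb)).mono ?_
      rintro t s' ⟨ht, n, hn, hle⟩
      exact ⟨by omega, n, hn, by omega⟩
    · refine (h'.putBack fun _ => .inr ⟨?_, ?_⟩).mono ?_
      · have hat : ∀ e w, G.IsLink e v w → e = s.reg 9 ∨ e = s.reg 11 := fun e w he => by
          simpa [hL] using h.red.cov v e ⟨w, he⟩
        intro e f w he hf
        have h1 : ∀ w, ¬ (G.IsLink (s.reg 9) v w ∧ G.IsLink (s.reg 11) v w) := fun w ⟨h1, h2⟩ =>
          hne ((h9.right_unique h1).trans (h2.right_unique h11))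
        rcases hat e w he with rfl | rfl <;> rcases hat f w hf with rfl | rfl
        · rfl
        · exact absurd ⟨he, hf⟩ (h1 w)
        · exact absurd ⟨hf, he⟩ (h1 w)
        · rfl
      · intro _ _ e f he hf hef
        have hb' : s.arr 2 (s.reg 11) ≠ 0 := by simpa [h.mem.reg4] using hb
        have he' : e = s.reg 9 ∨ e = s.reg 11 := by simpa [hL] using h.red.cov v e he
        rcases he' with rfl | rfl
        exacts [hst hb', hb']
      · rintro t s' ⟨ht, n, hn, hle⟩
        exact ⟨by omega, n, hn, by omega⟩
  have h' := h.setReg (k := 17) (s.arr 2 (s.reg 11)) (by simp) (by simp) (by simp)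
  rw [Ram.tryContract, wp_block_cons, wp_load, wp_block_cons, wp_cond]
  refine ⟨fun hb => ?_, fun hb => ?_⟩
  · rw [wp_skip]
    refine (key _ (by simpa using h') (by simpa using h9) (by simpa using h11) (by simpa using hne)
      fun hn => absurd (by simpa [h.mem.reg4] using hb) hn).mono ?_
    rintro t s' ⟨ht, hs⟩
    exact ⟨by omega, hs⟩
  · refine (Scanning.swapHeld (by simpa using h') (by simpa using h9) (by simpa using h11)
      (by simpa using hne)).mono ?_
    rintro t s₁ ⟨rfl, h₁, h9₁, h11₁, hne₁, harr, hr9, hr11⟩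
    refine (key s₁ h₁ h9₁ h11₁ hne₁ fun _ => ?_).mono ?_
    · rw [harr, hr9]
      simpa [h.mem.reg4] using hb
    · rintro t s' ⟨ht, hs⟩
      exact ⟨by omega, hs⟩

/-- The entry taken from the work list frees 300, which covers the fixed cost of the scan (51), the
treatment afterwards (45), the edges put back (80) and the remaining instructions. -/
theorem Ready.visit {n : ℕ} (h : Ready S nV nE O D s n) (h6 : s.reg 6 ≠ 0) :
    Wp visit s fun t s' => ∃ n', Ready S nV nE O D s' n' ∧ t + 1 + n' ≤ n := by
  obtain ⟨G, L, W, hm, hred, rfl⟩ := h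
  obtain ⟨W, rfl, hW⟩ := hm.work.eq_cons h6
  set v := s.arr 4 (s.reg 6) with hv
  have hlt : v < nV := hm.work_lt v (by simp)
  simp only [Ram.visit, wp_block_cons, wp_load, wp_move, wp_const, State.reg_setReg,
    State.arr_setReg, ← hv, if_true, Nat.reduceEqDiff, if_false]
  have hsc : Scanning S nV nE O D v W G.vertexSet.ncard (((((s.setReg 8 v).setReg 6
      (s.arr 5 (s.reg 6))).setReg 10 v).setReg 12 v).setReg 13 0) [] [] G L := by
    refine ⟨?_, ?_, by simp, hlt, .inl (by simp), rfl⟩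
    · refine ⟨by simpa using hm.reg0, by simpa using hm.reg1, by simpa using hm.reg2,
        by simpa using hm.reg3, by simpa using hm.reg4, by simpa using hm.reg19,
        by simpa using hm.reg20, by simpa using hm.free, by simpa using hm.list,
        by simpa using hW, fun u hu => hm.work_lt u (by simp [hu])⟩
    · have := hred.congr_pending (P' := fun u => u ∈ W ∨ u = v) fun u _ hu => .inl (by
        rcases List.mem_cons.1 hu with hu | hu
        exacts [.inr hu, .inl hu])
      simpa using this
  refine (hsc.scan (by simp)).mono ?_
  clear hsc
  rintro t s ⟨X, G', L', h, hend, ht⟩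
  have := h.red.net.loopless
  refine Wp.mono (Q := fun t s' => t ≤ 45 ∧ ∃ n, Ready S nV nE O D s' n ∧
      n ≤ 40 * totalLength nV L' + 300 * W.length + 800 * G.vertexSet.ncard + 80) ?_ ?_
  -- Here `k` counts the tests that precede `putBack`.
  · have fin : (v ∈ G'.vertexSet → Stuck {e | s.arr 2 e ≠ 0} G' O D v) → ∀ k ≤ 5,
        Wp putBack s fun t s' => t + k ≤ 45 ∧ ∃ n, Ready S nV nE O D s' n ∧
          n ≤ 40 * totalLength nV L' + 300 * W.length + 800 * G.vertexSet.ncard + 80 :=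
      fun hs k hk => (h.putBack hs).mono fun t s' ⟨ht, hs⟩ => ⟨by omega, hs⟩
    rcases hend with ⟨h13, hL⟩ | ⟨h13, h3⟩
    swap
    · rw [wp_cond]
      exact ⟨fun _ => fin (fun _ => .inl h3) 1 (by simp),
        fun hb => absurd (h13.trans h.mem.reg20.symm) hb⟩
    -- The list has been exhausted, so the held edges are all the edges at `v`.
    have hat : ∀ e w, G'.IsLink e v w → e ∈ X := fun e w he => by
      simpa [hL] using h.red.cov v e ⟨w, he⟩
    simp only [wp_cond, holds_eq, h13, h.mem.reg20, h.mem.reg2, h.mem.reg3, h.cur]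
    refine ⟨fun hb => absurd hb (by simp), fun _ => ⟨fun h12 => ?_, fun h12 => ?_⟩⟩
    · refine fin (fun _ => .inr ?_) 2 (by simp)
      have hX : ∀ e ∈ X, ∀ f ∈ X, e = f := by
        rcases h.held with ⟨rfl, -⟩ | ⟨rfl, -⟩ | ⟨-, -, h4, -⟩
        · simp
        · simp
        · exact absurd h12.symm h4.ne
      exact ⟨fun e f w he hf => hX e (hat e w he) f (hat f w hf),
        fun _ _ e f ⟨w, he⟩ ⟨w', hf⟩ hef => absurd (hX e (hat e w he) f (hat f w' hf)) hef⟩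
    obtain ⟨rfl, h9, h11, hne⟩ : X = [s.reg 9, s.reg 11] ∧ G'.IsLink (s.reg 9) v (s.reg 10) ∧
        G'.IsLink (s.reg 11) v (s.reg 12) ∧ s.reg 10 ≠ s.reg 12 := by
      rcases h.held with ⟨-, -, h3⟩ | ⟨-, h3, -⟩ | h1
      exacts [absurd h3 h12, absurd h3 h12, h1]
    have hpar : ∀ e f w, G'.IsLink e v w → G'.IsLink f v w → e = f := by
      have h1 : ∀ w, ¬ (G'.IsLink (s.reg 9) v w ∧ G'.IsLink (s.reg 11) v w) := fun w ⟨h1, h2⟩ =>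
        hne ((h9.right_unique h1).trans (h2.right_unique h11))
      intro e f w he hf
      have h2 := hat e w he
      have h3 := hat f w hf
      simp only [List.mem_cons, List.not_mem_nil, or_false] at h2 h3
      rcases h2 with rfl | rfl <;> rcases h3 with rfl | rfl
      · rfl
      · exact absurd ⟨he, hf⟩ (h1 w)
      · exact absurd ⟨hf, he⟩ (h1 w)
      · rfl
    refine ⟨fun hO => fin (fun _ => .inr ⟨hpar, fun h _ => absurd hO h⟩) 3 (by simp), fun hO =>
      ⟨fun hD => fin (fun _ => .inr ⟨hpar, fun _ h => absurd hD h⟩) 4 (by simp), fun hD => ?_⟩⟩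
    exact (h.tryContract h9 h11 hne hO hD hL).mono fun t s' ⟨ht, hs⟩ => ⟨by omega, hs⟩
  · rintro t' s' ⟨ht', n, hn, hle⟩
    rw [wp_block_nil]
    exact ⟨n, hn, by simp only [List.length_cons]; omega⟩

end Ram

namespace Ram

open TwoTerminal

variable {S : Prop} {nV nE O D : ℕ} {s : State} {G : Graph ℕ ℕ} {L : ℕ → List ℕ} {W : List ℕ}

/-! ## The whole algorithm -/

theorem Ready.loop {n : ℕ} (h : Ready S nV nE O D s n) :
    Wp (.loop (.lt 4 6) Ram.visit) s fun t s' => t ≤ n + 1 ∧ s'.reg 1 = nE ∧ (S ↔ s'.reg 7 = nE + 1) := by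
  refine (wp_loop (Ready S nV nE O D) (fun s n hs hb => ?_) h).mono ?_
  · exact hs.visit (by rw [holds_lt] at hb; omega)
  · rintro t s' ⟨n', ⟨G, L, W, hm, hred, rfl⟩, hb, hle⟩
    rw [holds_lt, hm.reg4] at hb
    have hw := hm.work
    rw [show s'.reg 6 = 0 by omega] at hw
    have hW := hw.eq_nil
    subst hW
    exact ⟨by omega, hm.reg1, (hred.congr_pending fun u _ hu => by simp at hu).decide⟩

/-- Put every edge on the lists of its two ends. -/
def listEdges : Prog :=
  .loop (.lt 18 1) <| block
    [.load 8 0 18, pushEdge 8 18, .load 8 1 18, pushEdge 8 18, .succ 18]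

/-- Put every vertex on the work list. -/
def listVertices : Prog :=
  .loop (.lt 18 0) <| block [pushVertex 18, .succ 18]

/-- As the two ends of an edge differ, each edge is put on two different lists; so the lists have no
repetitions and total length `2 * nE`. -/
theorem Mem.listEdges (h : Mem nV nE O D s (fun _ => []) []) (h18 : s.reg 18 = 0)
    (hlt : ∀ i < nE, s.arr 0 i < nV ∧ s.arr 1 i < nV ∧ s.arr 0 i ≠ s.arr 1 i) :
    Wp listEdges s fun t s' => t ≤ 20 * nE + 1 ∧ (∀ k < 3, s'.arr k = s.arr k) ∧
      s'.reg 7 = s.reg 7 ∧ ∃ L, Mem nV nE O D s' L [] ∧ (∀ u, (L u).Nodup) ∧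
      (∀ u e, e ∈ L u ↔ e < nE ∧ (s.arr 0 e = u ∨ s.arr 1 e = u)) ∧ totalLength nV L = 2 * nE := by
  refine (wp_loop (fun s' n => s'.reg 18 ≤ nE ∧ n = 20 * (nE - s'.reg 18) ∧
    (∀ k < 3, s'.arr k = s.arr k) ∧ s'.reg 7 = s.reg 7 ∧
    ∃ L, Mem nV nE O D s' L [] ∧ (∀ u, (L u).Nodup) ∧
      (∀ u e, e ∈ L u ↔ e < s'.reg 18 ∧ (s.arr 0 e = u ∨ s.arr 1 e = u)) ∧
      totalLength nV L = 2 * s'.reg 18) ?_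
    (n := 20 * nE) ⟨by omega, by omega, fun _ _ => rfl, rfl, _, h, by simp, by simp [h18],
      by simp [h18, totalLength]⟩).mono ?_
  · rintro s₁ n ⟨hle, rfl, harr, h7, L, hm, hnd, hmem, htl⟩ hb
    rw [holds_lt, hm.reg1] at hb
    obtain ⟨hx, hy, hxy⟩ := hlt _ hb
    set i := s₁.reg 18 with hi
    set x := s.arr 0 i
    set y := s.arr 1 i
    rw [wp_block_cons, wp_load, wp_block_cons]
    have hm₁ : Mem nV nE O D (s₁.setReg 8 (s₁.arr 0 (s₁.reg 18))) L [] := by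
      refine hm.congr (fun k hk => ?_) rfl rfl rfl
      have : k ≠ 8 := by omega
      simp [this]
    refine wp_pushEdge hm₁ (by simp) fun s₂ hm₂ hr₂ ha₂ => ?_
    simp only [State.reg_setReg, if_true, Nat.reduceEqDiff, if_false, harr 0 (by simp), ← hi] at hm₂
    rw [wp_block_cons, wp_load, wp_block_cons]
    have h18₂ : s₂.reg 18 = i := by rw [hr₂ 18 (by simp) (by simp)]; simp [hi]
    have harr₂ : s₂.arr 1 = s.arr 1 := (ha₂ 1 (by simp)).trans (harr 1 (by simp))
    have hm₃ : Mem nV nE O D (s₂.setReg 8 (s₂.arr 1 (s₂.reg 18)))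
        (Function.update L x (i :: L x)) [] := by
      refine hm₂.congr (fun k hk => ?_) rfl rfl rfl
      have : k ≠ 8 := by omega
      simp [this]
    refine wp_pushEdge hm₃ (by simp) fun s₃ hm₄ hr₄ ha₄ => ?_
    simp only [State.reg_setReg, if_true, Nat.reduceEqDiff, if_false, h18₂, harr₂] at hm₄
    rw [Function.update_of_ne hxy.symm] at hm₄
    replace hm₄ : Mem nV nE O D s₃
      (Function.update (Function.update L x (i :: L x)) y (i :: L y)) [] := hm₄
    have h18₃ : s₃.reg 18 = i := by rw [hr₄ 18 (by simp) (by simp)]; simp [h18₂]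
    rw [wp_block_cons, wp_succ, wp_block_nil]
    have hiL : ∀ u, i ∉ L u := fun u hu => absurd ((hmem u i).1 hu).1 (lt_irrefl i)
    simp only [State.reg_setReg, if_true, Nat.reduceEqDiff, if_false, h18₃, State.arr_setReg]
    refine ⟨_, ⟨by omega, rfl, fun k hk => ?_, ?_, _, hm₄.congr (fun k hk => ?_) rfl rfl rfl,
      fun u => ?_, fun u e => ?_, ?_⟩, by omega⟩
    · exact (ha₄ k hk).trans ((ha₂ k hk).trans (harr k hk))
    · rw [hr₄ 7 (by simp) (by simp), State.reg_setReg, if_neg (by simp), hr₂ 7 (by simp) (by simp),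
        State.reg_setReg, if_neg (by simp), h7]
    · have : k ≠ 18 := by omega
      simp [this]
    · by_cases huy : u = y
      · subst huy; simpa using ⟨hiL _, hnd _⟩
      by_cases hux : u = x
      · subst hux; simpa [huy] using ⟨hiL _, hnd _⟩
      simpa [huy, hux] using hnd u
    · have hlast : ∀ u, (e < i + 1 ∧ (s.arr 0 e = u ∨ s.arr 1 e = u)) ↔
          (e = i ∧ (x = u ∨ y = u)) ∨ e ∈ L u := fun u => by
        rw [hmem, Nat.lt_succ_iff_lt_or_eq]
        constructor
        · rintro ⟨h1 | rfl, h2⟩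
          exacts [.inr ⟨h1, h2⟩, .inl ⟨rfl, h2⟩]
        · rintro (⟨rfl, h2⟩ | ⟨h1, h2⟩)
          exacts [⟨.inr rfl, h2⟩, ⟨.inl h1, h2⟩]
      rw [hlast]
      by_cases huy : u = y
      · subst huy; simp
      by_cases hux : u = x
      · subst hux; simp [huy]
      simp [huy, hux, Ne.symm huy, Ne.symm hux]
    · have h1 := totalLength_update hx L (i :: L x)
      have h2 := totalLength_update hy (Function.update L x (i :: L x)) (i :: L y)
      rw [Function.update_of_ne hxy.symm] at h2
      simp only [List.length_cons] at h1 h2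
      omega
  · rintro t s' ⟨n, ⟨hle, rfl, harr, h7, L, hm, hnd, hmem, htl⟩, hb, ht⟩
    rw [holds_lt, hm.reg1] at hb
    have hi : s'.reg 18 = nE := by omega
    rw [hi] at hmem htl
    exact ⟨by omega, harr, h7, L, hm, hnd, hmem, htl⟩

theorem Mem.listVertices (h : Mem nV nE O D s L []) (h18 : s.reg 18 = 0) :
    Wp listVertices s fun t s' => t ≤ 20 * nV + 1 ∧ (∀ k < 3, s'.arr k = s.arr k) ∧
      s'.reg 7 = s.reg 7 ∧ ∃ W, Mem nV nE O D s' L W ∧ (∀ u < nV, u ∈ W) ∧ W.length = nV := by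
  refine (wp_loop (fun s' n => s'.reg 18 ≤ nV ∧ n = 20 * (nV - s'.reg 18) ∧
    (∀ k < 3, s'.arr k = s.arr k) ∧ s'.reg 7 = s.reg 7 ∧
    ∃ W, Mem nV nE O D s' L W ∧ (∀ u < s'.reg 18, u ∈ W) ∧ W.length = s'.reg 18) ?_
    (n := 20 * nV) ⟨by omega, by omega, fun _ _ => rfl, rfl, _, h, by simp [h18],
      by simp [h18]⟩).mono ?_
  · rintro s₁ n ⟨hle, rfl, harr, h7, W, hm, hmem, hlen⟩ hb
    rw [holds_lt, hm.reg0] at hb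
    rw [wp_block_cons]
    refine wp_pushVertex hm hb fun s₂ hm₂ hr₂ ha₂ => ?_
    rw [wp_block_cons, wp_succ, wp_block_nil]
    simp only [State.reg_setReg, if_true, Nat.reduceEqDiff, if_false, hr₂ 18 (by simp) (by simp),
      State.arr_setReg]
    refine ⟨_, ⟨by omega, rfl, fun k hk => (ha₂ k (by omega)).trans (harr k hk), ?_, _,
      hm₂.congr (fun k hk => ?_) rfl rfl rfl, fun u hu => ?_, by simp [hlen]⟩, by omega⟩
    · rw [hr₂ 7 (by simp) (by simp), h7]
    · have : k ≠ 18 := by omega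
      simp [this]
    · rcases Nat.lt_succ_iff_lt_or_eq.1 hu with hu | rfl
      · simp [hmem u hu]
      · simp
  · rintro t s' ⟨n, ⟨hle, rfl, harr, h7, W, hm, hmem, hlen⟩, hb, ht⟩
    rw [holds_lt, hm.reg0] at hb
    have hi : s'.reg 18 = nV := by omega
    rw [hi] at hmem hlen
    exact ⟨by omega, harr, h7, W, hm, hmem, hlen⟩

/-- Decide whether a network is a series of linearly independent ones. -/
def decideSLI : Prog :=
  block [.const 5 1, .const 19 1, .const 20 2, .move 7 0, listEdges, .const 18 0, listVertices,
    .loop (.lt 4 6) visit, .succ 1, .cond (.eq 7 1) (.const 0 1) (.const 0 0)]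

/-- The initial potential is `80 * numE + 1100 * numV`, as each edge is listed twice and each vertex
is on the work list. Building the lists costs 20 more per edge and per vertex. -/
theorem wp_decideSLI (I : EdgeList)
    (hlt : ∀ i < I.numE, I.fst i < I.numV ∧ I.snd i < I.numV ∧ I.fst i ≠ I.snd i)
    (hV : G.vertexSet.ncard = I.numV)
    (hG : ∀ L : ℕ → List ℕ, (∀ u, (L u).Nodup) →
      (∀ u e, e ∈ L u ↔ e < I.numE ∧ (I.fst e = u ∨ I.snd e = u)) →
      Reduced S I.numV I.numE I.origin I.dest (I.initState.arr 0) (I.initState.arr 1)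
        (I.initState.arr 2) I.numV G L (fun u => u < I.numV)) :
    Wp decideSLI I.initState fun t s => t ≤ 100 * I.numE + 1120 * I.numV + 20 ∧
      (S → s.reg 0 = 1) ∧ (¬ S → s.reg 0 = 0) := by
  simp only [decideSLI, wp_block_cons, wp_const, wp_move, State.reg_setReg,
    if_false, OfNat.zero_ne_ofNat]
  have harr : ∀ i < I.numE, I.initState.arr 0 i = I.fst i ∧ I.initState.arr 1 i = I.snd i :=
    fun i hi => by simp [EdgeList.initState, hi]
  set s₁ := (((I.initState.setReg 5 1).setReg 19 1).setReg 20 2).setReg 7 (I.initState.reg 0)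
    with hs₁
  have hm₁ : Mem I.numV I.numE I.origin I.dest s₁ (fun _ => []) [] := by
    refine ⟨by simp [hs₁, EdgeList.initState], by simp [hs₁, EdgeList.initState],
      by simp [hs₁, EdgeList.initState], by simp [hs₁, EdgeList.initState],
      by simp [hs₁, EdgeList.initState], by simp [hs₁, EdgeList.initState],
      by simp [hs₁, EdgeList.initState], by simp [hs₁, EdgeList.initState], fun u => ?_, ?_,
      by simp⟩
    · have : s₁.arr 3 u = 0 := by simp [hs₁, EdgeList.initState]
      rw [this]
      exact .nil
    · have : s₁.reg 6 = 0 := by simp [hs₁, EdgeList.initState]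
      rw [this]
      exact .nil
  refine (hm₁.listEdges (by simp [hs₁, EdgeList.initState]) fun i hi => ?_).mono ?_
  · have := harr i hi
    simp only [hs₁, State.arr_setReg, this]
    exact hlt i hi
  rintro t₂ s₂ ⟨ht₂, ha₂, h7₂, L, hm₂, hnd, hmem, htl⟩
  have hred := hG L hnd fun u e => by
    rw [hmem]
    refine and_congr_right fun he => ?_
    simp [hs₁, harr e he]
  have hm₃ : Mem I.numV I.numE I.origin I.dest (s₂.setReg 18 0) L [] := by
    refine hm₂.congr (fun k hk => ?_) rfl rfl rfl
    have : k ≠ 18 := by omega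
    simp [this]
  refine (hm₃.listVertices (by simp)).mono ?_
  rintro t₃ s₃ ⟨ht₃, ha₃, h7₃, W, hm₄, hW, hlen⟩
  obtain ⟨n, hn, hready⟩ : ∃ n ≤ 80 * I.numE + 1100 * I.numV,
      Ready S I.numV I.numE I.origin I.dest s₃ n := by
    refine ⟨_, ?_, G, L, W, hm₄, ?_, rfl⟩
    · rw [htl, hlen, hV]
      omega
    rw [ha₃ 0 (by simp), ha₃ 1 (by simp), ha₃ 2 (by simp), h7₃]
    simp only [State.reg_setReg, State.arr_setReg, Nat.reduceEqDiff, if_false]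
    rw [ha₂ 0 (by simp), ha₂ 1 (by simp), ha₂ 2 (by simp), h7₂]
    have := hred.congr_pending (P' := fun u => u ∈ W) fun u _ hu => .inl (hW u hu)
    simpa [hs₁, EdgeList.initState] using this
  refine hready.loop.mono ?_
  rintro t₄ s₄ ⟨ht₄, h1, hS⟩
  simp only [wp_succ, wp_cond, wp_const, wp_block_nil, holds_eq, State.reg_setReg, if_true,
    Nat.reduceEqDiff, if_false, h1, OfNat.ofNat_ne_one]
  refine ⟨fun hb => ⟨by omega, fun _ => trivial, fun hn => absurd (hS.2 hb) hn⟩, fun hb =>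
    ⟨by omega, fun h => absurd (hS.1 h) hb, fun _ => trivial⟩⟩

end Ram

/-! ### From an arbitrary network to its numbered copy -/

namespace TwoTerminal

theorem GraphIso.symm {α α' β β' : Type*} {f : α' → α} {g : β' → β} {H : Graph α' β'}
    {G : Graph α β} (h : GraphIso f g H G) (f' : α → α') (g' : β → β')
    (hf : Set.InvOn f' f H.vertexSet G.vertexSet) (hg : Set.InvOn g' g H.edgeSet G.edgeSet) :
    GraphIso f' g' G H where
  bijV := h.bijV.symm hf.symm
  bijE := h.bijE.symm hg.symm
  isLink_iff e he x hx y hy := by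
    rw [h.isLink_iff _ ((h.bijE.symm hg.symm).mapsTo he) _ ((h.bijV.symm hf.symm).mapsTo hx) _
      ((h.bijV.symm hf.symm).mapsTo hy), hf.2 hx, hf.2 hy, hg.2 he]

end TwoTerminal

namespace EdgeList

open TwoTerminal

variable {α : Type*} {β : Type*} {G : Graph α β} {O D : α}

variable {I : EdgeList} {v : ℕ → α} {e : ℕ → β}

/-- The graph of numbers that corresponds to `G` if the vertices and edges of `G` are numbered by `v`
and `e`. -/
def toGraph (I : EdgeList) (G : Graph α β) (v : ℕ → α) (e : ℕ → β)
    (hv : Set.InjOn v (Set.Iio I.numV)) : Graph ℕ ℕ where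
  vertexSet := Set.Iio I.numV
  IsLink i x y := i < I.numE ∧ x < I.numV ∧ y < I.numV ∧ G.IsLink (e i) (v x) (v y)
  edgeSet := {i | ∃ x y, i < I.numE ∧ x < I.numV ∧ y < I.numV ∧ G.IsLink (e i) (v x) (v y)}
  isLink_symm _ _ := ⟨fun _ _ ⟨hi, hx, hy, h⟩ => ⟨hi, hy, hx, h.symm⟩⟩
  eq_or_eq_of_isLink_of_isLink _ _ _ _ _ h h' :=
    (h.2.2.2.left_eq_or_eq h'.2.2.2).imp (fun heq => hv h.2.1 h'.2.1 heq)
      fun heq => hv h.2.1 h'.2.2.1 heq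
  left_mem_of_isLink _ _ _ h := h.2.1

theorem graphIso_toGraph (hv : Set.BijOn v (Set.Iio I.numV) G.vertexSet)
    (he : Set.BijOn e (Set.Iio I.numE) G.edgeSet)
    (hl : ∀ i < I.numE, I.fst i < I.numV ∧ I.snd i < I.numV ∧
      G.IsLink (e i) (v (I.fst i)) (v (I.snd i))) :
    GraphIso v e (I.toGraph G v e hv.injOn) G := by
  have hE : (I.toGraph G v e hv.injOn).edgeSet = Set.Iio I.numE :=
    Set.ext fun i => ⟨fun ⟨_, _, hi, _⟩ => hi, fun hi => ⟨_, _, hi, hl i hi⟩⟩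
  exact ⟨hv, hE ▸ he, fun i hi x hx y hy => ⟨fun h => h.2.2.2, fun h => ⟨(Set.ext_iff.1 hE i).1 hi, hx, hy, h⟩⟩⟩

theorem Represents.decideSLI (hn : IsNetwork G O D) (hI : I.Represents G O D) :
    ∃ t s, Ram.Runs Ram.decideSLI I.initState t s ∧
      t ≤ 1200 * (G.edgeSet.ncard + G.vertexSet.ncard) ∧
      (IsSLI G O D → s.reg 0 = 1) ∧ (¬ IsSLI G O D → s.reg 0 = 0) := by
  have ncard_Iio : ∀ n : ℕ, (Set.Iio n).ncard = n := fun n => by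
    rw [Set.ncard_eq_toFinset_card', Set.toFinset_Iio, Nat.card_Iio]
  obtain ⟨v, e, hv, he, ho, hvo, hd, hvd, hl⟩ := hI
  have hcV : G.vertexSet.ncard = I.numV := by
    rw [← hv.image_eq, hv.injOn.ncard_image, ncard_Iio]
  have hcE : G.edgeSet.ncard = I.numE := by
    rw [← he.image_eq, he.injOn.ncard_image, ncard_Iio]
  have hiso := EdgeList.graphIso_toGraph hv he hl
  set H := I.toGraph G v e hv.injOn with hH
  have hE : H.edgeSet = Set.Iio I.numE :=
    Set.ext fun i => ⟨fun ⟨_, _, hi, _⟩ => hi, fun hi => ⟨_, _, hi, hl i hi⟩⟩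
  have hnH : IsNetwork H I.origin I.dest :=
    hiso.isNetwork (by rw [hvo, hvd]; exact hn) ho hd
  have := hnH.loopless
  have hlink : ∀ i < I.numE, H.IsLink i (I.fst i) (I.snd i) := fun i hi => ⟨hi, hl i hi⟩
  have harr : ∀ i < I.numE, I.initState.arr 0 i = I.fst i ∧ I.initState.arr 1 i = I.snd i :=
    fun i hi => by simp [EdgeList.initState, hi]
  have hst : ∀ i, I.initState.arr 2 i = 0 := fun i => by simp [EdgeList.initState]
  have hV : H.vertexSet.ncard = I.numV := ncard_Iio _
  obtain ⟨t, s, hr, ht, h⟩ := Ram.wp_decideSLI (S := IsSLI G O D) (G := H) I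
    (fun i hi => ⟨(hl i hi).1, (hl i hi).2.1, (hlink i hi).ne⟩) hV fun L hnd hmem => by
      refine ⟨hnH, ?_, fun u hu => hu, fun i => by simp [hE, hst], fun i hi => ?_, ?_, hnd,
        fun u i hi => ((hmem u i).1 hi).1, fun u i hi _ => ?_, fun u i hi => ?_, fun u hu => .inl hu⟩
      · rw [← isThickSLI_empty]
        constructor
        · intro hs
          -- Series decompositions are pulled back along isomorphisms, so the inverse numbering is
          -- needed for the way from numbers to `G`.
          have hinv := hiso.symm (Function.invFunOn v H.vertexSet) (Function.invFunOn e H.edgeSet)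
            hiso.bijV.invOn_invFunOn hiso.bijE.invOn_invFunOn
          exact hs.of_graphIso hinv (by simp) hn.origin_mem hn.dest_mem
            (hvo ▸ hiso.bijV.invOn_invFunOn.1 ho) (hvd ▸ hiso.bijV.invOn_invFunOn.1 hd)
        · intro hs
          exact hs.of_graphIso hiso (by simp [hst]) ho hd hvo hvd
      · rw [hE] at hi
        rw [(harr i hi).1, (harr i hi).2]
        exact hlink i hi
      · rw [hE, hV, ncard_Iio]
      · obtain ⟨hi, h | h⟩ := (hmem u i).1 hi
        · exact h ▸ (hlink i hi).inc_left
        · exact h ▸ (hlink i hi).inc_right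
      · have hi' : i < I.numE := (Set.ext_iff.1 hE i).1 hi.edge_mem
        exact (hmem u i).2 ⟨hi', (hi.eq_or_eq_of_isLink (hlink i hi')).imp Eq.symm Eq.symm⟩
  -- The additive constant is absorbed by the term for the vertices, since the origin guarantees
  -- that there is at least one.
  exact ⟨t, s, hr, by rw [hcV, hcE]; omega, h⟩

end EdgeList

theorem proposition3 :
    ∃ (P : Ram.Prog) (C : ℕ),
      ∀ (α : Type*) (β : Type*) (G : Graph α β) (O D : α),
        TwoTerminal.IsNetwork G O D →
        ∀ I : EdgeList, I.Represents G O D →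
          ∃ (t : ℕ) (s : Ram.State),
            Ram.Runs P I.initState t s ∧
            t ≤ C * (G.edgeSet.ncard + G.vertexSet.ncard) ∧
            (TwoTerminal.IsSLI G O D → s.reg 0 = 1) ∧
            (¬ TwoTerminal.IsSLI G O D → s.reg 0 = 0) := by
  exact ⟨Ram.decideSLI, 1200, fun _ _ _ _ _ hn _ hI => hI.decideSLI hn⟩
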